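/- **Setting.** Let $f_{ij}:\mathbb{R}^d\to\mathbb{R}$ ($i\in[n]$, $j\in[m]$, $n,m\ge 1$) be convex and $L$-smooth with $L>0$ (differentiable with $L$-Lipschitz gradient), $f_i=\frac1m\sum_j f_{ij}$, $f=\frac1n\sum_i f_i$. Assume that $f$ has a unique minimizer $x^*$ and is $\mu$-quasi strongly convex, $\mu\ge0$: $f(x^*)\ge f(x)+\langle\nabla f(x),x^*-x\rangle+\frac\mu2\|x-x^*\|^2$ for all $x$. Let $\mathcal C$ be a (possibly randomized) compression operator with $\mathbf E\|\mathcal C(x)-x\|^2\le(1-\delta)\|x\|^2$ for all $x$, where $\delta\in(0,1]$, and let $p\in(0,1)$. EC-LSVRG with stepsize $\gamma>0$ starts from $x^0$, $e_i^0=0$ and arbitrary deterministic $w_i^0$. In iteration $k$ worker $i$ draws $l$ uniformly from $[m]$ and sets $g_i^k=\nabla f_{il}(x^k)-\nabla f_{il}(w_i^k)+\nabla f_i(w_i^k)$, $v_i^k=\mathcal C(e_i^k+\gamma g_i^k)$, $e_i^{k+1}=e_i^k+\gamma g_i^k-v_i^k$, and $w_i^{k+1}=x^k$ with probability $p$, $w_i^{k+1}=w_i^k$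 otherwise; then $x^{k+1}=x^k-\frac1n\sum_i v_i^k$. The index, the coin and the randomness of $\mathcal C$ of a worker are independent, and the draws of different iterations are independent. Put $g^k=\frac1n\sum_i g_i^k$, $e^k=\frac1n\sum_i e_i^k$, let $\mathbf E_k$ be the conditional expectation given all randomness drawn before iteration $k$, $\bar g_i^k=\mathbf E_k[g_i^k]$, and $$\sigma_k^2=\tfrac1{nm}\sum_{i,j}\|\nabla f_{ij}(w_i^k)-\nabla f_{ij}(x^*)\|^2,\quad \zeta_*^2=\tfrac1n\sum_i\|\nabla f_i(x^*)\|^2,\quad D_1=2\zeta_*^2,\quad \eta=\min\{\tfrac{\gamma\mu}2,\tfrac p4\},$$ $$w_k=(1-\eta)^{-(k+1)},\quad W_K=\sum_{k=0}^Kw_k,\quad \bar x^K=\tfrac1{W_K}\sum_{k=0}^Kw_kx^k,\quad F_2=\frac{72L\gamma^2}{\delta p(1-\eta)},\quad D_3=\frac{12L\gamma}{\delta^2}D_1,$$ $$\gamma_0=\min\Big\{\frac1{24L},\frac{\delta}{8L\sqrt{3(2+3\delta(2+\frac1{1-p}))}}\Big\},\qquad a(\gamma)=\|x^0-x^*\|^2+\tfrac4p\gamma^2\sigma_0^2+\gamma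 F_2\sigma_0^2 .$$ **Theorem.** There is a universal constant $c\ge1$ such that, in this setting, the following holds. 1. Let $0<\gamma\le\gamma_0$. Then EC-LSVRG satisfies the parametric assumption of the error-feedback framework with $A=A'=2L$, $\widetilde A=12L$, $\widetilde B_2=3$, $B_2'=2$, $\rho_1=1$, $\rho_2=p$, $C_2=Lp$, $D_1,D_3,F_2$ as above, $\sigma_{1,k}^2\equiv0$, $\sigma_{2,k}^2=\sigma_k^2$ and all other constants $0$. That is, all (conditional) expectations below exist and, for all $k,K\ge0$, almost surely, $\mathbf E_k[g^k]=\nabla f(x^k)$ and $$\tfrac1n\sum_i\|\bar g_i^k\|^2\le4L(f(x^k)-f(x^*))+D_1,\qquad \tfrac1n\sum_i\mathbf E_k\|g_i^k-\bar g_i^k\|^2\le24L(f(x^k)-f(x^*))+3\sigma_k^2,$$ $$\mathbf E_k\|g^k\|^2\le4L(f(x^k)-f(x^*))+2\sigma_k^2,\qquad \mathbf E_k[\sigma_{k+1}^2]\le(1-p)\sigma_k^2+2Lp(f(x^k)-f(x^*)),$$ $$3L\sum_{k=0}^Kw_k\mathbf E\|e^k\|^2\le\tfrac14\sum_{k=0}^Kw_k\mathbf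 E[f(x^k)-f(x^*)]+F_2\sigma_0^2+\gamma D_3W_K.$$ Moreover $f(\bar x^K)-f(x^*)$ is integrable and $$\mathbf E[f(\bar x^K)-f(x^*)]\le(1-\eta)^K\,\frac{4a(\gamma)}{\gamma}+\frac{48L\gamma^2}{\delta^2}D_1\quad(K\ge0)\ \text{ if }\mu>0,$$ $$\mathbf E[f(\bar x^K)-f(x^*)]\le\frac{4a(\gamma)}{\gamma K}+\frac{48L\gamma^2}{\delta^2}D_1\quad(K\ge1)\ \text{ if }\mu=0.$$ 2. Let $\mu>0$, $\kappa=L/\mu$, $\gamma=\gamma_0$ and $0<\varepsilon<1$. If $K\ge c\big(\frac1p+\frac{\kappa}{\delta\sqrt{1-p}}\big)\ln\frac1\varepsilon$, then $\mathbf E[f(\bar x^K)-f(x^*)]\le\varepsilon\cdot\frac{4a(\gamma_0)}{\gamma_0}+96\,\frac{L\gamma_0^2\zeta_*^2}{\delta^2}$. 3. Let $\mu>0$, $m\ge2$, $p=\frac1m$, $a=a(\gamma_0)$. For $K\ge1$ put $\Lambda_K=\ln\max\{2,\frac{\delta^2a\mu^3K^3}{48LD_1}\}$ and use the stepsize $\gamma=\min\{\gamma_0,\frac{2\Lambda_K}{\mu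 K}\}$ for $K$ iterations; if $D_1=0$, use $\gamma=\gamma_0$ and read $\Lambda_K$ as $\ln2$. If $4m\Lambda_K\le K$, then $$\mathbf E[f(\bar x^K)-f(x^*)]\le c\Big(\frac L\delta\,a\,\exp\Big(-\frac1c\min\Big\{\frac{\delta\mu}L,\frac1m\Big\}K\Big)+\Lambda_K^2\,\frac{LD_1}{\delta^2\mu^2K^2}\Big).$$ Moreover, for every $\varepsilon>0$, with $B=m+\frac{L}{\delta\mu}+\frac{\sqrt{L\zeta_*^2}}{\delta\mu\sqrt\varepsilon}$, every $K\ge c\,B\ln\big(2+B+\frac{La}{\delta\varepsilon}\big)$ gives $\mathbf E[f(\bar x^K)-f(x^*)]\le\varepsilon$. -/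

import Mathlib

open MeasureTheory ProbabilityTheory

noncomputable section

namespace ECLSVRG

/-- The space `ℝ^d` with its Euclidean norm. -/
abbrev Vec (d : ℕ) : Type := EuclideanSpace ℝ (Fin d)

/-! ### The optimization problem -/

/-- `f_i(x) = (1/m) ∑_j f_{ij}(x)`. -/
def localObj {d n m : ℕ} (f : Fin n → Fin m → Vec d → ℝ) (i : Fin n) (x : Vec d) : ℝ :=
  (1 / (m : ℝ)) * ∑ j, f i j x

/-- `f(x) = (1/n) ∑_i f_i(x)`. -/
def globalObj {d n m : ℕ} (f : Fin n → Fin m → Vec d → ℝ) (x : Vec d) : ℝ :=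
  (1 / (n : ℝ)) * ∑ i, localObj f i x

/-- `h` is differentiable with `L`-Lipschitz gradient. -/
def IsLSmooth {d : ℕ} (L : ℝ) (h : Vec d → ℝ) : Prop :=
  Differentiable ℝ h ∧ ∀ x y, ‖gradient h x - gradient h y‖ ≤ L * ‖x - y‖

/-- `xs` is the unique minimizer of `h`, and `h` is strongly quasi-convex with parameter `μ ≥ 0`. -/
structure IsQuasiStronglyConvex {d : ℕ} (μ : ℝ) (h : Vec d → ℝ) (xs : Vec d) : Prop where
  mu_nonneg : 0 ≤ μ
  unique_min : ∀ x, x ≠ xs → h xs < h x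
  quasi : ∀ x, h x + inner ℝ (gradient h x) (xs - x) + μ / 2 * ‖x - xs‖ ^ 2 ≤ h xs

/-! ### Compression operators and the random draws of the method -/

/-- A (possibly randomized) compression operator `θ ↦ C θ`, with `θ` drawn from `ν`, satisfying
`E ‖C(x) - x‖² ≤ (1 - δ) ‖x‖²` for all `x`. -/
structure IsCompressor {d : ℕ} {Θ : Type*} [MeasurableSpace Θ] (ν : Measure Θ)
    (C : Θ → Vec d → Vec d) (δ : ℝ) : Prop where
  measurable : Measurable (Function.uncurry C)
  delta_pos : 0 < δ
  delta_le_one : δ ≤ 1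
  integrable : ∀ x, Integrable (fun θ => ‖C θ x - x‖ ^ 2) ν
  contraction : ∀ x, ∫ θ, ‖C θ x - x‖ ^ 2 ∂ν ≤ (1 - δ) * ‖x‖ ^ 2

/-- What one worker draws in one iteration: an index `l ∈ [m]`, the coin that decides whether the
reference point is refreshed, and the randomness of the compressor. -/
abbrev Seed (m : ℕ) (Θ : Type*) : Type _ := Fin m × Bool × Θ

/-- The law of one draw: `l` is uniform on `[m]`, the coin is `true` with probability `p`, the
randomness of the compressor has law `ν`, and the three are independent. -/
def seedLaw {Θ : Type*} [MeasurableSpace Θ] (m : ℕ) (p : ℝ) (ν : Measure Θ) :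
    Measure (Seed m Θ) :=
  (uniformOn (Set.univ : Set (Fin m))).prod
    ((ENNReal.ofReal p • Measure.dirac true + ENNReal.ofReal (1 - p) • Measure.dirac false).prod ν)

/-- `ξ k i` is the draw of worker `i` in iteration `k`. Every draw has the law `seedLaw m p ν`, and
the draws of different iterations are independent. (Draws of different workers in the same
iteration may, but need not, be independent.) -/
structure IsSampling {n m : ℕ} {Θ Ω : Type*} [MeasurableSpace Θ] [MeasurableSpace Ω]
    (P : Measure Ω) (p : ℝ) (ν : Measure Θ) (ξ : ℕ → Ω → Fin n → Seed m Θ) : Prop where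
  measurable : ∀ k, Measurable (ξ k)
  law : ∀ k i, P.map (fun ω => ξ k ω i) = seedLaw m p ν
  indep : iIndepFun ξ P

/-- The history before iteration `k`: all the randomness drawn in the iterations `0, …, k - 1`. -/
abbrev history {n m : ℕ} {Θ Ω : Type*} [MeasurableSpace Θ]
    (ξ : ℕ → Ω → Fin n → Seed m Θ) (k : ℕ) : MeasurableSpace Ω :=
  ⨆ t ∈ Set.Iio k, MeasurableSpace.comap (ξ t) inferInstance

/-! ### The method -/

/-- The state of the method at the beginning of an iteration: the iterate `x^k`, the errors
`e_i^k` and the reference points `w_i^k`. -/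
structure State (d n : ℕ) where
  x : Vec d
  e : Fin n → Vec d
  w : Fin n → Vec d

/-- `g_i = ∇f_{il}(x) - ∇f_{il}(w_i) + ∇f_i(w_i)`. -/
def gradEst {d n m : ℕ} (f : Fin n → Fin m → Vec d → ℝ) (s : State d n) (i : Fin n) (l : Fin m) :
    Vec d :=
  gradient (f i l) s.x - gradient (f i l) (s.w i) + gradient (localObj f i) (s.w i)

/-- One iteration of EC-LSVRG with stepsize `γ`, given the draws of all the workers. -/
def step {d n m : ℕ} {Θ : Type*} (f : Fin n → Fin m → Vec d → ℝ) (C : Θ → Vec d → Vec d) (γ : ℝ)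
    (s : State d n) (z : Fin n → Seed m Θ) : State d n :=
  let g : Fin n → Vec d := fun i => gradEst f s i (z i).1
  let v : Fin n → Vec d := fun i => C (z i).2.2 (s.e i + γ • g i)
  { x := s.x - (1 / (n : ℝ)) • ∑ i, v i
    e := fun i => s.e i + γ • g i - v i
    w := fun i => if (z i).2.1 = true then s.x else s.w i }

/-- The state at the beginning of iteration `k`, started from `x^0`, `e_i^0 = 0` and `w_i^0`. -/
def state {d n m : ℕ} {Θ Ω : Type*} (f : Fin n → Fin m → Vec d → ℝ) (C : Θ → Vec d → Vec d)
    (x0 : Vec d) (w0 : Fin n → Vec d) (ξ : ℕ → Ω → Fin n → Seed m Θ) (γ : ℝ) :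
    ℕ → Ω → State d n
  | 0, _ => ⟨x0, 0, w0⟩
  | k + 1, ω => step f C γ (state f C x0 w0 ξ γ k ω) (ξ k ω)

/-- The stochastic gradient `g_i^k` used by worker `i` in iteration `k`. -/
def stochGrad {d n m : ℕ} {Θ Ω : Type*} (f : Fin n → Fin m → Vec d → ℝ) (C : Θ → Vec d → Vec d)
    (x0 : Vec d) (w0 : Fin n → Vec d) (ξ : ℕ → Ω → Fin n → Seed m Θ) (γ : ℝ)
    (i : Fin n) (k : ℕ) (ω : Ω) : Vec d :=
  gradEst f (state f C x0 w0 ξ γ k ω) i (ξ k ω i).1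

/-- `(1/(nm)) ∑_i ∑_j ‖∇f_{ij}(w_i) - ∇f_{ij}(x*)‖²`. -/
def sigmaSq {d n m : ℕ} (f : Fin n → Fin m → Vec d → ℝ) (xs : Vec d) (w : Fin n → Vec d) : ℝ :=
  (1 / ((n : ℝ) * (m : ℝ))) * ∑ i, ∑ j, ‖gradient (f i j) (w i) - gradient (f i j) xs‖ ^ 2

/-- `w_k = (1 - η)^{-(k+1)}`. -/
def weight (η : ℝ) (k : ℕ) : ℝ := ((1 - η) ^ (k + 1))⁻¹

/-- `W_K = ∑_{k=0}^K w_k`. -/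
def weightSum (η : ℝ) (K : ℕ) : ℝ := ∑ k ∈ Finset.range (K + 1), weight η k

/-- The weighted average `(1/W_K) ∑_{k=0}^K w_k x^k`. -/
def weightedAvg {d : ℕ} (η : ℝ) (x : ℕ → Vec d) (K : ℕ) : Vec d :=
  (weightSum η K)⁻¹ • ∑ k ∈ Finset.range (K + 1), weight η k • x k

/-! ### The parametric assumption -/

/-- The constants of the parametric assumption; `At`, `B1t`, `B2t`, `D1t` are the constants with a
tilde, and `A'`, `B1'`, `B2'`, `D1'` those with a prime. -/
structure Params where
  A : ℝ
  At : ℝ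
  A' : ℝ
  B1 : ℝ
  B2 : ℝ
  B1t : ℝ
  B2t : ℝ
  B1' : ℝ
  B2' : ℝ
  C1 : ℝ
  C2 : ℝ
  G : ℝ
  D1 : ℝ
  D1t : ℝ
  D1' : ℝ
  D2 : ℝ
  D3 : ℝ
  F1 : ℝ
  F2 : ℝ
  ρ1 : ℝ
  ρ2 : ℝ

/-- All constants are nonnegative and `ρ₁, ρ₂ ∈ [0, 1]`. -/
structure Params.Admissible (c : Params) : Prop where
  hA : 0 ≤ c.A
  hAt : 0 ≤ c.At
  hA' : 0 ≤ c.A'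
  hB1 : 0 ≤ c.B1
  hB2 : 0 ≤ c.B2
  hB1t : 0 ≤ c.B1t
  hB2t : 0 ≤ c.B2t
  hB1' : 0 ≤ c.B1'
  hB2' : 0 ≤ c.B2'
  hC1 : 0 ≤ c.C1
  hC2 : 0 ≤ c.C2
  hG : 0 ≤ c.G
  hD1 : 0 ≤ c.D1
  hD1t : 0 ≤ c.D1t
  hD1' : 0 ≤ c.D1'
  hD2 : 0 ≤ c.D2
  hD3 : 0 ≤ c.D3
  hF1 : 0 ≤ c.F1
  hF2 : 0 ≤ c.F2
  hρ1 : c.ρ1 ∈ Set.Icc (0 : ℝ) 1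
  hρ2 : c.ρ2 ∈ Set.Icc (0 : ℝ) 1

/-- `η = min {γμ/2, ρ₁/4, ρ₂/4}`. -/
def Params.eta (c : Params) (γ μ : ℝ) : ℝ := min (γ * μ / 2) (min (c.ρ1 / 4) (c.ρ2 / 4))

/-- The parametric assumption on iterates `x^k`, stochastic gradients `g_i^k`, errors `e_i^k` and
sequences `σ_{1,k}²`, `σ_{2,k}²`, for the objective `F` with minimizer `xs`. The conditional
expectations are taken with respect to the history `ℋ k` before iteration `k`. The integrability
clauses make sure that all the (conditional) expectations exist. -/
structure ParametricAssumption {d n : ℕ} {Ω : Type*} [MeasurableSpace Ω] (P : Measure Ω)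
    (ℋ : ℕ → MeasurableSpace Ω) (F : Vec d → ℝ) (xs : Vec d) (L μ γ : ℝ)
    (x : ℕ → Ω → Vec d) (g e : Fin n → ℕ → Ω → Vec d) (σ1 σ2 : ℕ → Ω → ℝ) (c : Params) :
    Prop where
  admissible : c.Admissible
  adapted_x : ∀ k, Measurable[ℋ k] (x k)
  adapted_σ1 : ∀ k, Measurable[ℋ k] (σ1 k)
  adapted_σ2 : ∀ k, Measurable[ℋ k] (σ2 k)
  memLp_g : ∀ i k, MemLp (g i k) 2 P
  memLp_e : ∀ i k, MemLp (e i k) 2 P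
  integrable_F : ∀ k, Integrable (fun ω => F (x k ω) - F xs) P
  integrable_σ1 : ∀ k, Integrable (σ1 k) P
  integrable_σ2 : ∀ k, Integrable (σ2 k) P
  σ1_nonneg : ∀ k ω, 0 ≤ σ1 k ω
  σ2_nonneg : ∀ k ω, 0 ≤ σ2 k ω
  unbiased : ∀ k,
    P[fun ω => (1 / (n : ℝ)) • ∑ i, g i k ω | ℋ k] =ᵐ[P] fun ω => gradient F (x k ω)
  mean_bound : ∀ k, ∀ᵐ ω ∂P,
    (1 / (n : ℝ)) * ∑ i, ‖(P[g i k | ℋ k]) ω‖ ^ 2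
      ≤ 2 * c.A * (F (x k ω) - F xs) + c.B1 * σ1 k ω + c.B2 * σ2 k ω + c.D1
  variance_bound : ∀ k, ∀ᵐ ω ∂P,
    (1 / (n : ℝ)) * ∑ i, (P[fun ω' => ‖g i k ω' - (P[g i k | ℋ k]) ω'‖ ^ 2 | ℋ k]) ω
      ≤ 2 * c.At * (F (x k ω) - F xs) + c.B1t * σ1 k ω + c.B2t * σ2 k ω + c.D1t
  second_moment_bound : ∀ k, ∀ᵐ ω ∂P,
    (P[fun ω' => ‖(1 / (n : ℝ)) • ∑ i, g i k ω'‖ ^ 2 | ℋ k]) ω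
      ≤ 2 * c.A' * (F (x k ω) - F xs) + c.B1' * σ1 k ω + c.B2' * σ2 k ω + c.D1'
  sigma1_bound : ∀ k, ∀ᵐ ω ∂P,
    (P[σ1 (k + 1) | ℋ k]) ω
      ≤ (1 - c.ρ1) * σ1 k ω + 2 * c.C1 * (F (x k ω) - F xs) + c.G * c.ρ1 * σ2 k ω + c.D2
  sigma2_bound : ∀ k, ∀ᵐ ω ∂P,
    (P[σ2 (k + 1) | ℋ k]) ω ≤ (1 - c.ρ2) * σ2 k ω + 2 * c.C2 * (F (x k ω) - F xs)
  error_bound : ∀ K : ℕ,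
    3 * L * ∑ k ∈ Finset.range (K + 1),
        weight (c.eta γ μ) k * ∫ ω, ‖(1 / (n : ℝ)) • ∑ i, e i k ω‖ ^ 2 ∂P
      ≤ 1 / 4 * ∑ k ∈ Finset.range (K + 1),
          weight (c.eta γ μ) k * ∫ ω, (F (x k ω) - F xs) ∂P
        + c.F1 * ∫ ω, σ1 0 ω ∂P + c.F2 * ∫ ω, σ2 0 ω ∂P
        + γ * c.D3 * weightSum (c.eta γ μ) K

/-! ### The constants of the result -/

/-- `ζ_*² = (1/n) ∑_i ‖∇f_i(x*)‖²`. -/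
def zetaSq {d n m : ℕ} (f : Fin n → Fin m → Vec d → ℝ) (xs : Vec d) : ℝ :=
  (1 / (n : ℝ)) * ∑ i, ‖gradient (localObj f i) xs‖ ^ 2

/-- `D₁ = (2/n) ∑_i ‖∇f_i(x*)‖²`. -/
def D1 {d n m : ℕ} (f : Fin n → Fin m → Vec d → ℝ) (xs : Vec d) : ℝ := 2 * zetaSq f xs

/-- The largest stepsize
`γ₀ = min {1/(24L), δ / (8L √(3 (2 + 3δ (2 + 1/(1-p)))))}`. -/
def maxStep (L δ p : ℝ) : ℝ :=
  min (1 / (24 * L)) (δ / (8 * L * √(3 * (2 + 3 * δ * (2 + 1 / (1 - p))))))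

/-- `min {γμ/2, p/4}`. -/
def rate (γ μ p : ℝ) : ℝ := min (γ * μ / 2) (p / 4)

/-- `F₂ = 72 L γ² / (δ p (1 - min {γμ/2, p/4}))`. -/
def F2 (L μ δ p γ : ℝ) : ℝ := 72 * L * γ ^ 2 / (δ * p * (1 - rate γ μ p))

/-- `T⁰ + γ F₂ σ₀²`, where `T⁰ = ‖x⁰ - x*‖² + (4/p) γ² σ₀²`. -/
def initialGap {d n m : ℕ} (f : Fin n → Fin m → Vec d → ℝ) (xs x0 : Vec d) (w0 : Fin n → Vec d)
    (L μ δ p γ : ℝ) : ℝ :=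
  (‖x0 - xs‖ ^ 2 + 4 / p * γ ^ 2 * sigmaSq f xs w0) + γ * F2 L μ δ p γ * sigmaSq f xs w0

/-- The constants with which EC-LSVRG satisfies the parametric assumption. -/
def params {d n m : ℕ} (f : Fin n → Fin m → Vec d → ℝ) (xs : Vec d) (L μ δ p γ : ℝ) : Params where
  A := 2 * L
  At := 12 * L
  A' := 2 * L
  B1 := 0
  B2 := 0
  B1t := 0
  B2t := 3
  B1' := 0
  B2' := 2
  C1 := 0
  C2 := L * p
  G := 0
  D1 := D1 f xs
  D1t := 0
  D1' := 0
  D2 := 0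
  D3 := 12 * L * γ / δ ^ 2 * D1 f xs
  F1 := 0
  F2 := F2 L μ δ p γ
  ρ1 := 1
  ρ2 := p

/-- `E [f(x̄^K) - f(x*)]` for EC-LSVRG run with stepsize `γ`, where `x̄^K` is the average of
`x^0, …, x^K` with the weights `w_k = (1 - min {γμ/2, p/4})^{-(k+1)}`. -/
def expectedGap {d n m : ℕ} {Θ Ω : Type*} [MeasurableSpace Ω] (P : Measure Ω)
    (f : Fin n → Fin m → Vec d → ℝ) (C : Θ → Vec d → Vec d) (xs x0 : Vec d) (w0 : Fin n → Vec d)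
    (ξ : ℕ → Ω → Fin n → Seed m Θ) (μ p γ : ℝ) (K : ℕ) : ℝ :=
  ∫ ω, (globalObj f (weightedAvg (rate γ μ p) (fun k => (state f C x0 w0 ξ γ k ω).x) K)
    - globalObj f xs) ∂P

/-- The logarithmic factor `ln (max {2, δ² a μ³ K³ / (48 L D₁)})`, where `a` is `initialGap` at the
largest stepsize. Only used for `D₁ ≠ 0`. -/
def logFactor {d n m : ℕ} (f : Fin n → Fin m → Vec d → ℝ) (xs x0 : Vec d) (w0 : Fin n → Vec d)
    (L μ δ p : ℝ) (K : ℕ) : ℝ :=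
  Real.log (max 2 (δ ^ 2 * initialGap f xs x0 w0 L μ δ p (maxStep L δ p) * μ ^ 3 * (K : ℝ) ^ 3
    / (48 * L * D1 f xs)))

open Classical in
/-- The stepsize for a run of `K` iterations, `min {γ₀, 2 ln (max {2, δ² a μ³ K³ / (48 L D₁)}) / (μK)}`;
for `D₁ = 0` the logarithm is infinite and the stepsize is `γ₀`. -/
def tunedStep {d n m : ℕ} (f : Fin n → Fin m → Vec d → ℝ) (xs x0 : Vec d) (w0 : Fin n → Vec d)
    (L μ δ p : ℝ) (K : ℕ) : ℝ :=
  if D1 f xs = 0 then maxStep L δ p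
  else min (maxStep L δ p) (2 * logFactor f xs x0 w0 L μ δ p K / (μ * K))

/-- `m + L/(δμ) + √(L ζ_*²) / (δ μ √ε)`. -/
def complexity {d n m : ℕ} (f : Fin n → Fin m → Vec d → ℝ) (xs : Vec d) (L μ δ ε : ℝ) : ℝ :=
  (m : ℝ) + L / (δ * μ) + √(L * zetaSq f xs) / (δ * μ * √ε)

end ECLSVRG

end

namespace ECLSVRG

/-! ### Convex smooth functions -/

section Smooth

variable {d : ℕ} {L : ℝ} {h : Vec d → ℝ}

/-! The engine is the virtual iterate x̃ = x - (1/n) ∑ e_i. What the compressor drops from the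
transmitted vector is exactly what it adds to the error, so x̃ makes an uncompressed step -γg
(`virtual_step`). Its squared distance to x* therefore contracts, apart from 3Lγ‖e‖², the price of
evaluating the gradient at x instead of x̃, and γ²‖g‖² (`integral_norm_virtual_step_sub_sq_le`).

Co-coercivity of the components (`IsLSmooth.norm_gradient_sub_sq_le`) bounds the moments of g by the
gap f(x) - f(x*) and by σ²: after averaging, the linear terms cancel because ∇f(x*) = 0. Refreshing
the reference point with probability p makes σ² contract with factor 1 - p up to a multiple of the
gap, so the sampling noise dies out. What persists is D₁, which enters through the error: the error
contracts with factor 1 - δ/2, but is fed by local gradients that need not vanish at x*.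

Each recursion is summed with the weights w_k, for which (1-η)w_{k+1} = w_k, so that it telescopes
(`weighted_sum_le_of_recursion`). The restriction on γ makes the accumulated error cost at most a
quarter of the accumulated gap (`error_sum_le`). The Lyapunov function ‖x̃ - x*‖² + (4/p)γ²σ² then
leaves another quarter of the gap to be bounded (`weighted_gap_le`), and Jensen's inequality passes
to the averaged iterate.

On the probabilistic side, the state is a function of the history and the fresh draw is independent
of it. Conditional expectations are thus integrals over the draw with the state frozen
(`condExp_comp_prodMk`), and all estimates are proved for a fixed state. Workers may be dependent
within an iteration: only one-worker marginals are used, with Jensen's inequality across workers.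

The explicit rates follow from γ₀ ≥ δ√(1-p)/(48L) and from the step 2Λ/(μK), for which exp(-Λ) · a/γ
and the noise term are of comparable size. -/

lemma IsLSmooth.hasDerivAt_line (hh : IsLSmooth L h) (x v : Vec d) (t : ℝ) :
    HasDerivAt (fun s : ℝ => h (x + s • v)) (inner ℝ (gradient h (x + t • v)) v) t := by
  have h1 : HasDerivAt (fun s : ℝ => x + s • v) v t := by
    simpa using ((hasDerivAt_id t).smul_const v).const_add x
  have h2 := (hh.1 (x + t • v)).hasFDerivAt.comp_hasDerivAt t h1
  rw [inner_gradient_left]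
  exact h2

/-- Along the segment from x to y, the difference between h and its quadratic model has nonpositive
derivative by the Lipschitz bound, hence is antitone. -/
lemma IsLSmooth.le_quadratic (hh : IsLSmooth L h) (x y : Vec d) :
    h y ≤ h x + inner ℝ (gradient h x) (y - x) + L / 2 * ‖y - x‖ ^ 2 := by
  set v := y - x with hv
  have hanti : AntitoneOn
      (fun s : ℝ => h (x + s • v) - s * inner ℝ (gradient h x) v - L / 2 * ‖v‖ ^ 2 * s ^ 2)
      (Set.Icc 0 1) := by
    have hd : ∀ t : ℝ, HasDerivAt
        (fun s : ℝ => h (x + s • v) - s * inner ℝ (gradient h x) v - L / 2 * ‖v‖ ^ 2 * s ^ 2)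
        (inner ℝ (gradient h (x + t • v)) v - 1 * inner ℝ (gradient h x) v
          - L / 2 * ‖v‖ ^ 2 * (((2 : ℕ) : ℝ) * t ^ (2 - 1))) t := fun t =>
      ((hh.hasDerivAt_line x v t).sub ((hasDerivAt_id t).mul_const _)).sub
        ((hasDerivAt_pow 2 t).const_mul _)
    refine antitoneOn_of_deriv_nonpos (convex_Icc 0 1)
      (fun t _ => (hd t).continuousAt.continuousWithinAt)
      (fun t _ => (hd t).differentiableAt.differentiableWithinAt) ?_
    intro t ht
    rw [interior_Icc] at ht
    rw [(hd t).deriv]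
    have h1 : inner ℝ (gradient h (x + t • v) - gradient h x) v ≤ L * t * ‖v‖ ^ 2 := by
      refine (real_inner_le_norm _ _).trans ?_
      have := hh.2 (x + t • v) x
      rw [add_sub_cancel_left, norm_smul, Real.norm_of_nonneg ht.1.le] at this
      calc _ ≤ L * (t * ‖v‖) * ‖v‖ := by gcongr
        _ = _ := by ring
    rw [inner_sub_left] at h1
    simp only [Nat.cast_ofNat, Nat.add_one_sub_one, pow_one, one_mul]
    linarith
  have := hanti (Set.left_mem_Icc.2 zero_le_one) (Set.right_mem_Icc.2 zero_le_one) zero_le_one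
  simp only [one_smul, zero_smul, add_zero, hv, add_sub_cancel] at this
  simp only [hv]
  linarith

lemma IsLSmooth.inner_gradient_le (hh : IsLSmooth L h) (hc : ConvexOn ℝ Set.univ h)
    (x y : Vec d) : h x + inner ℝ (gradient h x) (y - x) ≤ h y := by
  set v := y - x with hv
  have hc' : ConvexOn ℝ Set.univ (fun s : ℝ => h (x + s • v)) := by
    have := hc.comp_affineMap (AffineMap.lineMap x y : ℝ →ᵃ[ℝ] Vec d)
    have e : (fun s : ℝ => h (x + s • v)) = h ∘ (AffineMap.lineMap x y : ℝ →ᵃ[ℝ] Vec d) := by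
      ext s
      simp [AffineMap.lineMap_apply, hv, add_comm]
    rw [e]
    exact this
  have h0 := hh.hasDerivAt_line x v 0
  have := hc'.le_slope_of_hasDerivAt (Set.mem_univ 0) (Set.mem_univ 1) zero_lt_one h0
  simp only [slope, zero_smul, add_zero, one_smul, vsub_eq_sub, sub_zero, inv_one, smul_eq_mul,
    one_mul, hv, add_sub_cancel] at this
  simp only [hv]
  linarith

/-- At the point z reached from x by a step 1/L along the gradient difference, the quadratic upper
bound based at x is compared with the convex lower bound based at y. -/
lemma IsLSmooth.norm_gradient_sub_sq_le (hL : 0 < L) (hh : IsLSmooth L h)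
    (hc : ConvexOn ℝ Set.univ h) (x y : Vec d) :
    ‖gradient h x - gradient h y‖ ^ 2
      ≤ 2 * L * (h x - h y - inner ℝ (gradient h y) (x - y)) := by
  set u := gradient h x - gradient h y with hu
  set z := x - (1 / L) • u with hz
  have h1 := hh.le_quadratic x z
  have h2 := hh.inner_gradient_le hc y z
  have e1 : z - x = -((1 / L) • u) := by rw [hz]; abel
  have e2 : z - y = (x - y) - (1 / L) • u := by rw [hz]; abel
  rw [e1, norm_neg, norm_smul, inner_neg_right, inner_smul_right,
    Real.norm_of_nonneg (by positivity)] at h1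
  rw [e2, inner_sub_right, inner_smul_right] at h2
  have h3 : inner ℝ (gradient h x) u - inner ℝ (gradient h y) u = ‖u‖ ^ 2 := by
    rw [← inner_sub_left, ← hu, real_inner_self_eq_norm_sq]
  have h4 : L / 2 * (1 / L * ‖u‖) ^ 2 = 1 / (2 * L) * ‖u‖ ^ 2 := by field_simp
  rw [h4] at h1
  have h5 : 1 / L * (‖u‖ ^ 2) - 1 / (2 * L) * ‖u‖ ^ 2
      ≤ h x - h y - inner ℝ (gradient h y) (x - y) := by
    have h7 : 1 / L * ‖u‖ ^ 2
        = 1 / L * inner ℝ (gradient h x) u - 1 / L * inner ℝ (gradient h y) u := by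
      rw [← h3]; ring
    linarith
  have h6 : 1 / L * (‖u‖ ^ 2) - 1 / (2 * L) * ‖u‖ ^ 2 = ‖u‖ ^ 2 / (2 * L) := by
    field_simp; ring
  rw [h6, div_le_iff₀ (by positivity)] at h5
  linarith

lemma IsLSmooth.continuous_gradient (hh : IsLSmooth L h) : Continuous (gradient h) := by
  -- No sign of L is assumed here; truncation only weakens the bound.
  have : LipschitzWith (Real.toNNReal L) (gradient h) := by
    refine LipschitzWith.of_dist_le_mul fun x y => ?_
    rw [dist_eq_norm, dist_eq_norm]
    exact (hh.2 x y).trans (by gcongr; exact Real.le_coe_toNNReal L)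
  exact this.continuous

end Smooth

/-! ### The averaged objectives and their behaviour at the minimizer. -/

section Objective

variable {d n m : ℕ} {L : ℝ} {f : Fin n → Fin m → Vec d → ℝ}

lemma hasGradientAt_average {ι : Type*} [Fintype ι] {h : ι → Vec d → ℝ} {g : ι → Vec d}
    {x : Vec d} (a : ℝ) (hh : ∀ i, HasGradientAt (h i) (g i) x) :
    HasGradientAt (fun y => a * ∑ i, h i y) (a • ∑ i, g i) x := by
  have h1 : HasFDerivAt (fun y => a * ∑ i, h i y)
      (a • ∑ i, InnerProductSpace.toDual ℝ (Vec d) (g i)) x :=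
    (HasFDerivAt.fun_sum fun i _ => (hh i).hasFDerivAt).const_mul a
  rw [hasGradientAt_iff_hasFDerivAt]
  have e : (InnerProductSpace.toDual ℝ (Vec d)) (a • ∑ i, g i)
      = a • ∑ i, InnerProductSpace.toDual ℝ (Vec d) (g i) := by simp
  rw [e]
  exact h1

lemma IsLSmooth.average {ι : Type*} [Fintype ι] [Nonempty ι] {h : ι → Vec d → ℝ}
    (hh : ∀ i, IsLSmooth L (h i)) :
    IsLSmooth L (fun y => 1 / (Fintype.card ι : ℝ) * ∑ i, h i y) := by
  have hg : ∀ x, HasGradientAt (fun y => 1 / (Fintype.card ι : ℝ) * ∑ i, h i y)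
      ((1 / (Fintype.card ι : ℝ)) • ∑ i, gradient (h i) x) x := fun x =>
    hasGradientAt_average _ fun i => ((hh i).1 x).hasGradientAt
  refine ⟨fun x => (hg x).differentiableAt, fun x y => ?_⟩
  rw [(hg x).gradient, (hg y).gradient, ← smul_sub, ← Finset.sum_sub_distrib, norm_smul,
    Real.norm_of_nonneg (by positivity)]
  have hcard : (0 : ℝ) < Fintype.card ι := by exact_mod_cast Fintype.card_pos
  calc _ ≤ 1 / (Fintype.card ι : ℝ) * ∑ i : ι, L * ‖x - y‖ := by
        gcongr
        exact norm_sum_le_of_le _ fun i _ => (hh i).2 x y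
    _ = _ := by
        rw [Finset.sum_const, Finset.card_univ, nsmul_eq_mul]
        field_simp

lemma convexOn_average {ι : Type*} [Fintype ι] {h : ι → Vec d → ℝ} {a : ℝ} (ha : 0 ≤ a)
    (hh : ∀ i, ConvexOn ℝ Set.univ (h i)) :
    ConvexOn ℝ Set.univ (fun y => a * ∑ i, h i y) := by
  have : ConvexOn ℝ Set.univ (fun y => ∑ i, h i y) := by
    refine ⟨convex_univ, fun x _ y _ s t hs ht hst => ?_⟩
    simp only [smul_eq_mul, Finset.mul_sum, ← Finset.sum_add_distrib]
    exact Finset.sum_le_sum fun i _ => (hh i).2 (Set.mem_univ x) (Set.mem_univ y) hs ht hst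
  exact this.smul ha

lemma isLSmooth_localObj (hm : 0 < m) (hs : ∀ i j, IsLSmooth L (f i j)) (i : Fin n) :
    IsLSmooth L (localObj f i) := by
  have : Nonempty (Fin m) := ⟨⟨0, hm⟩⟩
  have := IsLSmooth.average (fun j => hs i j)
  rwa [Fintype.card_fin] at this

lemma isLSmooth_globalObj (hn : 0 < n) (hm : 0 < m) (hs : ∀ i j, IsLSmooth L (f i j)) :
    IsLSmooth L (globalObj f) := by
  have : Nonempty (Fin n) := ⟨⟨0, hn⟩⟩
  have := IsLSmooth.average (fun i => isLSmooth_localObj hm hs i)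
  rwa [Fintype.card_fin] at this

lemma convexOn_localObj (hc : ∀ i j, ConvexOn ℝ Set.univ (f i j)) (i : Fin n) :
    ConvexOn ℝ Set.univ (localObj f i) :=
  convexOn_average (by positivity) (hc i)

lemma convexOn_globalObj (hc : ∀ i j, ConvexOn ℝ Set.univ (f i j)) :
    ConvexOn ℝ Set.univ (globalObj f) :=
  convexOn_average (by positivity) (convexOn_localObj hc)

lemma gradient_localObj (hs : ∀ i j, IsLSmooth L (f i j)) (i : Fin n) (x : Vec d) :
    gradient (localObj f i) x = (1 / (m : ℝ)) • ∑ j, gradient (f i j) x :=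
  (hasGradientAt_average _ fun j => ((hs i j).1 x).hasGradientAt).gradient

lemma gradient_globalObj (hm : 0 < m) (hs : ∀ i j, IsLSmooth L (f i j)) (x : Vec d) :
    gradient (globalObj f) x = (1 / (n : ℝ)) • ∑ i, gradient (localObj f i) x :=
  (hasGradientAt_average _ fun i => ((isLSmooth_localObj hm hs i).1 x).hasGradientAt).gradient

section QuasiStronglyConvex

variable {μ : ℝ} {xs : Vec d}

lemma IsQuasiStronglyConvex.le {h : Vec d → ℝ} (hq : IsQuasiStronglyConvex μ h xs) (x : Vec d) :
    h xs ≤ h x := by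
  by_cases hx : x = xs
  · rw [hx]
  · exact (hq.unique_min x hx).le

lemma IsQuasiStronglyConvex.gradient_eq_zero {h : Vec d → ℝ}
    (hq : IsQuasiStronglyConvex μ h xs) : gradient h xs = 0 := by
  have : fderiv ℝ h xs = 0 := IsLocalMin.fderiv_eq_zero (Filter.Eventually.of_forall hq.le)
  simp [gradient, this]

/-- Quasi strong convexity and smoothness bound the same value h(x*) from the two sides of the
linearization at x* + v. The factor ‖v‖² stays because μ ≤ L may fail when d = 0. -/
lemma IsQuasiStronglyConvex.mul_norm_sq_le {h : Vec d → ℝ} (hq : IsQuasiStronglyConvex μ h xs)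
    (hs : IsLSmooth L h) (v : Vec d) : μ * ‖v‖ ^ 2 ≤ L * ‖v‖ ^ 2 := by
  have h1 := hq.quasi (xs + v)
  have h2 := hs.le_quadratic (xs + v) xs
  rw [norm_sub_rev] at h2
  rw [add_sub_cancel_left] at h1 h2
  linarith

/-- The gradients of the components deviate from those at the minimizer by at most the gap. -/
lemma average_norm_gradient_sub_sq_le (hL : 0 < L) (hn : 0 < n) (hm : 0 < m)
    (hc : ∀ i j, ConvexOn ℝ Set.univ (f i j)) (hs : ∀ i j, IsLSmooth L (f i j))
    (hq : IsQuasiStronglyConvex μ (globalObj f) xs) (x : Vec d) :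
    (1 / (n : ℝ)) * ∑ i, (1 / (m : ℝ)) * ∑ j, ‖gradient (f i j) x - gradient (f i j) xs‖ ^ 2
      ≤ 2 * L * (globalObj f x - globalObj f xs) := by
  have key : ∀ i, (1 / (m : ℝ)) * ∑ j, ‖gradient (f i j) x - gradient (f i j) xs‖ ^ 2
      ≤ 2 * L * (localObj f i x - localObj f i xs
          - inner ℝ (gradient (localObj f i) xs) (x - xs)) := by
    intro i
    rw [gradient_localObj hs, inner_smul_left, sum_inner]
    simp only [localObj, conj_trivial, ← mul_sub, ← Finset.sum_sub_distrib]
    rw [mul_left_comm, Finset.mul_sum (a := 2 * L)]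
    gcongr with j _
    exact (hs i j).norm_gradient_sub_sq_le hL (hc i j) x xs
  calc _ ≤ (1 / (n : ℝ)) * ∑ i, 2 * L * (localObj f i x - localObj f i xs
          - inner ℝ (gradient (localObj f i) xs) (x - xs)) := by
        exact mul_le_mul_of_nonneg_left (Finset.sum_le_sum fun i _ => key i) (by positivity)
    _ = 2 * L * (globalObj f x - globalObj f xs
          - inner ℝ (gradient (globalObj f) xs) (x - xs)) := by
        rw [gradient_globalObj hm hs, inner_smul_left, sum_inner]
        simp only [globalObj, conj_trivial, ← mul_sub, ← Finset.sum_sub_distrib]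
        rw [mul_left_comm, Finset.mul_sum (a := 2 * L)]
    -- The linear terms have been collected into a pairing with ∇f(x*), which is zero.
    _ = _ := by rw [hq.gradient_eq_zero, inner_zero_left, sub_zero]

end QuasiStronglyConvex

end Objective

/-! ### Freezing an independent variable -/

section Freezing

variable {Ω S T E : Type*} {mH : MeasurableSpace Ω} [mΩ : MeasurableSpace Ω] [MeasurableSpace S] [MeasurableSpace T]
  {P : Measure Ω} [IsProbabilityMeasure P] {X : Ω → S} {Z : Ω → T}
  [NormedAddCommGroup E]

lemma map_prodMk_eq_prod (hle : mH ≤ mΩ) (hX : Measurable[mH] X)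
    (hZ : Measurable Z) (hind : Indep mH (MeasurableSpace.comap Z inferInstance) P) :
    P.map (fun ω => (X ω, Z ω)) = (P.map X).prod (P.map Z) := by
  rw [← indepFun_iff_map_prod_eq_prod_map_map (hX.mono hle le_rfl).aemeasurable hZ.aemeasurable]
  exact indep_of_indep_of_le_left hind hX.comap_le

lemma integrable_comp_prodMk (hle : mH ≤ mΩ) (hX : Measurable[mH] X)
    (hZ : Measurable Z) (hind : Indep mH (MeasurableSpace.comap Z inferInstance) P)
    {Φ : S × T → E} (hΦ : StronglyMeasurable Φ)
    (h1 : ∀ s, Integrable (fun z => Φ (s, z)) (P.map Z))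
    (h2 : Integrable (fun ω => ∫ z, ‖Φ (X ω, z)‖ ∂(P.map Z)) P) :
    Integrable (fun ω => Φ (X ω, Z ω)) P := by
  have hX' := hX.mono hle le_rfl
  have := Measure.isProbabilityMeasure_map (μ := P) hX'.aemeasurable
  have := Measure.isProbabilityMeasure_map (μ := P) hZ.aemeasurable
  have hm := map_prodMk_eq_prod hle hX hZ hind
  have : Integrable Φ (P.map (fun ω => (X ω, Z ω))) := by
    rw [hm, integrable_prod_iff hΦ.aestronglyMeasurable]
    refine ⟨Filter.Eventually.of_forall h1, ?_⟩
    exact (integrable_map_measure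
      (hΦ.norm.integral_prod_right' (ν := P.map Z)).aestronglyMeasurable hX'.aemeasurable).2 h2
  exact (integrable_map_measure hΦ.aestronglyMeasurable (hX'.prodMk hZ).aemeasurable).1 this

variable [NormedSpace ℝ E]

lemma integral_comp_prodMk (hle : mH ≤ mΩ) (hX : Measurable[mH] X)
    (hZ : Measurable Z) (hind : Indep mH (MeasurableSpace.comap Z inferInstance) P)
    {Φ : S × T → E} (hΦ : StronglyMeasurable Φ)
    (hint : Integrable (fun ω => Φ (X ω, Z ω)) P) :
    Integrable (fun ω => ∫ z, Φ (X ω, z) ∂(P.map Z)) P ∧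
      ∫ ω, Φ (X ω, Z ω) ∂P = ∫ ω, ∫ z, Φ (X ω, z) ∂(P.map Z) ∂P := by
  have hX' := hX.mono hle le_rfl
  have := Measure.isProbabilityMeasure_map (μ := P) hX'.aemeasurable
  have := Measure.isProbabilityMeasure_map (μ := P) hZ.aemeasurable
  have hm := map_prodMk_eq_prod hle hX hZ hind
  have h1 : Integrable Φ ((P.map X).prod (P.map Z)) := by
    rw [← hm]
    exact (integrable_map_measure hΦ.aestronglyMeasurable (hX'.prodMk hZ).aemeasurable).2 hint
  have h2 := (hΦ.integral_prod_right' (ν := P.map Z)).aestronglyMeasurable (μ := P.map X)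
  refine ⟨(integrable_map_measure h2 hX'.aemeasurable).1 h1.integral_prod_left, ?_⟩
  rw [← integral_map (hX'.prodMk hZ).aemeasurable hΦ.aestronglyMeasurable, hm,
    integral_prod _ h1, integral_map hX'.aemeasurable h2]

/-- If `X` is measurable with respect to `mH` and `Z` is independent of `mH`, then the conditional
expectation of `Φ (X, Z)` given `mH` integrates out `Z`. -/
lemma condExp_comp_prodMk [CompleteSpace E] (hle : mH ≤ mΩ)
    (hX : Measurable[mH] X)
    (hZ : Measurable Z) (hind : Indep mH (MeasurableSpace.comap Z inferInstance) P)
    {Φ : S × T → E} (hΦ : StronglyMeasurable Φ)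
    (hint : Integrable (fun ω => Φ (X ω, Z ω)) P) :
    P[fun ω => Φ (X ω, Z ω) | mH] =ᵐ[P] fun ω => ∫ z, Φ (X ω, z) ∂(P.map Z) := by
  have := Measure.isProbabilityMeasure_map (μ := P) hZ.aemeasurable
  have hint' := (integral_comp_prodMk hle hX hZ hind hΦ hint).1
  refine (ae_eq_condExp_of_forall_setIntegral_eq hle hint (fun A _ _ => hint'.integrableOn)
    (fun A hA _ => ?_) ?_).symm
  -- The indicator of the history event A is adjoined to X as a second frozen coordinate; the
  -- integral over A is then an instance of the unconditional Fubini statement.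
  · set b : Ω → ℝ := A.indicator (fun _ => 1) with hb
    have hbm : Measurable[mH] b := measurable_const.indicator hA
    have hXb : Measurable[mH] (fun ω => (X ω, b ω)) := hX.prodMk hbm
    have hΨ : StronglyMeasurable (fun q : (S × ℝ) × T => q.1.2 • Φ (q.1.1, q.2)) := by
      refine StronglyMeasurable.smul (by fun_prop : Measurable _).stronglyMeasurable ?_
      exact hΦ.comp_measurable (by fun_prop)
    have e : ∀ (F : Ω → E), A.indicator F = fun ω => b ω • F ω := by
      intro F
      ext ω
      by_cases h : ω ∈ A <;> simp [hb, h]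
    have hi : Integrable (fun ω => b ω • Φ (X ω, Z ω)) P := by
      rw [← e]
      exact hint.indicator (hle _ hA)
    have key := (integral_comp_prodMk hle hXb hZ hind hΨ hi).2
    rw [← integral_indicator (hle _ hA), ← integral_indicator (hle _ hA), e, e, key]
    simp only [integral_smul]
  · exact ((hΦ.integral_prod_right' (ν := P.map Z)).comp_measurable hX).aestronglyMeasurable

end Freezing

/-! ### The law of one draw -/

section SeedLaw

variable {Θ : Type*} [MeasurableSpace Θ] {ν : Measure Θ} [IsProbabilityMeasure ν] {m : ℕ} {p : ℝ}

lemma uniformOn_univ_eq_sum (m : ℕ) :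
    uniformOn (Set.univ : Set (Fin m))
      = ∑ l : Fin m, ENNReal.ofReal (1 / (m : ℝ)) • Measure.dirac l := by
  rcases Nat.eq_zero_or_pos m with rfl | hm
  · ext s
    simp [Set.eq_empty_of_isEmpty s]
  refine Measure.ext_of_singleton fun l => ?_
  rw [uniformOn_univ, Measure.count_singleton, Fintype.card_fin, Measure.finsetSum_apply]
  simp only [Measure.smul_apply, smul_eq_mul, Measure.dirac_apply, Set.indicator_apply,
    Set.mem_singleton_iff, Pi.one_apply, mul_ite, mul_one, mul_zero, Finset.sum_ite_eq',
    Finset.mem_univ, if_true]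
  rw [ENNReal.ofReal_div_of_pos (by exact_mod_cast hm)]
  simp

/-- Index and coin take finitely many values, so the law is a finite mixture of copies of ν;
integrability has to be checked only in the randomness of the compressor. -/
lemma seedLaw_eq_sum (m : ℕ) (p : ℝ) :
    seedLaw m p ν = ∑ l : Fin m, ENNReal.ofReal (1 / (m : ℝ)) •
      (ENNReal.ofReal p • ν.map (fun θ => ((l, true, θ) : Seed m Θ))
        + ENNReal.ofReal (1 - p) • ν.map (fun θ => ((l, false, θ) : Seed m Θ))) := by
  rw [seedLaw, uniformOn_univ_eq_sum, ← Measure.sum_fintype, Measure.prod_sum_left,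
    Measure.sum_fintype]
  refine Finset.sum_congr rfl fun l _ => ?_
  rw [Measure.prod_smul_left, Measure.dirac_prod, Measure.add_prod, Measure.prod_smul_left,
    Measure.prod_smul_left, Measure.dirac_prod, Measure.dirac_prod,
    Measure.map_add _ _ (by fun_prop), Measure.map_smul, Measure.map_smul,
    Measure.map_map (by fun_prop) (by fun_prop), Measure.map_map (by fun_prop) (by fun_prop)]
  rfl

variable {E : Type*} [NormedAddCommGroup E]

lemma integrable_seedLaw {h : Seed m Θ → E} (hm : StronglyMeasurable h)
    (hi : ∀ l b, Integrable (fun θ => h (l, b, θ)) ν) : Integrable h (seedLaw m p ν) := by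
  rw [seedLaw_eq_sum]
  refine integrable_finsetSum_measure.2 fun l _ => Integrable.smul_measure ?_ ENNReal.ofReal_ne_top
  have key : ∀ b, Integrable h (ν.map (fun θ => ((l, b, θ) : Seed m Θ))) := fun b =>
    (integrable_map_measure hm.aestronglyMeasurable (by fun_prop)).2 (hi l b)
  exact ((key true).smul_measure ENNReal.ofReal_ne_top).add_measure
    ((key false).smul_measure ENNReal.ofReal_ne_top)

variable [NormedSpace ℝ E]

lemma integral_seedLaw (hp0 : 0 ≤ p) (hp1 : p ≤ 1) {h : Seed m Θ → E} (hm : StronglyMeasurable h)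
    (hi : ∀ l b, Integrable (fun θ => h (l, b, θ)) ν) :
    ∫ s, h s ∂(seedLaw m p ν) = (1 / (m : ℝ)) • ∑ l, (p • ∫ θ, h (l, true, θ) ∂ν
      + (1 - p) • ∫ θ, h (l, false, θ) ∂ν) := by
  have key : ∀ l b, Integrable h (ν.map (fun θ => ((l, b, θ) : Seed m Θ))) := fun l b =>
    (integrable_map_measure hm.aestronglyMeasurable (by fun_prop)).2 (hi l b)
  rw [seedLaw_eq_sum, integral_finsetSum_measure, Finset.smul_sum]
  · refine Finset.sum_congr rfl fun l _ => ?_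
    rw [integral_smul_measure, ENNReal.toReal_ofReal (by positivity),
      integral_add_measure ((key l true).smul_measure ENNReal.ofReal_ne_top)
        ((key l false).smul_measure ENNReal.ofReal_ne_top), integral_smul_measure,
      integral_smul_measure, ENNReal.toReal_ofReal hp0, ENNReal.toReal_ofReal (by linarith),
      integral_map (by fun_prop) hm.aestronglyMeasurable,
      integral_map (by fun_prop) hm.aestronglyMeasurable]
  · refine fun l _ => Integrable.smul_measure ?_ ENNReal.ofReal_ne_top
    exact ((key l true).smul_measure ENNReal.ofReal_ne_top).add_measure
      ((key l false).smul_measure ENNReal.ofReal_ne_top)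

end SeedLaw
/-! ### Averages of vectors -/

section Average

variable {E : Type*} [NormedAddCommGroup E]

lemma average_linear_combination {n : ℕ} (a b : ℝ) (F G : Fin n → ℝ) :
    (1 / (n : ℝ)) * ∑ i, (a * F i + b * G i)
      = a * ((1 / (n : ℝ)) * ∑ i, F i) + b * ((1 / (n : ℝ)) * ∑ i, G i) := by
  rw [Finset.sum_add_distrib, ← Finset.mul_sum, ← Finset.mul_sum]
  ring

lemma norm_add_sq_le_young {α : ℝ} (hα : 0 < α) (a b : E) :
    ‖a + b‖ ^ 2 ≤ (1 + α) * ‖a‖ ^ 2 + (1 + 1 / α) * ‖b‖ ^ 2 := by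
  have h1 : ‖a + b‖ ^ 2 ≤ (‖a‖ + ‖b‖) ^ 2 := by gcongr; exact norm_add_le a b
  have h2 : 2 * (‖a‖ * ‖b‖) ≤ α * ‖a‖ ^ 2 + 1 / α * ‖b‖ ^ 2 := by
    have : α * ‖a‖ ^ 2 + 1 / α * ‖b‖ ^ 2 - 2 * (‖a‖ * ‖b‖) = (α * ‖a‖ - ‖b‖) ^ 2 / α := by
      field_simp
      ring
    have h3 : 0 ≤ (α * ‖a‖ - ‖b‖) ^ 2 / α := by positivity
    linarith
  nlinarith

lemma norm_sub_sq_le_two_mul (a b : E) : ‖a - b‖ ^ 2 ≤ 2 * ‖a‖ ^ 2 + 2 * ‖b‖ ^ 2 := by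
  have := norm_add_sq_le_young one_pos a (-b)
  rw [norm_neg, ← sub_eq_add_neg] at this
  linarith

variable [InnerProductSpace ℝ E]

/-- The bias-variance identity. Dropping one of its two squares gives the two inequalities below,
one of which is Jensen's inequality for the squared norm. -/
lemma average_norm_sub_average_sq {m : ℕ} (hm : 0 < m) (y : Fin m → E) :
    (1 / (m : ℝ)) * ∑ l, ‖y l - (1 / (m : ℝ)) • ∑ j, y j‖ ^ 2
      = (1 / (m : ℝ)) * ∑ l, ‖y l‖ ^ 2 - ‖(1 / (m : ℝ)) • ∑ j, y j‖ ^ 2 := by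
  have hm' : (m : ℝ) ≠ 0 := by positivity
  set a := (1 / (m : ℝ)) • ∑ j, y j with ha
  have h1 : ∑ l, inner ℝ (y l) a = m * ‖a‖ ^ 2 := by
    have h2 : ∑ j, y j = (m : ℝ) • a := by rw [ha, smul_smul, mul_one_div_cancel hm', one_smul]
    rw [← sum_inner, h2, inner_smul_left, real_inner_self_eq_norm_sq, conj_trivial]
  simp only [norm_sub_sq_real, Finset.sum_add_distrib, Finset.sum_sub_distrib, ← Finset.mul_sum, h1]
  simp only [Finset.sum_const, Finset.card_univ, Fintype.card_fin, nsmul_eq_mul]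
  field_simp
  ring

lemma average_norm_sub_average_sq_le {m : ℕ} (hm : 0 < m) (y : Fin m → E) :
    (1 / (m : ℝ)) * ∑ l, ‖y l - (1 / (m : ℝ)) • ∑ j, y j‖ ^ 2
      ≤ (1 / (m : ℝ)) * ∑ l, ‖y l‖ ^ 2 := by
  rw [average_norm_sub_average_sq hm]
  have := sq_nonneg ‖(1 / (m : ℝ)) • ∑ j, y j‖
  linarith

lemma norm_average_sq_le {m : ℕ} (hm : 0 < m) (y : Fin m → E) :
    ‖(1 / (m : ℝ)) • ∑ j, y j‖ ^ 2 ≤ (1 / (m : ℝ)) * ∑ l, ‖y l‖ ^ 2 := by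
  have h1 := average_norm_sub_average_sq hm y
  have h2 : 0 ≤ (1 / (m : ℝ)) * ∑ l, ‖y l - (1 / (m : ℝ)) • ∑ j, y j‖ ^ 2 := by positivity
  linarith

end Average

/-! ### Integrals over the draws of one iteration -/

section Draws

variable {n m : ℕ} {p : ℝ} {Θ : Type*} [MeasurableSpace Θ] {ν : Measure Θ}
  [IsProbabilityMeasure ν] {Q : Measure (Fin n → Seed m Θ)}
  {E : Type*} [NormedAddCommGroup E]

/-- Here `Q` is the joint law of the draws of all workers. Only its marginals are prescribed, so
only functions of a single coordinate have an explicit integral. -/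
lemma integrable_eval (hQ : ∀ i, Q.map (fun z => z i) = seedLaw m p ν) (i : Fin n)
    {h : Seed m Θ → E} (hm : StronglyMeasurable h)
    (hi : ∀ l b, Integrable (fun θ => h (l, b, θ)) ν) : Integrable (fun z => h (z i)) Q := by
  have := integrable_seedLaw (p := p) hm hi
  rw [← hQ i] at this
  exact (integrable_map_measure hm.aestronglyMeasurable (measurable_pi_apply i).aemeasurable).1 this

lemma integrable_eval_index (hQ : ∀ i, Q.map (fun z => z i) = seedLaw m p ν) (i : Fin n)
    (h : Fin m → Bool → E) : Integrable (fun z => h (z i).1 (z i).2.1) Q :=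
  integrable_eval hQ i (h := fun s => h s.1 s.2.1)
    ((StronglyMeasurable.of_discrete (f := fun q : Fin m × Bool => h q.1 q.2)).comp_measurable
      (g := fun s : Seed m Θ => (s.1, s.2.1)) (by fun_prop)) fun l b => integrable_const (h l b)

variable [NormedSpace ℝ E]

lemma integral_eval (hp0 : 0 ≤ p) (hp1 : p ≤ 1)
    (hQ : ∀ i, Q.map (fun z => z i) = seedLaw m p ν) (i : Fin n)
    {h : Seed m Θ → E} (hm : StronglyMeasurable h)
    (hi : ∀ l b, Integrable (fun θ => h (l, b, θ)) ν) :
    ∫ z, h (z i) ∂Q = (1 / (m : ℝ)) • ∑ l, (p • ∫ θ, h (l, true, θ) ∂ν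
      + (1 - p) • ∫ θ, h (l, false, θ) ∂ν) := by
  rw [← integral_seedLaw hp0 hp1 hm hi, ← hQ i,
    integral_map (measurable_pi_apply i).aemeasurable hm.aestronglyMeasurable]

variable [CompleteSpace E]

lemma integral_eval_index_coin (hp0 : 0 ≤ p) (hp1 : p ≤ 1)
    (hQ : ∀ i, Q.map (fun z => z i) = seedLaw m p ν) (i : Fin n) (h : Fin m → Bool → E) :
    ∫ z, h (z i).1 (z i).2.1 ∂Q
      = (1 / (m : ℝ)) • ∑ l, (p • h l true + (1 - p) • h l false) := by
  have := integral_eval hp0 hp1 hQ i (h := fun s => h s.1 s.2.1)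
    ((StronglyMeasurable.of_discrete (f := fun q : Fin m × Bool => h q.1 q.2)).comp_measurable
      (g := fun s : Seed m Θ => (s.1, s.2.1)) (by fun_prop)) fun l b => integrable_const (h l b)
  simpa using this

lemma integral_eval_index (hp0 : 0 ≤ p) (hp1 : p ≤ 1)
    (hQ : ∀ i, Q.map (fun z => z i) = seedLaw m p ν) (i : Fin n) (h : Fin m → E) :
    ∫ z, h (z i).1 ∂Q = (1 / (m : ℝ)) • ∑ l, h l := by
  rw [integral_eval_index_coin hp0 hp1 hQ i (fun l _ => h l)]
  simp [← add_smul]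

lemma integral_eval_coin (hm : 0 < m) (hp0 : 0 ≤ p) (hp1 : p ≤ 1)
    (hQ : ∀ i, Q.map (fun z => z i) = seedLaw m p ν) (i : Fin n) (h : Bool → E) :
    ∫ z, h (z i).2.1 ∂Q = p • h true + (1 - p) • h false := by
  have hm' : (m : ℝ) ≠ 0 := by positivity
  rw [integral_eval_index_coin hp0 hp1 hQ i (fun _ b => h b), Finset.sum_const, Finset.card_univ,
    Fintype.card_fin, ← Nat.cast_smul_eq_nsmul ℝ, smul_smul, one_div_mul_cancel hm', one_smul]

end Draws

/-! ### One iteration from a fixed state -/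

section OneStep

variable {d n m : ℕ} {L μ p : ℝ} {f : Fin n → Fin m → Vec d → ℝ} {xs : Vec d}

lemma average_gradEst (hm : 0 < m) (hs : ∀ i j, IsLSmooth L (f i j)) (s : State d n) (i : Fin n) :
    (1 / (m : ℝ)) • ∑ l, gradEst f s i l = gradient (localObj f i) s.x := by
  have hm' : (m : ℝ) ≠ 0 := by positivity
  simp only [gradEst, Finset.sum_add_distrib, Finset.sum_sub_distrib, smul_add, smul_sub,
    ← gradient_localObj hs]
  rw [Finset.sum_const, Finset.card_univ,
    Fintype.card_fin, ← Nat.cast_smul_eq_nsmul ℝ, smul_smul, one_div_mul_cancel hm', one_smul]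
  abel

lemma sigmaSq_eq (xs : Vec d) (w : Fin n → Vec d) :
    sigmaSq f xs w = (1 / (n : ℝ)) * ∑ i, (1 / (m : ℝ)) *
      ∑ j, ‖gradient (f i j) (w i) - gradient (f i j) xs‖ ^ 2 := by
  rw [sigmaSq, ← Finset.mul_sum, ← mul_assoc, one_div_mul_one_div]

lemma sigmaSq_nonneg (xs : Vec d) (w : Fin n → Vec d) : 0 ≤ sigmaSq f xs w := by
  unfold sigmaSq; positivity

lemma zetaSq_nonneg (f : Fin n → Fin m → Vec d → ℝ) (xs : Vec d) : 0 ≤ zetaSq f xs := by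
  unfold zetaSq; positivity

lemma D1_nonneg (f : Fin n → Fin m → Vec d → ℝ) (xs : Vec d) : 0 ≤ D1 f xs :=
  mul_nonneg zero_le_two (zetaSq_nonneg f xs)

/-- The average over workers and indices of the quantities that are bounded by two terms. -/
lemma average_le_of_le {F : Fin n → Fin m → ℝ} (s : State d n) (hL : 0 < L) (hn : 0 < n)
    (hm : 0 < m) (hc : ∀ i j, ConvexOn ℝ Set.univ (f i j)) (hs : ∀ i j, IsLSmooth L (f i j))
    (hq : IsQuasiStronglyConvex μ (globalObj f) xs)
    (hF : ∀ i, (1 / (m : ℝ)) * ∑ l, F i l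
      ≤ 2 * ((1 / (m : ℝ)) * ∑ l, ‖gradient (f i l) s.x - gradient (f i l) xs‖ ^ 2)
        + 2 * ((1 / (m : ℝ)) * ∑ l, ‖gradient (f i l) (s.w i) - gradient (f i l) xs‖ ^ 2)) :
    (1 / (n : ℝ)) * ∑ i, (1 / (m : ℝ)) * ∑ l, F i l
      ≤ 4 * L * (globalObj f s.x - globalObj f xs) + 2 * sigmaSq f xs s.w := by
  have h1 := average_norm_gradient_sub_sq_le hL hn hm hc hs hq s.x
  have h2 : (1 / (n : ℝ)) * ∑ i, (1 / (m : ℝ)) * ∑ l, F i l ≤ (1 / (n : ℝ)) * ∑ i,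
      (2 * ((1 / (m : ℝ)) * ∑ l, ‖gradient (f i l) s.x - gradient (f i l) xs‖ ^ 2)
        + 2 * ((1 / (m : ℝ)) * ∑ l, ‖gradient (f i l) (s.w i) - gradient (f i l) xs‖ ^ 2)) :=
    mul_le_mul_of_nonneg_left (Finset.sum_le_sum fun i _ => hF i) (by positivity)
  rw [average_linear_combination, ← sigmaSq_eq xs s.w] at h2
  linarith

/-- The centred estimator is ∇f_{il}(x) - ∇f_{il}(w_i) minus its mean over l. The variance is at
most the second moment, and ∇f_{il}(x*) is inserted between the two gradients. -/
lemma average_variance_gradEst_le (s : State d n) (hL : 0 < L) (hn : 0 < n) (hm : 0 < m)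
    (hc : ∀ i j, ConvexOn ℝ Set.univ (f i j)) (hs : ∀ i j, IsLSmooth L (f i j))
    (hq : IsQuasiStronglyConvex μ (globalObj f) xs) :
    (1 / (n : ℝ)) * ∑ i, (1 / (m : ℝ)) * ∑ l, ‖gradEst f s i l - gradient (localObj f i) s.x‖ ^ 2
      ≤ 4 * L * (globalObj f s.x - globalObj f xs) + 2 * sigmaSq f xs s.w := by
  refine average_le_of_le s hL hn hm hc hs hq fun i => ?_
  have e : ∀ l, gradEst f s i l - gradient (localObj f i) s.x
      = (gradient (f i l) s.x - gradient (f i l) (s.w i))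
        - (1 / (m : ℝ)) • ∑ j, (gradient (f i j) s.x - gradient (f i j) (s.w i)) := by
    intro l
    rw [Finset.sum_sub_distrib, smul_sub, ← gradient_localObj hs, ← gradient_localObj hs, gradEst]
    abel
  simp only [e]
  refine (average_norm_sub_average_sq_le hm _).trans ?_
  rw [← average_linear_combination]
  gcongr with l _
  rw [← sub_sub_sub_cancel_right _ _ (gradient (f i l) xs)]
  exact norm_sub_sq_le_two_mul _ _

/-- The deviation splits into ∇f_{il}(x) - ∇f_{il}(x*) and the centred version of ∇f_{il}(w_i) -
∇f_{il}(x*); centring only decreases the second moment. -/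
lemma average_norm_gradEst_sub_sq_le (s : State d n) (hL : 0 < L) (hn : 0 < n) (hm : 0 < m)
    (hc : ∀ i j, ConvexOn ℝ Set.univ (f i j)) (hs : ∀ i j, IsLSmooth L (f i j))
    (hq : IsQuasiStronglyConvex μ (globalObj f) xs) :
    (1 / (n : ℝ)) * ∑ i, (1 / (m : ℝ)) * ∑ l, ‖gradEst f s i l - gradient (localObj f i) xs‖ ^ 2
      ≤ 4 * L * (globalObj f s.x - globalObj f xs) + 2 * sigmaSq f xs s.w := by
  refine average_le_of_le s hL hn hm hc hs hq fun i => ?_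
  have h1 := average_norm_sub_average_sq_le hm
    (fun l => gradient (f i l) (s.w i) - gradient (f i l) xs)
  have h2 : (1 / (m : ℝ)) * ∑ l, ‖gradEst f s i l - gradient (localObj f i) xs‖ ^ 2
      ≤ (1 / (m : ℝ)) * ∑ l, (2 * ‖gradient (f i l) s.x - gradient (f i l) xs‖ ^ 2
        + 2 * ‖(gradient (f i l) (s.w i) - gradient (f i l) xs)
          - (1 / (m : ℝ)) • ∑ j, (gradient (f i j) (s.w i) - gradient (f i j) xs)‖ ^ 2) := by
    gcongr with l _
    refine (le_of_eq ?_).trans (norm_sub_sq_le_two_mul _ _)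
    congr 2
    rw [Finset.sum_sub_distrib, smul_sub, ← gradient_localObj hs, ← gradient_localObj hs, gradEst]
    abel
  rw [average_linear_combination] at h2
  linarith

/-- Young's inequality around ∇f_i(x*), with α left free: α = 1 gives the mean bound of the
parametric assumption, α = 2 gives the coefficients of the error recursion. -/
lemma average_norm_gradient_localObj_sq_le {α : ℝ} (hα : 0 < α) (hL : 0 < L) (hn : 0 < n)
    (hm : 0 < m)
    (hc : ∀ i j, ConvexOn ℝ Set.univ (f i j)) (hs : ∀ i j, IsLSmooth L (f i j))
    (hq : IsQuasiStronglyConvex μ (globalObj f) xs) (x : Vec d) :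
    (1 / (n : ℝ)) * ∑ i, ‖gradient (localObj f i) x‖ ^ 2
      ≤ (1 + α) * (2 * L * (globalObj f x - globalObj f xs)) + (1 + 1 / α) / 2 * D1 f xs := by
  have h1 := average_norm_gradient_sub_sq_le hL hn hm hc hs hq x
  have h3 : ∀ i, ‖gradient (localObj f i) x - gradient (localObj f i) xs‖ ^ 2
      ≤ (1 / (m : ℝ)) * ∑ j, ‖gradient (f i j) x - gradient (f i j) xs‖ ^ 2 := by
    intro i
    rw [gradient_localObj hs, gradient_localObj hs, ← smul_sub, ← Finset.sum_sub_distrib]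
    exact norm_average_sq_le hm _
  have h2 : (1 / (n : ℝ)) * ∑ i, ‖gradient (localObj f i) x‖ ^ 2
      ≤ (1 / (n : ℝ)) * ∑ i, ((1 + α) *
          ((1 / (m : ℝ)) * ∑ j, ‖gradient (f i j) x - gradient (f i j) xs‖ ^ 2)
        + (1 + 1 / α) * ‖gradient (localObj f i) xs‖ ^ 2) := by
    refine mul_le_mul_of_nonneg_left (Finset.sum_le_sum fun i _ => ?_) (by positivity)
    have h4 := norm_add_sq_le_young hα (gradient (localObj f i) x - gradient (localObj f i) xs)
      (gradient (localObj f i) xs)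
    rw [sub_add_cancel] at h4
    have := mul_le_mul_of_nonneg_left (h3 i) (by positivity : 0 ≤ 1 + α)
    linarith
  rw [average_linear_combination] at h2
  have h5 := mul_le_mul_of_nonneg_left h1 (by positivity : 0 ≤ 1 + α)
  rw [D1, zetaSq]
  linarith

variable {Θ : Type*} [MeasurableSpace Θ] {ν : Measure Θ}
  [IsProbabilityMeasure ν] {Q : Measure (Fin n → Seed m Θ)}

lemma integral_gradEst (hm : 0 < m) (hs : ∀ i j, IsLSmooth L (f i j)) (hp0 : 0 ≤ p) (hp1 : p ≤ 1)
    (hQ : ∀ i, Q.map (fun z => z i) = seedLaw m p ν) (s : State d n) (i : Fin n) :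
    ∫ z, gradEst f s i (z i).1 ∂Q = gradient (localObj f i) s.x := by
  rw [integral_eval_index hp0 hp1 hQ i (fun l => gradEst f s i l), average_gradEst hm hs]

lemma integrable_average_gradEst (hQ : ∀ i, Q.map (fun z => z i) = seedLaw m p ν)
    (s : State d n) : Integrable (fun z => (1 / (n : ℝ)) • ∑ i, gradEst f s i (z i).1) Q :=
  (integrable_finsetSum _ fun i _ =>
    integrable_eval_index hQ i (fun l _ => gradEst f s i l)).smul (1 / (n : ℝ))

lemma integral_average_gradEst (hm : 0 < m) (hs : ∀ i j, IsLSmooth L (f i j))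
    (hp0 : 0 ≤ p) (hp1 : p ≤ 1)
    (hQ : ∀ i, Q.map (fun z => z i) = seedLaw m p ν) (s : State d n) :
    ∫ z, (1 / (n : ℝ)) • ∑ i, gradEst f s i (z i).1 ∂Q = gradient (globalObj f) s.x := by
  rw [integral_smul, integral_finsetSum _ fun i _ =>
    integrable_eval_index hQ i (fun l _ => gradEst f s i l), gradient_globalObj hm hs]
  simp only [integral_gradEst hm hs hp0 hp1 hQ]

/-- The integrand couples all workers, so their marginals do not determine its law; but it depends
only on the n indices and takes finitely many values. -/
lemma integrable_norm_average_gradEst_sq (Q : Measure (Fin n → Seed m Θ))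
    [IsProbabilityMeasure Q] (s : State d n) :
    Integrable (fun z => ‖(1 / (n : ℝ)) • ∑ i, gradEst f s i (z i).1‖ ^ 2) Q := by
  have h : StronglyMeasurable (fun q : Fin n → Fin m => ‖(1 / (n : ℝ)) • ∑ i, gradEst f s i (q i)‖ ^ 2) :=
    StronglyMeasurable.of_discrete
  have h2 := h.comp_measurable (g := fun (z : Fin n → Seed m Θ) i => (z i).1) (by fun_prop)
  obtain ⟨B, hB⟩ := (Set.finite_range
    (fun q : Fin n → Fin m => ‖(1 / (n : ℝ)) • ∑ i, gradEst f s i (q i)‖ ^ 2)).bddAbove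
  refine Integrable.of_bound h2.aestronglyMeasurable B (Filter.Eventually.of_forall fun z => ?_)
  rw [Real.norm_of_nonneg (by positivity)]
  exact hB ⟨fun i => (z i).1, rfl⟩

/-- Since the ∇f_i(x*) average to zero they may be subtracted for free; Jensen's inequality across
workers then needs no independence. -/
lemma integral_norm_average_gradEst_sq_le [IsProbabilityMeasure Q] (hL : 0 < L) (hn : 0 < n) (hm : 0 < m)
    (hc : ∀ i j, ConvexOn ℝ Set.univ (f i j)) (hs : ∀ i j, IsLSmooth L (f i j))
    (hq : IsQuasiStronglyConvex μ (globalObj f) xs) (hp0 : 0 ≤ p) (hp1 : p ≤ 1)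
    (hQ : ∀ i, Q.map (fun z => z i) = seedLaw m p ν) (s : State d n) :
    ∫ z, ‖(1 / (n : ℝ)) • ∑ i, gradEst f s i (z i).1‖ ^ 2 ∂Q
      ≤ 4 * L * (globalObj f s.x - globalObj f xs) + 2 * sigmaSq f xs s.w := by
  refine le_trans ?_ (average_norm_gradEst_sub_sq_le s hL hn hm hc hs hq)
  have hi : ∀ i : Fin n, Integrable
      (fun z => ‖gradEst f s i (z i).1 - gradient (localObj f i) xs‖ ^ 2) Q := fun i =>
    integrable_eval_index hQ i (fun l _ => ‖gradEst f s i l - gradient (localObj f i) xs‖ ^ 2)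
  have h0 : (1 / (n : ℝ)) • ∑ i, gradient (localObj f i) xs = 0 := by
    rw [← gradient_globalObj hm hs, hq.gradient_eq_zero]
  calc _ ≤ ∫ z, (1 / (n : ℝ)) * ∑ i, ‖gradEst f s i (z i).1 - gradient (localObj f i) xs‖ ^ 2 ∂Q := by
        refine integral_mono (integrable_norm_average_gradEst_sq Q s)
          ((integrable_finsetSum _ fun i _ => hi i).const_mul _) fun z => ?_
        have := norm_average_sq_le hn
          (fun i => gradEst f s i (z i).1 - gradient (localObj f i) xs)
        rwa [Finset.sum_sub_distrib, smul_sub, h0, sub_zero] at this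
    _ = _ := by
        rw [integral_const_mul, integral_finsetSum _ fun i _ => hi i]
        congr 1
        refine Finset.sum_congr rfl fun i _ => ?_
        rw [integral_eval_index hp0 hp1 hQ i
          (fun l => ‖gradEst f s i l - gradient (localObj f i) xs‖ ^ 2), smul_eq_mul]

lemma integral_norm_gradEst_sub_sq (hp0 : 0 ≤ p) (hp1 : p ≤ 1)
    (hQ : ∀ i, Q.map (fun z => z i) = seedLaw m p ν) (s : State d n) (i : Fin n) (a : Vec d) :
    ∫ z, ‖gradEst f s i (z i).1 - a‖ ^ 2 ∂Q = (1 / (m : ℝ)) * ∑ l, ‖gradEst f s i l - a‖ ^ 2 := by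
  rw [integral_eval_index hp0 hp1 hQ i (fun l => ‖gradEst f s i l - a‖ ^ 2), smul_eq_mul]

lemma integral_sigmaSq_step_le (hL : 0 < L) (hn : 0 < n) (hm : 0 < m)
    (hc : ∀ i j, ConvexOn ℝ Set.univ (f i j)) (hs : ∀ i j, IsLSmooth L (f i j))
    (hq : IsQuasiStronglyConvex μ (globalObj f) xs) (hp0 : 0 ≤ p) (hp1 : p ≤ 1)
    (hQ : ∀ i, Q.map (fun z => z i) = seedLaw m p ν) (C : Θ → Vec d → Vec d) (γ : ℝ)
    (s : State d n) :
    ∫ z, sigmaSq f xs (step f C γ s z).w ∂Q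
      ≤ (1 - p) * sigmaSq f xs s.w + 2 * (L * p) * (globalObj f s.x - globalObj f xs) := by
  -- The new reference point of worker i depends on the draw only through the coin, so each worker
  -- contributes a function of one Boolean. On `true` the gap bounds the average, on `false` it is
  -- the old σ².
  obtain ⟨B, hB⟩ : ∃ B : Fin n → Bool → ℝ, ∀ i b, B i b = (1 / (m : ℝ)) * ∑ j,
      ‖gradient (f i j) (if b = true then s.x else s.w i) - gradient (f i j) xs‖ ^ 2 :=
    ⟨_, fun _ _ => rfl⟩
  have e : ∀ z : Fin n → Seed m Θ, sigmaSq f xs (step f C γ s z).w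
      = (1 / (n : ℝ)) * ∑ i, B i (z i).2.1 := fun z => by
    rw [sigmaSq_eq]
    simp only [hB, step]
  have hi : ∀ (i : Fin n), Integrable (fun z => B i (z i).2.1) Q := fun i =>
    integrable_eval_index hQ i (fun _ b => B i b)
  simp only [e]
  rw [integral_const_mul, integral_finsetSum _ fun i _ => hi i]
  have e2 : ∀ i : Fin n, ∫ z, B i (z i).2.1 ∂Q = p * B i true + (1 - p) * B i false := fun i =>
    integral_eval_coin hm hp0 hp1 hQ i (B i)
  rw [Finset.sum_congr rfl fun i _ => e2 i, average_linear_combination]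
  simp only [hB, if_true, Bool.false_eq_true, if_false]
  rw [← sigmaSq_eq xs s.w]
  have := mul_le_mul_of_nonneg_left (average_norm_gradient_sub_sq_le hL hn hm hc hs hq s.x) hp0
  linarith

end OneStep

/-! ### The virtual iterate, on which compression has no effect. -/

section Virtual

variable {d n m : ℕ} {γ : ℝ} {f : Fin n → Fin m → Vec d → ℝ} {Θ : Type*} {C : Θ → Vec d → Vec d}

/-- The virtual iterate `x - (1/n) ∑_i e_i`. -/
noncomputable def State.virtual (s : State d n) : Vec d := s.x - (1 / (n : ℝ)) • ∑ i, s.e i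

/-- The transmitted vectors v_i leave x and e_i with the same sign and cancel, whatever the
compressor does. -/
lemma virtual_step (s : State d n) (z : Fin n → Seed m Θ) :
    (step f C γ s z).virtual = s.virtual - γ • ((1 / (n : ℝ)) • ∑ i, gradEst f s i (z i).1) := by
  simp only [State.virtual, step, Finset.sum_add_distrib, Finset.sum_sub_distrib, smul_add,
    smul_sub, ← Finset.smul_sum]
  rw [smul_comm γ]
  abel

lemma norm_virtual_step_sub_sq (s : State d n) (z : Fin n → Seed m Θ) (xs : Vec d) :
    ‖(step f C γ s z).virtual - xs‖ ^ 2 = ‖s.virtual - xs‖ ^ 2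
      - 2 * γ * inner ℝ (s.virtual - xs) ((1 / (n : ℝ)) • ∑ i, gradEst f s i (z i).1)
      + γ ^ 2 * ‖(1 / (n : ℝ)) • ∑ i, gradEst f s i (z i).1‖ ^ 2 := by
  rw [virtual_step, sub_right_comm, norm_sub_sq_real, inner_smul_right, norm_smul, mul_pow,
    Real.norm_eq_abs, sq_abs]
  ring

end Virtual

/-! ### One-step bounds for the compression error and for the virtual iterate. -/

section ErrorStep

variable {d n m : ℕ} {L μ p δ γ : ℝ} {f : Fin n → Fin m → Vec d → ℝ} {xs : Vec d}
  {Θ : Type*} [MeasurableSpace Θ] {ν : Measure Θ} {C : Θ → Vec d → Vec d}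

lemma IsCompressor.stronglyMeasurable_norm_sub_sq (hC : IsCompressor ν C δ) (y : Fin m → Vec d) :
    StronglyMeasurable (fun t : Seed m Θ => ‖y t.1 - C t.2.2 (y t.1)‖ ^ 2) := by
  have h1 : Measurable (fun t : Seed m Θ => y t.1) := (Measurable.of_discrete (f := y)).comp measurable_fst
  have h2 : Measurable (fun t : Seed m Θ => C t.2.2 (y t.1)) :=
    hC.measurable.comp (measurable_snd.snd.prodMk h1)
  exact ((h1.sub h2).norm.pow_const 2).stronglyMeasurable

variable [IsProbabilityMeasure ν] {Q : Measure (Fin n → Seed m Θ)}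

lemma integrable_norm_error_step_sq (hC : IsCompressor ν C δ)
    (hQ : ∀ i, Q.map (fun z => z i) = seedLaw m p ν) (γ : ℝ) (s : State d n) (i : Fin n) :
    Integrable (fun z => ‖(step f C γ s z).e i‖ ^ 2) Q := by
  refine integrable_eval hQ i
    (hC.stronglyMeasurable_norm_sub_sq (fun l => s.e i + γ • gradEst f s i l)) fun l b => ?_
  simp only [norm_sub_rev _ (C _ _)]
  exact hC.integrable _

lemma integral_norm_error_step_sq_le (hC : IsCompressor ν C δ) (hp0 : 0 ≤ p) (hp1 : p ≤ 1)
    (hQ : ∀ i, Q.map (fun z => z i) = seedLaw m p ν) (γ : ℝ) (s : State d n) (i : Fin n) :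
    ∫ z, ‖(step f C γ s z).e i‖ ^ 2 ∂Q
      ≤ (1 - δ) * ((1 / (m : ℝ)) * ∑ l, ‖s.e i + γ • gradEst f s i l‖ ^ 2) := by
  have h := integral_eval hp0 hp1 hQ i
    (hC.stronglyMeasurable_norm_sub_sq (fun l => s.e i + γ • gradEst f s i l)) fun l b => by
      simp only [norm_sub_rev _ (C _ _)]
      exact hC.integrable _
  refine h.le.trans ?_
  rw [mul_left_comm, Finset.mul_sum, smul_eq_mul]
  gcongr with l _
  simp only [norm_sub_rev _ (C _ _), smul_eq_mul, ← add_mul]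
  rw [add_sub_cancel, one_mul]
  exact hC.contraction _

/-- Separating the variance before Young's inequality is applied keeps the factor 2/δ away from it;
only the mean gradient is multiplied by 2/δ. -/
lemma average_norm_error_add_sq (hm : 0 < m) (hs : ∀ i j, IsLSmooth L (f i j)) (γ : ℝ)
    (s : State d n) (i : Fin n) :
    (1 / (m : ℝ)) * ∑ l, ‖s.e i + γ • gradEst f s i l‖ ^ 2
      = ‖s.e i + γ • gradient (localObj f i) s.x‖ ^ 2
        + γ ^ 2 * ((1 / (m : ℝ)) * ∑ l, ‖gradEst f s i l - gradient (localObj f i) s.x‖ ^ 2) := by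
  have hm' : (m : ℝ) ≠ 0 := by positivity
  have h := average_norm_sub_average_sq hm (fun l => s.e i + γ • gradEst f s i l)
  have e : (1 / (m : ℝ)) • ∑ l, (s.e i + γ • gradEst f s i l)
      = s.e i + γ • gradient (localObj f i) s.x := by
    rw [Finset.sum_add_distrib, smul_add, ← Finset.smul_sum, smul_comm _ γ,
      average_gradEst hm hs, Finset.sum_const, Finset.card_univ,
      Fintype.card_fin, ← Nat.cast_smul_eq_nsmul ℝ, smul_smul, one_div_mul_cancel hm', one_smul]
  rw [e] at h
  simp only [add_sub_add_left_eq_sub, ← smul_sub, norm_smul, mul_pow, ← Finset.mul_sum,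
    Real.norm_eq_abs, sq_abs] at h
  rw [mul_left_comm] at h
  linarith

lemma integral_average_error_step_le (hL : 0 < L) (hn : 0 < n) (hm : 0 < m)
    (hc : ∀ i j, ConvexOn ℝ Set.univ (f i j)) (hs : ∀ i j, IsLSmooth L (f i j))
    (hq : IsQuasiStronglyConvex μ (globalObj f) xs) (hp0 : 0 ≤ p) (hp1 : p ≤ 1)
    (hC : IsCompressor ν C δ)
    (hQ : ∀ i, Q.map (fun z => z i) = seedLaw m p ν) (γ : ℝ) (s : State d n) :
    ∫ z, (1 / (n : ℝ)) * ∑ i, ‖(step f C γ s z).e i‖ ^ 2 ∂Q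
      ≤ (1 - δ / 2) * ((1 / (n : ℝ)) * ∑ i, ‖s.e i‖ ^ 2)
        + γ ^ 2 * ((12 / δ + 4) * L * (globalObj f s.x - globalObj f xs)
          + 2 * sigmaSq f xs s.w + 3 / (2 * δ) * D1 f xs) := by
  have hδ0 := hC.delta_pos
  have hδ1 := hC.delta_le_one
  rw [integral_const_mul, integral_finsetSum _ fun i _ =>
    integrable_norm_error_step_sq hC hQ γ s i]
  have key : ∀ i : Fin n, ∫ z, ‖(step f C γ s z).e i‖ ^ 2 ∂Q
      ≤ 1 * ((1 - δ / 2) * ‖s.e i‖ ^ 2 + (2 / δ * γ ^ 2) * ‖gradient (localObj f i) s.x‖ ^ 2)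
        + γ ^ 2 * ((1 / (m : ℝ)) *
          ∑ l, ‖gradEst f s i l - gradient (localObj f i) s.x‖ ^ 2) := by
    intro i
    refine (integral_norm_error_step_sq_le hC hp0 hp1 hQ γ s i).trans ?_
    rw [average_norm_error_add_sq hm hs, mul_add, one_mul]
    gcongr ?_ + ?_
    -- Young's parameter δ/2 spends half of the contraction: (1-δ)(1+δ/2) ≤ 1-δ/2, at the price of
    -- the factor (1-δ)(1+2/δ) ≤ 2/δ on the gradient.
    · have h1 := norm_add_sq_le_young (half_pos hδ0) (s.e i) (γ • gradient (localObj f i) s.x)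
      rw [norm_smul, mul_pow, Real.norm_eq_abs, sq_abs] at h1
      have h2 := mul_le_mul_of_nonneg_left h1 (sub_nonneg.2 hδ1)
      refine h2.trans ?_
      set a := ‖s.e i‖ ^ 2
      set b := γ ^ 2 * ‖gradient (localObj f i) s.x‖ ^ 2
      have ha : 0 ≤ a := by positivity
      have hb : 0 ≤ b := by positivity
      have e1 : (1 - δ) * (1 + δ / 2) ≤ 1 - δ / 2 := by nlinarith
      have e2 : (1 - δ) * (1 + 1 / (δ / 2)) ≤ 2 / δ := by
        have : (1 - δ) * (1 + 1 / (δ / 2)) = 2 / δ - 1 - δ := by field_simp; ring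
        linarith
      have := mul_le_mul_of_nonneg_right e1 ha
      have := mul_le_mul_of_nonneg_right e2 hb
      calc _ = (1 - δ) * (1 + δ / 2) * a + (1 - δ) * (1 + 1 / (δ / 2)) * b := by ring
        _ ≤ (1 - δ / 2) * a + 2 / δ * b := by linarith
        _ = _ := by ring
    · refine mul_le_of_le_one_left (by positivity) (by linarith)
  have h1 := average_variance_gradEst_le s hL hn hm hc hs hq
  have h2 := average_norm_gradient_localObj_sq_le two_pos hL hn hm hc hs hq s.x
  have h3 : (1 / (n : ℝ)) * ∑ i : Fin n, ∫ z, ‖(step f C γ s z).e i‖ ^ 2 ∂Q ≤ _ :=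
    mul_le_mul_of_nonneg_left (Finset.sum_le_sum fun i _ => key i) (by positivity)
  rw [average_linear_combination, average_linear_combination, one_mul] at h3
  have h4 := mul_le_mul_of_nonneg_left h1 (sq_nonneg γ)
  have h5 := mul_le_mul_of_nonneg_left h2 (by positivity : 0 ≤ 2 / δ * γ ^ 2)
  refine (h3.trans (add_le_add (add_le_add le_rfl h5) h4)).trans (le_of_eq ?_)
  field_simp
  ring

/-- The cross term splits into ⟨∇f(x), x* - x⟩, handled by quasi strong convexity, and ⟨∇f(x), e⟩.
The latter costs one gap, since ‖∇f(x)‖² ≤ 2L · gap, plus 2L‖e‖². Replacing ‖x - x*‖² by ‖x̃ - x*‖²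
costs μ‖e‖² ≤ L‖e‖², whence 3L in total. -/
lemma integral_norm_virtual_step_sub_sq_le [IsProbabilityMeasure Q] (hL : 0 < L) (hn : 0 < n)
    (hm : 0 < m)
    (hc : ∀ i j, ConvexOn ℝ Set.univ (f i j)) (hs : ∀ i j, IsLSmooth L (f i j))
    (hq : IsQuasiStronglyConvex μ (globalObj f) xs) (hp0 : 0 ≤ p) (hp1 : p ≤ 1)
    (hQ : ∀ i, Q.map (fun z => z i) = seedLaw m p ν) (hγ : 0 ≤ γ) (s : State d n) :
    ∫ z, ‖(step f C γ s z).virtual - xs‖ ^ 2 ∂Q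
      ≤ (1 - γ * μ / 2) * ‖s.virtual - xs‖ ^ 2 - γ * (globalObj f s.x - globalObj f xs)
        + 3 * L * γ * ‖(1 / (n : ℝ)) • ∑ i, s.e i‖ ^ 2
        + γ ^ 2 * (4 * L * (globalObj f s.x - globalObj f xs) + 2 * sigmaSq f xs s.w) := by
  have i1 := integrable_average_gradEst (f := f) hQ s
  have i2 := integrable_norm_average_gradEst_sq (f := f) Q s
  have i3 := i1.const_inner (𝕜 := ℝ) (s.virtual - xs)
  simp only [norm_virtual_step_sub_sq]
  have i4 : Integrable (fun z => ‖s.virtual - xs‖ ^ 2 - 2 * γ * inner ℝ (s.virtual - xs)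
      ((1 / (n : ℝ)) • ∑ i, gradEst f s i (z i).1)) Q := (integrable_const _).sub (i3.const_mul _)
  rw [integral_add i4 (i2.const_mul _),
    integral_sub (integrable_const _) (i3.const_mul _), integral_const_mul, integral_const_mul,
    integral_inner i1, integral_average_gradEst hm hs hp0 hp1 hQ]
  simp only [integral_const, probReal_univ, one_smul]
  have h1 := integral_norm_average_gradEst_sq_le hL hn hm hc hs hq hp0 hp1 hQ s
  have h1' := mul_le_mul_of_nonneg_left h1 (sq_nonneg γ)
  suffices h : ‖s.virtual - xs‖ ^ 2 - 2 * γ * inner ℝ (s.virtual - xs) (gradient (globalObj f) s.x)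
      ≤ (1 - γ * μ / 2) * ‖s.virtual - xs‖ ^ 2 - γ * (globalObj f s.x - globalObj f xs)
        + 3 * L * γ * ‖(1 / (n : ℝ)) • ∑ i, s.e i‖ ^ 2 by linarith
  have hv : s.virtual = s.x - (1 / (n : ℝ)) • ∑ i, s.e i := rfl
  set e := (1 / (n : ℝ)) • ∑ i, s.e i
  set G := gradient (globalObj f) s.x
  have hμ := hq.mu_nonneg
  have h2 := hq.quasi s.x
  have hsm := isLSmooth_globalObj hn hm hs
  have h3 := hsm.norm_gradient_sub_sq_le hL (convexOn_globalObj hc) s.x xs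
  rw [hq.gradient_eq_zero, sub_zero, inner_zero_left, sub_zero] at h3
  have h4 := hq.mul_norm_sq_le hsm e
  have h5 : inner ℝ (s.virtual - xs) G = - inner ℝ G (xs - s.x) - inner ℝ G e := by
    rw [hv, real_inner_comm, ← inner_neg_right, ← inner_sub_right]
    congr 1
    abel
  have h6 : 2 * inner ℝ G e ≤ (globalObj f s.x - globalObj f xs) + 2 * L * ‖e‖ ^ 2 := by
    have h7 : 2 * (‖G‖ * ‖e‖) ≤ ‖G‖ ^ 2 / (2 * L) + 2 * L * ‖e‖ ^ 2 := by
      have : ‖G‖ ^ 2 / (2 * L) + 2 * L * ‖e‖ ^ 2 - 2 * (‖G‖ * ‖e‖)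
          = (‖G‖ - 2 * L * ‖e‖) ^ 2 / (2 * L) := by
        field_simp
        ring
      have h8 : 0 ≤ (‖G‖ - 2 * L * ‖e‖) ^ 2 / (2 * L) := by positivity
      linarith
    have h9 : ‖G‖ ^ 2 / (2 * L) ≤ globalObj f s.x - globalObj f xs := by
      rw [div_le_iff₀ (by positivity)]; linarith
    have := real_inner_le_norm G e
    linarith
  have h7 : ‖s.virtual - xs‖ ^ 2 ≤ 2 * ‖s.x - xs‖ ^ 2 + 2 * ‖e‖ ^ 2 := by
    rw [hv, sub_right_comm]
    exact norm_sub_sq_le_two_mul _ _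
  have h8 := mul_le_mul_of_nonneg_left h7 hμ
  have h9 : - 2 * inner ℝ (s.virtual - xs) G
      ≤ - (μ / 2 * ‖s.virtual - xs‖ ^ 2) - (globalObj f s.x - globalObj f xs)
        + 3 * L * ‖e‖ ^ 2 := by
    rw [h5]; linarith
  have := mul_le_mul_of_nonneg_left h9 hγ
  linarith

end ErrorStep

/-! ### Measurability -/

section Measurability

variable {d n m : ℕ} {L γ : ℝ} {f : Fin n → Fin m → Vec d → ℝ}
  {Θ : Type*} [MeasurableSpace Θ] {C : Θ → Vec d → Vec d}

instance State.instMeasurableSpace : MeasurableSpace (State d n) :=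
  MeasurableSpace.comap (fun s => (s.x, s.e, s.w)) inferInstance

lemma State.measurable_components :
    Measurable (fun s : State d n => (s.x, s.e, s.w)) := comap_measurable _

lemma State.measurable_x : Measurable (State.x : State d n → Vec d) :=
  State.measurable_components.fst

lemma State.measurable_e (i : Fin n) : Measurable (fun s : State d n => s.e i) :=
  (measurable_pi_apply i).comp State.measurable_components.snd.fst

lemma State.measurable_w (i : Fin n) : Measurable (fun s : State d n => s.w i) :=
  (measurable_pi_apply i).comp State.measurable_components.snd.snd

lemma State.measurable_iff {α : Type*} [MeasurableSpace α] {S : α → State d n} :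
    Measurable S ↔ Measurable (fun a => (S a).x) ∧ (∀ i, Measurable (fun a => (S a).e i))
      ∧ ∀ i, Measurable (fun a => (S a).w i) := by
  refine ⟨fun h => ⟨State.measurable_x.comp h, fun i => (State.measurable_e i).comp h,
    fun i => (State.measurable_w i).comp h⟩, fun h => ?_⟩
  refine measurable_comap_iff.2 (h.1.prodMk ((measurable_pi_lambda _ h.2.1).prodMk
    (measurable_pi_lambda _ h.2.2)))

lemma IsLSmooth.measurable_gradient {h : Vec d → ℝ} (hh : IsLSmooth L h) :
    Measurable (gradient h) := hh.continuous_gradient.measurable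

lemma measurable_gradEst (hm : 0 < m) (hs : ∀ i j, IsLSmooth L (f i j)) (i : Fin n) (l : Fin m) :
    Measurable (fun s : State d n => gradEst f s i l) :=
  (((hs i l).measurable_gradient.comp State.measurable_x).sub
    ((hs i l).measurable_gradient.comp (State.measurable_w i))).add
    ((isLSmooth_localObj hm hs i).measurable_gradient.comp (State.measurable_w i))

/-- The sampled index is discrete, so joint measurability reduces to measurability in the state for
each fixed index. -/
lemma measurable_gradEst_prod (hm : 0 < m) (hs : ∀ i j, IsLSmooth L (f i j)) (i : Fin n) :
    Measurable (fun q : State d n × (Fin n → Seed m Θ) => gradEst f q.1 i (q.2 i).1) := by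
  have h : Measurable (fun q : State d n × Fin m => gradEst f q.1 i q.2) :=
    measurable_from_prod_countable_left fun l => measurable_gradEst hm hs i l
  have hz : Measurable (fun q : State d n × (Fin n → Seed m Θ) => q.2 i) :=
    (measurable_pi_apply i).comp measurable_snd
  have h2 : Measurable (fun q : State d n × (Fin n → Seed m Θ) => (q.1, (q.2 i).1)) :=
    measurable_fst.prodMk hz.fst
  have h3 := h.comp h2
  simp only [Function.comp_def] at h3
  exact h3

lemma measurable_step (hm : 0 < m) (hs : ∀ i j, IsLSmooth L (f i j))
    (hC : Measurable (Function.uncurry C)) (γ : ℝ) :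
    Measurable (fun q : State d n × (Fin n → Seed m Θ) => step f C γ q.1 q.2) := by
  have hz : ∀ i, Measurable (fun q : State d n × (Fin n → Seed m Θ) => q.2 i) := fun i =>
    (measurable_pi_apply i).comp measurable_snd
  have hy : ∀ i, Measurable (fun q : State d n × (Fin n → Seed m Θ) =>
      q.1.e i + γ • gradEst f q.1 i (q.2 i).1) := fun i =>
    ((State.measurable_e i).comp measurable_fst).add
      ((measurable_gradEst_prod hm hs i).const_smul γ)
  have hv : ∀ i, Measurable (fun q : State d n × (Fin n → Seed m Θ) =>
      C (q.2 i).2.2 (q.1.e i + γ • gradEst f q.1 i (q.2 i).1)) := fun i =>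
    hC.comp ((hz i).snd.snd.prodMk (hy i))
  refine State.measurable_iff.2 ⟨?_, fun i => (hy i).sub (hv i), fun i => ?_⟩
  · exact (State.measurable_x.comp measurable_fst).sub
      ((Finset.measurable_fun_sum _ fun i _ => hv i).const_smul (1 / (n : ℝ)))
  · exact Measurable.ite ((hz i).snd.fst (measurableSet_singleton true))
      (State.measurable_x.comp measurable_fst) ((State.measurable_w i).comp measurable_fst)

lemma measurable_sigmaSq (hs : ∀ i j, IsLSmooth L (f i j)) (xs : Vec d) :
    Measurable (fun s : State d n => sigmaSq f xs s.w) := by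
  refine (Finset.measurable_fun_sum _ fun i _ => Finset.measurable_fun_sum _ fun j _ => ?_).const_mul _
  exact ((((hs i j).measurable_gradient.comp (State.measurable_w i)).sub_const _).norm).pow_const 2

lemma measurable_average_error :
    Measurable (fun s : State d n => (1 / (n : ℝ)) • ∑ i, s.e i) :=
  (Finset.measurable_fun_sum _ fun i _ => State.measurable_e i).const_smul (1 / (n : ℝ))

lemma measurable_virtual : Measurable (State.virtual : State d n → Vec d) :=
  State.measurable_x.sub measurable_average_error

end Measurability

/-! ### The history -/

section MeasurableState

variable {n m : ℕ} {Θ Ω : Type*} [MeasurableSpace Θ] {ξ : ℕ → Ω → Fin n → Seed m Θ}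

lemma measurable_state {d : ℕ} {L : ℝ} {f : Fin n → Fin m → Vec d → ℝ} {C : Θ → Vec d → Vec d}
    (hm : 0 < m) (hs : ∀ i j, IsLSmooth L (f i j))
    (hC : Measurable (Function.uncurry C)) (x0 : Vec d) (w0 : Fin n → Vec d) (γ : ℝ) (k : ℕ) :
    Measurable[history ξ k] (state f C x0 w0 ξ γ k) := by
  induction k with
  | zero => exact measurable_const
  | succ k ih =>
    have h1 : history ξ k ≤ history ξ (k + 1) :=
      iSup₂_le fun t ht => le_iSup₂_of_le t (Set.mem_Iio.2 (Nat.lt_succ_of_lt ht)) le_rfl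
    have h2 : Measurable[history ξ (k + 1)] (ξ k) :=
      (comap_measurable (ξ k)).mono
        (le_iSup₂_of_le (f := fun t (_ : t ∈ Set.Iio (k + 1)) =>
          MeasurableSpace.comap (ξ t) inferInstance) k (Set.mem_Iio.2 (Nat.lt_succ_self k)) le_rfl)
        le_rfl
    exact (measurable_step hm hs hC γ).comp ((ih.mono h1 le_rfl).prodMk h2)

end MeasurableState

section History

variable {n m : ℕ} {Θ Ω : Type*} [MeasurableSpace Θ] [mΩ : MeasurableSpace Ω]
  {P : Measure Ω} {p : ℝ} {ν : Measure Θ} {ξ : ℕ → Ω → Fin n → Seed m Θ}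

lemma IsSampling.history_le (hξ : IsSampling P p ν ξ) (k : ℕ) : history ξ k ≤ mΩ :=
  iSup₂_le fun t _ => (hξ.measurable t).comap_le

lemma IsSampling.indep_history (hξ : IsSampling P p ν ξ) (k : ℕ) :
    Indep (history ξ k) (MeasurableSpace.comap (ξ k) inferInstance) P := by
  have h := indep_iSup_of_disjoint (fun t => (hξ.measurable t).comap_le) hξ.indep.iIndep
    (S := Set.Iio k) (T := {k}) (by simp)
  rwa [iSup_singleton] at h

lemma IsSampling.map_eval (hξ : IsSampling P p ν ξ) (k : ℕ) (i : Fin n) :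
    (P.map (ξ k)).map (fun z => z i) = seedLaw m p ν := by
  rw [Measure.map_map (measurable_pi_apply i) (hξ.measurable k)]
  exact hξ.law k i

end History

/-! ### Square integrability of the iterates -/

section Iterates

/-- The standing assumptions on the problem, the compressor and the sampling. -/
structure Setting {d n m : ℕ} (f : Fin n → Fin m → Vec d → ℝ) (L μ δ p : ℝ) (xs : Vec d)
    {Θ Ω : Type*} [MeasurableSpace Θ] [MeasurableSpace Ω] (ν : Measure Θ) (C : Θ → Vec d → Vec d)
    (P : Measure Ω) (ξ : ℕ → Ω → Fin n → Seed m Θ) : Prop where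
  hn : 0 < n
  hm : 0 < m
  hL : 0 < L
  hp0 : 0 < p
  hp1 : p < 1
  hconv : ∀ i j, ConvexOn ℝ Set.univ (f i j)
  hsmooth : ∀ i j, IsLSmooth L (f i j)
  hquasi : IsQuasiStronglyConvex μ (globalObj f) xs
  hC : IsCompressor ν C δ
  hξ : IsSampling P p ν ξ

variable {d n m : ℕ} {f : Fin n → Fin m → Vec d → ℝ} {L μ δ p : ℝ} {xs x0 : Vec d}
  {w0 : Fin n → Vec d} {Θ Ω : Type*} [MeasurableSpace Θ] [mΩ : MeasurableSpace Ω] {ν : Measure Θ}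
  {C : Θ → Vec d → Vec d} {P : Measure Ω} {ξ : ℕ → Ω → Fin n → Seed m Θ} {γ : ℝ}

lemma IsLSmooth.memLp_gradient [IsProbabilityMeasure P] {h : Vec d → ℝ} (hh : IsLSmooth L h)
    {X : Ω → Vec d} (hX : MemLp X 2 P) : MemLp (fun ω => gradient h (X ω)) 2 P := by
  have h2 : MemLp (fun ω => L * ‖X ω‖) 2 P := hX.norm.const_mul L
  have h1 : MemLp (fun ω => ‖gradient h 0‖ + L * ‖X ω‖) 2 P :=
    (memLp_const ‖gradient h 0‖).add h2
  have h0 : AEStronglyMeasurable (fun ω => gradient h (X ω)) P :=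
    Continuous.comp_aestronglyMeasurable (g := gradient h) hh.continuous_gradient hX.1
  refine h1.of_le h0 (Filter.Eventually.of_forall fun ω => ?_)
  have h2 := hh.2 (X ω) 0
  rw [sub_zero] at h2
  have h3 := norm_sub_norm_le (gradient h (X ω)) (gradient h 0)
  rw [Real.norm_eq_abs]
  exact (by linarith : ‖gradient h (X ω)‖ ≤ ‖gradient h 0‖ + L * ‖X ω‖).trans (le_abs_self _)

namespace Setting

lemma measurable_state (S : Setting f L μ δ p xs ν C P ξ) (k : ℕ) :
    Measurable[history ξ k] (state f C x0 w0 ξ γ k) :=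
  ECLSVRG.measurable_state S.hm S.hsmooth S.hC.measurable x0 w0 γ k

lemma measurable_state' (S : Setting f L μ δ p xs ν C P ξ) (k : ℕ) :
    Measurable (state f C x0 w0 ξ γ k) :=
  S.measurable_state k |>.mono (S.hξ.history_le k) le_rfl

lemma smooth_globalObj (S : Setting f L μ δ p xs ν C P ξ) : IsLSmooth L (globalObj f) :=
  isLSmooth_globalObj S.hn S.hm S.hsmooth

lemma gap_nonneg (S : Setting f L μ δ p xs ν C P ξ) (x : Vec d) :
    0 ≤ globalObj f x - globalObj f xs := sub_nonneg.2 (S.hquasi.le x)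

lemma measurable_stochGrad (S : Setting f L μ δ p xs ν C P ξ) (i : Fin n) (k : ℕ) :
    Measurable (stochGrad f C x0 w0 ξ γ i k) := by
  have h1 := measurable_gradEst_prod (Θ := Θ) S.hm S.hsmooth i
  have h2 : Measurable (fun ω => (state f C x0 w0 ξ γ k ω, ξ k ω)) :=
    (S.measurable_state' k).prodMk (S.hξ.measurable k)
  have h3 := h1.comp h2
  simp only [Function.comp_def] at h3
  exact h3

variable [IsProbabilityMeasure P]

lemma memLp_gradEst (S : Setting f L μ δ p xs ν C P ξ) {Y : Ω → State d n}
    (hx : MemLp (fun ω => (Y ω).x) 2 P) (i : Fin n) (hw : MemLp (fun ω => (Y ω).w i) 2 P)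
    (l : Fin m) : MemLp (fun ω => gradEst f (Y ω) i l) 2 P :=
  (((S.hsmooth i l).memLp_gradient hx).sub ((S.hsmooth i l).memLp_gradient hw)).add
    ((isLSmooth_localObj S.hm S.hsmooth i).memLp_gradient hw)

/-- The sampled index is random, so the estimator is dominated by the sum of the norms over all
indices. -/
lemma memLp_stochGrad_of_memLp (S : Setting f L μ δ p xs ν C P ξ) (k : ℕ)
    (hx : MemLp (fun ω => (state f C x0 w0 ξ γ k ω).x) 2 P) (i : Fin n)
    (hw : MemLp (fun ω => (state f C x0 w0 ξ γ k ω).w i) 2 P) :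
    MemLp (stochGrad f C x0 w0 ξ γ i k) 2 P := by
  have h1 : MemLp (fun ω => ∑ l, ‖gradEst f (state f C x0 w0 ξ γ k ω) i l‖) 2 P :=
    memLp_finsetSum _ fun l _ => (S.memLp_gradEst hx i hw l).norm
  refine h1.of_le (S.measurable_stochGrad i k).aestronglyMeasurable
    (Filter.Eventually.of_forall fun ω => ?_)
  rw [Real.norm_of_nonneg (by positivity)]
  exact Finset.single_le_sum (f := fun l => ‖gradEst f (state f C x0 w0 ξ γ k ω) i l‖)
    (fun l _ => norm_nonneg _) (Finset.mem_univ (ξ k ω i).1)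

lemma integrable_gap_of_memLp (S : Setting f L μ δ p xs ν C P ξ) {X : Ω → Vec d}
    (hX : MemLp X 2 P) : Integrable (fun ω => globalObj f (X ω) - globalObj f xs) P := by
  have h1 : Integrable (fun ω => L / 2 * ‖X ω - xs‖ ^ 2) P :=
    ((hX.sub (memLp_const xs)).integrable_norm_pow two_ne_zero).const_mul _
  refine h1.mono' ?_ (Filter.Eventually.of_forall fun ω => ?_)
  · exact (S.smooth_globalObj.1.continuous.comp_aestronglyMeasurable hX.1).sub
      aestronglyMeasurable_const
  · rw [Real.norm_of_nonneg (S.gap_nonneg _)]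
    have := S.smooth_globalObj.le_quadratic xs (X ω)
    rw [S.hquasi.gradient_eq_zero, inner_zero_left] at this
    linarith

lemma condExp_state_succ_le (S : Setting f L μ δ p xs ν C P ξ) (k : ℕ) {Φ Ψ : State d n → ℝ}
    (hΦ : Measurable Φ) (hi : Integrable (fun ω => Φ (state f C x0 w0 ξ γ (k + 1) ω)) P)
    (hle : ∀ s, ∫ z, Φ (step f C γ s z) ∂(P.map (ξ k)) ≤ Ψ s) :
    ∀ᵐ ω ∂P, (P[fun ω' => Φ (state f C x0 w0 ξ γ (k + 1) ω') | history ξ k]) ω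
      ≤ Ψ (state f C x0 w0 ξ γ k ω) := by
  have h := condExp_comp_prodMk (S.hξ.history_le k)
    (S.measurable_state (x0 := x0) (w0 := w0) (γ := γ) k)
    (S.hξ.measurable k) (S.hξ.indep_history k)
    (Φ := fun q : State d n × (Fin n → Seed m Θ) => Φ (step f C γ q.1 q.2))
    (hΦ.comp (measurable_step S.hm S.hsmooth S.hC.measurable γ)).stronglyMeasurable hi
  filter_upwards [h] with ω hω
  refine le_trans (le_of_eq ?_) (hle (state f C x0 w0 ξ γ k ω))
  exact hω

lemma integral_state_succ_le (S : Setting f L μ δ p xs ν C P ξ) (k : ℕ) {Φ Ψ : State d n → ℝ}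
    (hΦ : Measurable Φ) (hi : Integrable (fun ω => Φ (state f C x0 w0 ξ γ (k + 1) ω)) P)
    (hi' : Integrable (fun ω => Ψ (state f C x0 w0 ξ γ k ω)) P)
    (hle : ∀ s, ∫ z, Φ (step f C γ s z) ∂(P.map (ξ k)) ≤ Ψ s) :
    ∫ ω, Φ (state f C x0 w0 ξ γ (k + 1) ω) ∂P ≤ ∫ ω, Ψ (state f C x0 w0 ξ γ k ω) ∂P := by
  rw [← integral_condExp (S.hξ.history_le k)]
  exact integral_mono_ae integrable_condExp hi' (S.condExp_state_succ_le k hΦ hi hle)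

variable [IsProbabilityMeasure ν]

/-- The compressor is controlled only through its residual. So the new error is shown to be square
integrable first, from the bound on its integral over the draw; the transmitted vector is then e_i +
γg_i minus the new error, which gives the new x. The new w_i is one of x and w_i. -/
lemma memLp_state (S : Setting f L μ δ p xs ν C P ξ) (k : ℕ) :
    MemLp (fun ω => (state f C x0 w0 ξ γ k ω).x) 2 P ∧
      (∀ i, MemLp (fun ω => (state f C x0 w0 ξ γ k ω).e i) 2 P) ∧
      ∀ i, MemLp (fun ω => (state f C x0 w0 ξ γ k ω).w i) 2 P := by
  induction k with
  | zero => exact ⟨memLp_const _, fun i => memLp_const _, fun i => memLp_const _⟩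
  | succ k ih =>
    obtain ⟨hx, he, hw⟩ := ih
    have hms := State.measurable_iff.1 (S.measurable_state' (x0 := x0) (w0 := w0) (γ := γ) (k + 1))
    have := Measure.isProbabilityMeasure_map (μ := P) (S.hξ.measurable k).aemeasurable
    have hg : ∀ i, MemLp (stochGrad f C x0 w0 ξ γ i k) 2 P := fun i =>
      S.memLp_stochGrad_of_memLp k hx i (hw i)
    have he' : ∀ i, MemLp (fun ω => (state f C x0 w0 ξ γ (k + 1) ω).e i) 2 P := by
      intro i
      refine (memLp_two_iff_integrable_sq_norm (hms.2.1 i).aestronglyMeasurable).2 ?_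
      refine integrable_comp_prodMk (S.hξ.history_le k) (S.measurable_state k)
        (S.hξ.measurable k) (S.hξ.indep_history k)
        (Φ := fun q : State d n × (Fin n → Seed m Θ) => ‖(step f C γ q.1 q.2).e i‖ ^ 2)
        (((((State.measurable_iff.1 (measurable_step S.hm S.hsmooth S.hC.measurable γ)).2.1
          i)).norm.pow_const 2)).stronglyMeasurable
        (fun s => integrable_norm_error_step_sq S.hC (S.hξ.map_eval k) γ s i) ?_
      have hb : Integrable (fun ω => (1 - δ) * ((1 / (m : ℝ)) * ∑ l,
          ‖(state f C x0 w0 ξ γ k ω).e i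
            + γ • gradEst f (state f C x0 w0 ξ γ k ω) i l‖ ^ 2)) P := by
        refine ((integrable_finsetSum _ fun l _ => ?_).const_mul _).const_mul _
        exact ((he i).add ((S.memLp_gradEst hx i (hw i) l).const_smul γ)).integrable_norm_pow
          two_ne_zero
      refine hb.mono' ?_ (Filter.Eventually.of_forall fun ω => ?_)
      · have h1 : StronglyMeasurable (fun q : State d n × (Fin n → Seed m Θ) =>
            ‖‖(step f C γ q.1 q.2).e i‖ ^ 2‖) :=
          (((((State.measurable_iff.1 (measurable_step S.hm S.hsmooth S.hC.measurable γ)).2.1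
          i)).norm.pow_const 2)).stronglyMeasurable.norm
        exact ((h1.integral_prod_right' (ν := P.map (ξ k))).comp_measurable
          (S.measurable_state' k)).aestronglyMeasurable
      · simp only [norm_pow, norm_norm]
        rw [Real.norm_of_nonneg (integral_nonneg fun z => by positivity)]
        exact integral_norm_error_step_sq_le S.hC S.hp0.le S.hp1.le (S.hξ.map_eval k) γ _ i
    refine ⟨?_, he', fun i => ?_⟩
    · have e : (fun ω => (state f C x0 w0 ξ γ (k + 1) ω).x) = fun ω =>
          (state f C x0 w0 ξ γ k ω).x - (1 / (n : ℝ)) • ∑ i, ((state f C x0 w0 ξ γ k ω).e i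
            + γ • stochGrad f C x0 w0 ξ γ i k ω - (state f C x0 w0 ξ γ (k + 1) ω).e i) := by
        ext1 ω
        simp only [state, step, stochGrad, sub_sub_cancel]
      rw [e]
      exact hx.sub ((memLp_finsetSum _ fun i _ =>
        ((he i).add ((hg i).const_smul γ)).sub (he' i)).const_smul (1 / (n : ℝ)))
    · refine (hx.norm.add (hw i).norm).of_le (hms.2.2 i).aestronglyMeasurable
        (Filter.Eventually.of_forall fun ω => ?_)
      simp only [state, step, Pi.add_apply]
      rw [Real.norm_of_nonneg (by positivity)]
      split_ifs
      · exact le_add_of_nonneg_right (norm_nonneg _)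
      · exact le_add_of_nonneg_left (norm_nonneg _)

lemma memLp_stochGrad (S : Setting f L μ δ p xs ν C P ξ) (i : Fin n) (k : ℕ) :
    MemLp (stochGrad f C x0 w0 ξ γ i k) 2 P :=
  S.memLp_stochGrad_of_memLp k (S.memLp_state k).1 i ((S.memLp_state k).2.2 i)

lemma memLp_average_error (S : Setting f L μ δ p xs ν C P ξ) (k : ℕ) :
    MemLp (fun ω => (1 / (n : ℝ)) • ∑ i, (state f C x0 w0 ξ γ k ω).e i) 2 P :=
  (memLp_finsetSum _ fun i _ => (S.memLp_state k).2.1 i).const_smul (1 / (n : ℝ))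

lemma integrable_gap (S : Setting f L μ δ p xs ν C P ξ) (k : ℕ) :
    Integrable (fun ω => globalObj f (state f C x0 w0 ξ γ k ω).x - globalObj f xs) P :=
  S.integrable_gap_of_memLp (S.memLp_state k).1

lemma integrable_sigmaSq (S : Setting f L μ δ p xs ν C P ξ) (k : ℕ) :
    Integrable (fun ω => sigmaSq f xs (state f C x0 w0 ξ γ k ω).w) P :=
  (integrable_finsetSum _ fun i _ => integrable_finsetSum _ fun j _ =>
    (((S.hsmooth i j).memLp_gradient ((S.memLp_state k).2.2 i)).sub
      (memLp_const (gradient (f i j) xs))).integrable_norm_pow two_ne_zero).const_mul _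

lemma integrable_average_error_sq (S : Setting f L μ δ p xs ν C P ξ) (k : ℕ) :
    Integrable (fun ω => (1 / (n : ℝ)) * ∑ i, ‖(state f C x0 w0 ξ γ k ω).e i‖ ^ 2) P :=
  (integrable_finsetSum _ fun i _ =>
    ((S.memLp_state k).2.1 i).integrable_norm_pow two_ne_zero).const_mul _

lemma integrable_norm_average_error_sq (S : Setting f L μ δ p xs ν C P ξ) (k : ℕ) :
    Integrable (fun ω => ‖(1 / (n : ℝ)) • ∑ i, (state f C x0 w0 ξ γ k ω).e i‖ ^ 2) P :=
  (S.memLp_average_error k).integrable_norm_pow two_ne_zero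

lemma integrable_virtual_sq (S : Setting f L μ δ p xs ν C P ξ) (k : ℕ) :
    Integrable (fun ω => ‖(state f C x0 w0 ξ γ k ω).virtual - xs‖ ^ 2) P :=
  (((S.memLp_state k).1.sub (S.memLp_average_error k)).sub (memLp_const xs)).integrable_norm_pow
    two_ne_zero

/-! ### One iteration of the process -/

lemma integral_sigmaSq_succ_le (S : Setting f L μ δ p xs ν C P ξ) (k : ℕ) :
    ∫ ω, sigmaSq f xs (state f C x0 w0 ξ γ (k + 1) ω).w ∂P
      ≤ (1 - p) * ∫ ω, sigmaSq f xs (state f C x0 w0 ξ γ k ω).w ∂P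
        + 2 * (L * p) * ∫ ω, (globalObj f (state f C x0 w0 ξ γ k ω).x - globalObj f xs) ∂P := by
  have h1 := (S.integrable_sigmaSq (x0 := x0) (w0 := w0) (γ := γ) k).const_mul (1 - p)
  have h2 := (S.integrable_gap (x0 := x0) (w0 := w0) (γ := γ) k).const_mul (2 * (L * p))
  rw [← integral_const_mul, ← integral_const_mul, ← integral_add h1 h2]
  exact S.integral_state_succ_le k
    (Φ := fun s => sigmaSq f xs s.w) (Ψ := fun s => (1 - p) * sigmaSq f xs s.w
      + 2 * (L * p) * (globalObj f s.x - globalObj f xs))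
    (measurable_sigmaSq S.hsmooth xs) (S.integrable_sigmaSq (k + 1)) (h1.add h2)
    fun s => integral_sigmaSq_step_le S.hL S.hn S.hm S.hconv S.hsmooth S.hquasi S.hp0.le S.hp1.le
      (S.hξ.map_eval k) C γ s

lemma integral_average_error_succ_le (S : Setting f L μ δ p xs ν C P ξ) (k : ℕ) :
    ∫ ω, (1 / (n : ℝ)) * ∑ i, ‖(state f C x0 w0 ξ γ (k + 1) ω).e i‖ ^ 2 ∂P
      ≤ (1 - δ / 2) * ∫ ω, (1 / (n : ℝ)) * ∑ i, ‖(state f C x0 w0 ξ γ k ω).e i‖ ^ 2 ∂P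
        + γ ^ 2 * ((12 / δ + 4) * L
            * ∫ ω, (globalObj f (state f C x0 w0 ξ γ k ω).x - globalObj f xs) ∂P
          + 2 * ∫ ω, sigmaSq f xs (state f C x0 w0 ξ γ k ω).w ∂P + 3 / (2 * δ) * D1 f xs) := by
  have h1 := (S.integrable_average_error_sq (x0 := x0) (w0 := w0) (γ := γ) k).const_mul (1 - δ / 2)
  have h2 := (S.integrable_gap (x0 := x0) (w0 := w0) (γ := γ) k).const_mul ((12 / δ + 4) * L)
  have h3 := (S.integrable_sigmaSq (x0 := x0) (w0 := w0) (γ := γ) k).const_mul 2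
  have h4 := integrable_const (μ := P) (3 / (2 * δ) * D1 f xs)
  have h5 := (h2.add h3).add h4
  refine (S.integral_state_succ_le k
    (Φ := fun s => (1 / (n : ℝ)) * ∑ i, ‖s.e i‖ ^ 2)
    (Ψ := fun s => (1 - δ / 2) * ((1 / (n : ℝ)) * ∑ i, ‖s.e i‖ ^ 2)
        + γ ^ 2 * ((12 / δ + 4) * L * (globalObj f s.x - globalObj f xs)
          + 2 * sigmaSq f xs s.w + 3 / (2 * δ) * D1 f xs))
    ((Finset.measurable_fun_sum _ fun i _ => (State.measurable_e i).norm.pow_const 2).const_mul _)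
    (S.integrable_average_error_sq (k + 1)) (h1.add (h5.const_mul _))
    fun s => integral_average_error_step_le S.hL S.hn S.hm S.hconv S.hsmooth S.hquasi S.hp0.le
      S.hp1.le S.hC (S.hξ.map_eval k) γ s).trans (le_of_eq ?_)
  refine (integral_add h1 (h5.const_mul _)).trans ?_
  rw [integral_const_mul (1 - δ / 2)]
  congr 1
  rw [integral_const_mul (γ ^ 2)]
  congr 1
  refine (integral_add (h2.add h3) h4).trans ?_
  congr 1
  · refine (integral_add h2 h3).trans ?_
    rw [integral_const_mul, integral_const_mul]
  · simp

lemma integral_virtual_succ_le (S : Setting f L μ δ p xs ν C P ξ) (hγ : 0 ≤ γ) (k : ℕ) :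
    ∫ ω, ‖(state f C x0 w0 ξ γ (k + 1) ω).virtual - xs‖ ^ 2 ∂P
      ≤ (1 - γ * μ / 2) * ∫ ω, ‖(state f C x0 w0 ξ γ k ω).virtual - xs‖ ^ 2 ∂P
        - γ * ∫ ω, (globalObj f (state f C x0 w0 ξ γ k ω).x - globalObj f xs) ∂P
        + 3 * L * γ * ∫ ω, ‖(1 / (n : ℝ)) • ∑ i, (state f C x0 w0 ξ γ k ω).e i‖ ^ 2 ∂P
        + γ ^ 2 * (4 * L * ∫ ω, (globalObj f (state f C x0 w0 ξ γ k ω).x - globalObj f xs) ∂P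
          + 2 * ∫ ω, sigmaSq f xs (state f C x0 w0 ξ γ k ω).w ∂P) := by
  have := Measure.isProbabilityMeasure_map (μ := P) (S.hξ.measurable k).aemeasurable
  have h1 := (S.integrable_virtual_sq (x0 := x0) (w0 := w0) (γ := γ) k).const_mul (1 - γ * μ / 2)
  have h2 := (S.integrable_gap (x0 := x0) (w0 := w0) (γ := γ) k).const_mul γ
  have h2' := (S.integrable_gap (x0 := x0) (w0 := w0) (γ := γ) k).const_mul (4 * L)
  have h3 := (S.integrable_sigmaSq (x0 := x0) (w0 := w0) (γ := γ) k).const_mul 2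
  have h4 := (S.integrable_norm_average_error_sq (x0 := x0) (w0 := w0) (γ := γ) k).const_mul
    (3 * L * γ)
  have h5 := (h2'.add h3).const_mul (γ ^ 2)
  refine (S.integral_state_succ_le k
    (Φ := fun s => ‖s.virtual - xs‖ ^ 2)
    (Ψ := fun s => (1 - γ * μ / 2) * ‖s.virtual - xs‖ ^ 2
        - γ * (globalObj f s.x - globalObj f xs)
        + 3 * L * γ * ‖(1 / (n : ℝ)) • ∑ i, s.e i‖ ^ 2
        + γ ^ 2 * (4 * L * (globalObj f s.x - globalObj f xs) + 2 * sigmaSq f xs s.w))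
    ((measurable_virtual.sub_const xs).norm.pow_const 2)
    (S.integrable_virtual_sq (k + 1)) (((h1.sub h2).add h4).add h5)
    fun s => integral_norm_virtual_step_sub_sq_le S.hL S.hn S.hm S.hconv S.hsmooth S.hquasi
      S.hp0.le S.hp1.le (S.hξ.map_eval k) hγ s).trans (le_of_eq ?_)
  refine (integral_add ((h1.sub h2).add h4) h5).trans ?_
  congr 1
  · refine (integral_add (h1.sub h2) h4).trans ?_
    rw [integral_const_mul]
    congr 1
    refine (integral_sub h1 h2).trans ?_
    rw [integral_const_mul, integral_const_mul]
  · rw [integral_const_mul]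
    congr 1
    refine (integral_add h2' h3).trans ?_
    rw [integral_const_mul, integral_const_mul]

end Setting

end Iterates

/-! ### Weighted sums of recursive sequences -/

section Weights

variable {η : ℝ}

lemma weight_pos (hη : η < 1) (k : ℕ) : 0 < weight η k :=
  inv_pos.2 (pow_pos (sub_pos.2 hη) _)

lemma weightSum_pos (hη : η < 1) (K : ℕ) : 0 < weightSum η K :=
  Finset.sum_pos (fun k _ => weight_pos hη k) ⟨0, by simp⟩

lemma one_sub_mul_weight_zero (hη : η < 1) : (1 - η) * weight η 0 = 1 := by
  have : 1 - η ≠ 0 := (sub_pos.2 hη).ne'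
  simp [weight, this]

lemma one_sub_mul_weight_succ (hη : η < 1) (k : ℕ) :
    (1 - η) * weight η (k + 1) = weight η k := by
  have : 1 - η ≠ 0 := (sub_pos.2 hη).ne'
  rw [weight, weight, pow_succ (1 - η) (k + 1)]
  field_simp

/-- After multiplication by w_k, the part (1-η)w_k of the coefficient of u_k equals w_{k-1} (or 1
for k = 0) and telescopes; the surplus a - η is what remains in front of the sum. -/
lemma weighted_sum_le_of_recursion (hη : η < 1) {a : ℝ} {u b : ℕ → ℝ}
    (hu : ∀ k, u (k + 1) ≤ (1 - a) * u k + b k) (K : ℕ) :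
    (a - η) * ∑ k ∈ Finset.range (K + 1), weight η k * u k + weight η K * u (K + 1)
      ≤ u 0 + ∑ k ∈ Finset.range (K + 1), weight η k * b k := by
  induction K with
  | zero =>
    have h1 := mul_le_mul_of_nonneg_left (hu 0) (weight_pos hη 0).le
    have h2 : (1 - η) * weight η 0 * u 0 = u 0 := by rw [one_sub_mul_weight_zero hη, one_mul]
    simp only [zero_add, Finset.range_one, Finset.sum_singleton]
    linarith
  | succ K ih =>
    rw [Finset.sum_range_succ _ (K + 1), Finset.sum_range_succ _ (K + 1)]
    have h1 := mul_le_mul_of_nonneg_left (hu (K + 1)) (weight_pos hη (K + 1)).le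
    have h2 : (1 - η) * weight η (K + 1) * u (K + 1) = weight η K * u (K + 1) := by
      rw [one_sub_mul_weight_succ hη]
    linarith

lemma inv_weightSum_le (h0 : 0 ≤ η) (hη : η < 1) (K : ℕ) : (weightSum η K)⁻¹ ≤ (1 - η) ^ K := by
  have h1 : 0 < 1 - η := sub_pos.2 hη
  have h2 : weight η K ≤ weightSum η K :=
    Finset.single_le_sum (f := weight η) (fun k _ => (weight_pos hη k).le)
      (Finset.mem_range.2 (Nat.lt_succ_self K))
  calc (weightSum η K)⁻¹ ≤ (weight η K)⁻¹ := inv_anti₀ (weight_pos hη K) h2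
    _ = (1 - η) ^ (K + 1) := inv_inv _
    _ ≤ (1 - η) ^ K := pow_le_pow_of_le_one h1.le (by linarith) (Nat.le_succ K)

lemma weightSum_zero (K : ℕ) : weightSum 0 K = K + 1 := by simp [weightSum, weight]

end Weights

/-! ### Step sizes -/

section StepSize

variable {L μ δ p γ : ℝ}

lemma rate_nonneg (hγ : 0 ≤ γ) (hμ : 0 ≤ μ) (hp : 0 ≤ p) : 0 ≤ rate γ μ p :=
  le_min (by positivity) (by positivity)

lemma rate_lt_one (hp : p < 1) : rate γ μ p < 1 := (min_le_right _ _).trans_lt (by linarith)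

lemma maxStep_pos (hL : 0 < L) (hδ : 0 < δ) (hp : p < 1) : 0 < maxStep L δ p := by
  have : 0 < 1 - p := sub_pos.2 hp
  unfold maxStep
  exact lt_min (by positivity) (by positivity)

/-- The second bound in γ₀, squared; 1/(1-p) ≥ 1 turns 2 + 1/(1-p) into 3. -/
lemma sq_bound_of_le_maxStep (hL : 0 < L) (hδ : 0 < δ) (hp0 : 0 ≤ p) (hp : p < 1) (hγ : 0 < γ)
    (h : γ ≤ maxStep L δ p) : 192 * (γ * L) ^ 2 * (2 + 9 * δ) ≤ δ ^ 2 := by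
  have h1 : 0 < 1 - p := sub_pos.2 hp
  have h2 := h.trans (min_le_right _ _)
  set q := 3 * (2 + 3 * δ * (2 + 1 / (1 - p))) with hq
  have h3 : 1 ≤ 1 / (1 - p) := by rw [le_div_iff₀ h1]; linarith
  have hq0 : 3 * (2 + 9 * δ) ≤ q := by
    rw [hq]
    nlinarith
  have hq1 : 0 < q := by positivity
  rw [le_div_iff₀ (by positivity)] at h2
  have h4 : (γ * (8 * L * √q)) ^ 2 ≤ δ ^ 2 := by gcongr
  have h5 : (γ * (8 * L * √q)) ^ 2 = 64 * (γ * L) ^ 2 * q := by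
    have := Real.sq_sqrt hq1.le
    calc _ = 64 * (γ * L) ^ 2 * (√q) ^ 2 := by ring
      _ = _ := by rw [this]
  have h6 : 64 * (γ * L) ^ 2 * (3 * (2 + 9 * δ)) ≤ 64 * (γ * L) ^ 2 * q := by gcongr
  linarith

lemma mul_le_of_le_maxStep (hL : 0 < L) (h : γ ≤ maxStep L δ p) : 24 * L * γ ≤ 1 := by
  have := h.trans (min_le_left _ _)
  rw [le_div_iff₀ (by positivity)] at this
  linarith

/-- The weights must grow more slowly than the error contracts: with η ≤ δ/16, a fixed fraction of
δ/2 survives in δ/2 - η. -/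
lemma rate_le_of_le_maxStep (hL : 0 < L) (hδ : 0 < δ) (hp0 : 0 ≤ p) (hp : p < 1) (hγ : 0 < γ)
    (h : γ ≤ maxStep L δ p) (hμ : μ ≤ L) : rate γ μ p ≤ δ / 16 := by
  have h1 := sq_bound_of_le_maxStep hL hδ hp0 hp hγ h
  have h2 : (16 * (γ * L)) ^ 2 ≤ δ ^ 2 := by
    have : 0 ≤ (γ * L) ^ 2 * δ := by positivity
    nlinarith [sq_nonneg (γ * L)]
  have h3 : 16 * (γ * L) ≤ δ := le_of_sq_le_sq h2 hδ.le
  have h4 : γ * μ ≤ γ * L := by gcongr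
  refine (min_le_left _ _).trans ?_
  linarith [mul_pos hγ hL]

lemma params_eta {d n m : ℕ} (f : Fin n → Fin m → Vec d → ℝ) (xs : Vec d) (hp : p ≤ 1) :
    (params f xs L μ δ p γ).eta γ μ = rate γ μ p := by
  simp only [Params.eta, params, rate]
  rw [min_eq_right (b := p / 4)]
  linarith

lemma F2_nonneg (hL : 0 < L) (hδ : 0 < δ) (hp0 : 0 < p) (hp : p < 1) : 0 ≤ F2 L μ δ p γ := by
  have : 0 < 1 - rate γ μ p := sub_pos.2 (rate_lt_one hp)
  unfold F2
  positivity

/-- The scalar core of the error bound, with A, R, S in the roles of error, gap and σ²: the sum of S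
is eliminated in favour of S 0 and the sum of R, and the result is inserted into the sum of A. -/
lemma error_sum_le (hL : 0 < L) (hδ : 0 < δ) (hp0 : 0 < p) (hp : p < 1) (hγ : 0 < γ) (hμ : 0 ≤ μ)
    (h : γ ≤ maxStep L δ p) (hη : rate γ μ p ≤ δ / 16) {A R S : ℕ → ℝ} {D : ℝ} (hD : 0 ≤ D)
    (hA : ∀ k, 0 ≤ A k) (hR : ∀ k, 0 ≤ R k) (hS : ∀ k, 0 ≤ S k) (hA0 : A 0 = 0)
    (hS1 : ∀ k, S (k + 1) ≤ (1 - p) * S k + 2 * (L * p) * R k)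
    (hA1 : ∀ k, A (k + 1) ≤ (1 - δ / 2) * A k
      + γ ^ 2 * ((12 / δ + 4) * L * R k + 2 * S k + 3 / (2 * δ) * D)) (K : ℕ) :
    3 * L * ∑ k ∈ Finset.range (K + 1), weight (rate γ μ p) k * A k
      ≤ 1 / 4 * ∑ k ∈ Finset.range (K + 1), weight (rate γ μ p) k * R k
        + F2 L μ δ p γ * S 0 + 12 * L * γ ^ 2 / δ ^ 2 * D * weightSum (rate γ μ p) K := by
  have hη1 := rate_lt_one (γ := γ) (μ := μ) hp
  have hη0 := rate_nonneg hγ.le hμ hp0.le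
  have hηp : rate γ μ p ≤ p / 4 := min_le_right _ _
  have hF : 72 * L * γ ^ 2 / (δ * p) ≤ F2 L μ δ p γ := by
    have h1 : 0 < 1 - rate γ μ p := sub_pos.2 hη1
    exact div_le_div_of_nonneg_left (by positivity) (by positivity)
      (mul_le_of_le_one_right (by positivity) (by linarith))
  have hsq := sq_bound_of_le_maxStep hL hδ hp0.le hp hγ h
  set η := rate γ μ p
  have e1 := weighted_sum_le_of_recursion hη1 hS1 K
  have e2 := weighted_sum_le_of_recursion hη1 hA1 K
  have w1 := mul_nonneg (weight_pos hη1 K).le (hS (K + 1))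
  have w2 := mul_nonneg (weight_pos hη1 K).le (hA (K + 1))
  have s1 : ∑ k ∈ Finset.range (K + 1), weight η k * (2 * (L * p) * R k)
      = 2 * (L * p) * ∑ k ∈ Finset.range (K + 1), weight η k * R k := by
    rw [Finset.mul_sum]; exact Finset.sum_congr rfl fun k _ => by ring
  have s2 : ∑ k ∈ Finset.range (K + 1), weight η k
        * (γ ^ 2 * ((12 / δ + 4) * L * R k + 2 * S k + 3 / (2 * δ) * D))
      = γ ^ 2 * ((12 / δ + 4) * L * ∑ k ∈ Finset.range (K + 1), weight η k * R k
        + 2 * ∑ k ∈ Finset.range (K + 1), weight η k * S k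
        + 3 / (2 * δ) * D * weightSum η K) := by
    rw [weightSum]
    simp only [Finset.mul_sum, ← Finset.sum_add_distrib]
    exact Finset.sum_congr rfl fun k _ => by ring
  rw [s1] at e1
  rw [s2, hA0] at e2
  have hWA : 0 ≤ ∑ k ∈ Finset.range (K + 1), weight η k * A k :=
    Finset.sum_nonneg fun k _ => mul_nonneg (weight_pos hη1 k).le (hA k)
  have hWR : 0 ≤ ∑ k ∈ Finset.range (K + 1), weight η k * R k :=
    Finset.sum_nonneg fun k _ => mul_nonneg (weight_pos hη1 k).le (hR k)
  have hWS : 0 ≤ ∑ k ∈ Finset.range (K + 1), weight η k * S k :=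
    Finset.sum_nonneg fun k _ => mul_nonneg (weight_pos hη1 k).le (hS k)
  have hW := (weightSum_pos hη1 K).le
  set WA := ∑ k ∈ Finset.range (K + 1), weight η k * A k
  set WR := ∑ k ∈ Finset.range (K + 1), weight η k * R k
  set WS := ∑ k ∈ Finset.range (K + 1), weight η k * S k
  set W := weightSum η K
  have hS0 := hS 0
  -- From η ≤ p/4, the surplus p - η is at least 3p/4.
  have f1 : WS ≤ 4 / (3 * p) * S 0 + 8 / 3 * L * WR := by
    have : 3 / 4 * p * WS ≤ S 0 + 2 * (L * p) * WR := by
      have : (3 / 4 * p) * WS ≤ (p - η) * WS := by gcongr; linarith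
      linarith
    have e : 4 / (3 * p) * S 0 + 8 / 3 * L * WR = (S 0 + 2 * (L * p) * WR) / (3 / 4 * p) := by
      field_simp
      ring
    rw [e, le_div_iff₀ (by positivity)]
    linarith
  -- Here δ/2 - η ≥ δ/2 - δ/16 = 7δ/16; the next factor 48L/(7δ) normalizes the left side to 3L ·
  -- WA.
  have f2 : 7 / 16 * δ * WA ≤ γ ^ 2 * ((12 / δ + 4) * L * WR + 2 * WS + 3 / (2 * δ) * D * W) := by
    have : (7 / 16 * δ) * WA ≤ (δ / 2 - η) * WA := by gcongr; linarith
    linarith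
  have f3 : 7 / 16 * δ * WA ≤ γ ^ 2 * ((12 / δ + 4) * L * WR
      + 2 * (4 / (3 * p) * S 0 + 8 / 3 * L * WR) + 3 / (2 * δ) * D * W) := by
    refine f2.trans ?_
    gcongr
  have f4 : 3 * L * WA ≤ 48 * L / (7 * δ) * (γ ^ 2 * ((12 / δ + 4) * L * WR
      + 2 * (4 / (3 * p) * S 0 + 8 / 3 * L * WR) + 3 / (2 * δ) * D * W)) := by
    have := mul_le_mul_of_nonneg_left f3 (by positivity : 0 ≤ 48 * L / (7 * δ))
    have e : 48 * L / (7 * δ) * (7 / 16 * δ * WA) = 3 * L * WA := by field_simp; ring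
    rwa [e] at this
  have e3 : 48 * L / (7 * δ) * (γ ^ 2 * ((12 / δ + 4) * L * WR
      + 2 * (4 / (3 * p) * S 0 + 8 / 3 * L * WR) + 3 / (2 * δ) * D * W))
      = 48 * (γ * L) ^ 2 * (12 + 28 / 3 * δ) / (7 * δ ^ 2) * WR
        + 128 / 7 * (L * γ ^ 2 / (δ * p)) * S 0 + 72 / 7 * (L * γ ^ 2 / δ ^ 2 * D * W) := by
    field_simp
    ring
  rw [e3] at f4
  refine f4.trans ?_
  -- Seven times the stepsize condition 192(γL)²(2 + 9δ) ≤ δ² suffices, since 12 + 28δ/3 ≤ 7(2 +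
  -- 9δ). The two constants below have room to spare: 128/7 ≤ 72 and 72/7 ≤ 12.
  have g1 : 48 * (γ * L) ^ 2 * (12 + 28 / 3 * δ) / (7 * δ ^ 2) ≤ 1 / 4 := by
    rw [div_le_iff₀ (by positivity)]
    nlinarith [sq_nonneg (γ * L), mul_nonneg (sq_nonneg (γ * L)) hδ.le]
  have g2 : 128 / 7 * (L * γ ^ 2 / (δ * p)) ≤ F2 L μ δ p γ := by
    have h0 : 0 ≤ L * γ ^ 2 / (δ * p) := by positivity
    have h1 : 72 * L * γ ^ 2 / (δ * p) = 72 * (L * γ ^ 2 / (δ * p)) := by ring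
    linarith
  have g3 : 72 / 7 * (L * γ ^ 2 / δ ^ 2 * D * W) ≤ 12 * L * γ ^ 2 / δ ^ 2 * D * W := by
    have h0 : 0 ≤ L * γ ^ 2 / δ ^ 2 * D * W := by positivity
    have h1 : 12 * L * γ ^ 2 / δ ^ 2 * D * W = 12 * (L * γ ^ 2 / δ ^ 2 * D * W) := by ring
    linarith
  gcongr

end StepSize

namespace Setting

variable {d n m : ℕ} {f : Fin n → Fin m → Vec d → ℝ} {L μ δ p : ℝ} {xs x0 : Vec d}
  {w0 : Fin n → Vec d} {Θ Ω : Type*} [MeasurableSpace Θ] [mΩ : MeasurableSpace Ω] {ν : Measure Θ}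
  {C : Θ → Vec d → Vec d} {P : Measure Ω} {ξ : ℕ → Ω → Fin n → Seed m Θ} {γ : ℝ}

/-! ### The parametric assumption -/

lemma integral_gap_nonneg (S : Setting f L μ δ p xs ν C P ξ) (X : Ω → Vec d) :
    0 ≤ ∫ ω, (globalObj f (X ω) - globalObj f xs) ∂P :=
  integral_nonneg fun ω => S.gap_nonneg (X ω)

lemma measurable_average_gradEst (S : Setting f L μ δ p xs ν C P ξ) :
    Measurable (fun q : State d n × (Fin n → Seed m Θ) =>
      (1 / (n : ℝ)) • ∑ i, gradEst f q.1 i (q.2 i).1) :=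
  (Finset.measurable_fun_sum _ fun i _ =>
    measurable_gradEst_prod S.hm S.hsmooth i).const_smul (1 / (n : ℝ))

lemma initialGap_nonneg (S : Setting f L μ δ p xs ν C P ξ) (x0 : Vec d) (w0 : Fin n → Vec d)
    (hγ : 0 ≤ γ) : 0 ≤ initialGap f xs x0 w0 L μ δ p γ := by
  have h1 := F2_nonneg (μ := μ) (γ := γ) S.hL S.hC.delta_pos S.hp0 S.hp1
  have h2 := sigmaSq_nonneg (f := f) xs w0
  have h3 := S.hp0
  unfold initialGap
  positivity

variable [IsProbabilityMeasure P]

lemma condExp_draw (S : Setting f L μ δ p xs ν C P ξ) {E : Type*} [NormedAddCommGroup E]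
    [NormedSpace ℝ E] [CompleteSpace E] (k : ℕ) {Φ : State d n × (Fin n → Seed m Θ) → E}
    (hΦ : StronglyMeasurable Φ)
    (hi : Integrable (fun ω => Φ (state f C x0 w0 ξ γ k ω, ξ k ω)) P) :
    P[fun ω => Φ (state f C x0 w0 ξ γ k ω, ξ k ω) | history ξ k]
      =ᵐ[P] fun ω => ∫ z, Φ (state f C x0 w0 ξ γ k ω, z) ∂(P.map (ξ k)) :=
  condExp_comp_prodMk (S.hξ.history_le k) (S.measurable_state k) (S.hξ.measurable k)
    (S.hξ.indep_history k) hΦ hi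

variable [IsProbabilityMeasure ν]

lemma error_bound (S : Setting f L μ δ p xs ν C P ξ) (hγ : 0 < γ) (hγ' : γ ≤ maxStep L δ p)
    (K : ℕ) :
    3 * L * ∑ k ∈ Finset.range (K + 1), weight (rate γ μ p) k
        * ∫ ω, ‖(1 / (n : ℝ)) • ∑ i, (state f C x0 w0 ξ γ k ω).e i‖ ^ 2 ∂P
      ≤ 1 / 4 * ∑ k ∈ Finset.range (K + 1), weight (rate γ μ p) k
          * ∫ ω, (globalObj f (state f C x0 w0 ξ γ k ω).x - globalObj f xs) ∂P
        + F2 L μ δ p γ * sigmaSq f xs w0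
        + 12 * L * γ ^ 2 / δ ^ 2 * D1 f xs * weightSum (rate γ μ p) K := by
  have hL := S.hL
  have hη1 := rate_lt_one (γ := γ) (μ := μ) S.hp1
  -- A nonzero vector is needed to get μ ≤ L. For d = 0 all norms vanish and the left side is zero.
  by_cases hv : ∃ v : Vec d, v ≠ 0
  · obtain ⟨v, hv⟩ := hv
    have hμL : μ ≤ L := by
      have h1 := S.hquasi.mul_norm_sq_le S.smooth_globalObj v
      exact le_of_mul_le_mul_right h1 (by positivity)
    have h0 : sigmaSq f xs w0 = ∫ ω, sigmaSq f xs (state f C x0 w0 ξ γ 0 ω).w ∂P := by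
      simp [state]
    rw [h0]
    refine le_trans ?_ (error_sum_le hL S.hC.delta_pos S.hp0 S.hp1 hγ S.hquasi.mu_nonneg hγ'
      (rate_le_of_le_maxStep hL S.hC.delta_pos S.hp0.le S.hp1 hγ hγ' hμL)
      (A := fun k => ∫ ω, (1 / (n : ℝ)) * ∑ i, ‖(state f C x0 w0 ξ γ k ω).e i‖ ^ 2 ∂P)
      (R := fun k => ∫ ω, (globalObj f (state f C x0 w0 ξ γ k ω).x - globalObj f xs) ∂P)
      (S := fun k => ∫ ω, sigmaSq f xs (state f C x0 w0 ξ γ k ω).w ∂P)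
      (D1_nonneg f xs) (fun k => integral_nonneg fun ω => by positivity)
      (fun k => S.integral_gap_nonneg _) (fun k => integral_nonneg fun ω => sigmaSq_nonneg _ _)
      (by simp [state]) S.integral_sigmaSq_succ_le S.integral_average_error_succ_le K)
    refine mul_le_mul_of_nonneg_left (Finset.sum_le_sum fun k _ => ?_) (by positivity)
    refine mul_le_mul_of_nonneg_left ?_ (weight_pos hη1 k).le
    exact integral_mono (S.integrable_norm_average_error_sq k) (S.integrable_average_error_sq k)
      fun ω => norm_average_sq_le S.hn _
  · have hz : ∀ v : Vec d, v = 0 := by simpa using hv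
    have e : ∀ v : Vec d, ‖v‖ = 0 := fun v => by rw [hz v, norm_zero]
    simp only [e]
    have h1 : 0 ≤ ∑ k ∈ Finset.range (K + 1), weight (rate γ μ p) k
          * ∫ ω, (globalObj f (state f C x0 w0 ξ γ k ω).x - globalObj f xs) ∂P :=
      Finset.sum_nonneg fun k _ => mul_nonneg (weight_pos hη1 k).le (S.integral_gap_nonneg _)
    have h2 := mul_nonneg (F2_nonneg (μ := μ) (γ := γ) hL S.hC.delta_pos S.hp0 S.hp1)
      (sigmaSq_nonneg (f := f) xs w0)
    have h3 := (weightSum_pos hη1 K).le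
    have h4 := D1_nonneg f xs
    have h5 : 0 ≤ 12 * L * γ ^ 2 / δ ^ 2 * D1 f xs * weightSum (rate γ μ p) K := by positivity
    simp only [ne_eq, OfNat.ofNat_ne_zero, not_false_eq_true, zero_pow, integral_zero, mul_zero,
      Finset.sum_const_zero]
    linarith

lemma condExp_stochGrad (S : Setting f L μ δ p xs ν C P ξ) (i : Fin n) (k : ℕ) :
    P[stochGrad f C x0 w0 ξ γ i k | history ξ k]
      =ᵐ[P] fun ω => gradient (localObj f i) (state f C x0 w0 ξ γ k ω).x := by
  have h := S.condExp_draw (x0 := x0) (w0 := w0) (γ := γ) k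
    (Φ := fun q : State d n × (Fin n → Seed m Θ) => gradEst f q.1 i (q.2 i).1)
    (measurable_gradEst_prod S.hm S.hsmooth i).stronglyMeasurable
    ((S.memLp_stochGrad i k).integrable one_le_two)
  simp only [integral_gradEst S.hm S.hsmooth S.hp0.le S.hp1.le (S.hξ.map_eval k)] at h
  exact h

lemma memLp_average_stochGrad (S : Setting f L μ δ p xs ν C P ξ) (k : ℕ) :
    MemLp (fun ω => (1 / (n : ℝ)) • ∑ i, stochGrad f C x0 w0 ξ γ i k ω) 2 P :=
  (memLp_finsetSum _ fun i _ => S.memLp_stochGrad i k).const_smul (1 / (n : ℝ))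

lemma parametricAssumption (S : Setting f L μ δ p xs ν C P ξ) (hγ : 0 < γ)
    (hγ' : γ ≤ maxStep L δ p) :
    ParametricAssumption P (history ξ) (globalObj f) xs L μ γ
      (fun k ω => (state f C x0 w0 ξ γ k ω).x)
      (stochGrad f C x0 w0 ξ γ)
      (fun i k ω => (state f C x0 w0 ξ γ k ω).e i)
      (fun _ _ => 0)
      (fun k ω => sigmaSq f xs (state f C x0 w0 ξ γ k ω).w)
      (params f xs L μ δ p γ) where
  admissible := by
    have hL := S.hL
    have hp0 := S.hp0
    have hp1 := S.hp1
    have hδ := S.hC.delta_pos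
    have hD := D1_nonneg f xs
    have hF := F2_nonneg (μ := μ) (γ := γ) hL hδ hp0 hp1
    constructor <;> simp only [params, Set.mem_Icc] <;>
      first | positivity | assumption | exact ⟨hp0.le, hp1.le⟩ | exact ⟨zero_le_one, le_rfl⟩
  adapted_x k := State.measurable_x.comp (S.measurable_state k)
  adapted_σ1 k := measurable_const
  adapted_σ2 k := (measurable_sigmaSq S.hsmooth xs).comp (S.measurable_state k)
  memLp_g i k := S.memLp_stochGrad i k
  memLp_e i k := (S.memLp_state k).2.1 i
  integrable_F k := S.integrable_gap k
  integrable_σ1 k := integrable_zero _ _ _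
  integrable_σ2 k := S.integrable_sigmaSq k
  σ1_nonneg k ω := le_rfl
  σ2_nonneg k ω := sigmaSq_nonneg _ _
  unbiased k := by
    have h := S.condExp_draw (x0 := x0) (w0 := w0) (γ := γ) k
      (Φ := fun q : State d n × (Fin n → Seed m Θ) =>
        (1 / (n : ℝ)) • ∑ i, gradEst f q.1 i (q.2 i).1)
      S.measurable_average_gradEst.stronglyMeasurable
      ((S.memLp_average_stochGrad k).integrable one_le_two)
    simp only [integral_average_gradEst S.hm S.hsmooth S.hp0.le S.hp1.le (S.hξ.map_eval k)] at h
    exact h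
  mean_bound k := by
    have h := ae_all_iff.2 fun i => S.condExp_stochGrad (x0 := x0) (w0 := w0) (γ := γ) i k
    filter_upwards [h] with ω hω
    simp only [hω, params]
    have := average_norm_gradient_localObj_sq_le one_pos S.hL S.hn S.hm S.hconv S.hsmooth S.hquasi
      (state f C x0 w0 ξ γ k ω).x
    linarith
  variance_bound k := by
    have h : ∀ i, P[fun ω' => ‖stochGrad f C x0 w0 ξ γ i k ω'
        - (P[stochGrad f C x0 w0 ξ γ i k | history ξ k]) ω'‖ ^ 2 | history ξ k]
        =ᵐ[P] fun ω => (1 / (m : ℝ)) * ∑ l, ‖gradEst f (state f C x0 w0 ξ γ k ω) i l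
          - gradient (localObj f i) (state f C x0 w0 ξ γ k ω).x‖ ^ 2 := by
      intro i
      have h1 : (fun ω' => ‖stochGrad f C x0 w0 ξ γ i k ω'
          - (P[stochGrad f C x0 w0 ξ γ i k | history ξ k]) ω'‖ ^ 2)
          =ᵐ[P] fun ω => ‖stochGrad f C x0 w0 ξ γ i k ω
            - gradient (localObj f i) (state f C x0 w0 ξ γ k ω).x‖ ^ 2 := by
        filter_upwards [S.condExp_stochGrad (x0 := x0) (w0 := w0) (γ := γ) i k] with ω hω
        rw [hω]
      refine (condExp_congr_ae h1).trans ?_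
      have hlo := isLSmooth_localObj S.hm S.hsmooth i
      have hmeas : Measurable (fun q : State d n × (Fin n → Seed m Θ) =>
          ‖gradEst f q.1 i (q.2 i).1 - gradient (localObj f i) q.1.x‖ ^ 2) :=
        ((measurable_gradEst_prod S.hm S.hsmooth i).sub
          (hlo.measurable_gradient.comp (State.measurable_x.comp measurable_fst))).norm.pow_const 2
      have h2 := S.condExp_draw (x0 := x0) (w0 := w0) (γ := γ) k hmeas.stronglyMeasurable
        (((S.memLp_stochGrad i k).sub
          (hlo.memLp_gradient (S.memLp_state k).1)).integrable_norm_pow two_ne_zero)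
      simp only [integral_norm_gradEst_sub_sq S.hp0.le S.hp1.le (S.hξ.map_eval k)] at h2
      exact h2
    filter_upwards [ae_all_iff.2 h] with ω hω
    simp only [hω, params]
    -- The proved bound 4L · gap + 2σ² is stronger than the required 24L · gap + 3σ².
    have h1 := average_variance_gradEst_le (state f C x0 w0 ξ γ k ω) S.hL S.hn S.hm S.hconv
      S.hsmooth S.hquasi
    have h2 := sigmaSq_nonneg (f := f) xs (state f C x0 w0 ξ γ k ω).w
    have h3 := mul_nonneg S.hL.le (S.gap_nonneg (state f C x0 w0 ξ γ k ω).x)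
    linarith
  second_moment_bound k := by
    have := Measure.isProbabilityMeasure_map (μ := P) (S.hξ.measurable k).aemeasurable
    have h := S.condExp_draw (x0 := x0) (w0 := w0) (γ := γ) k
      (S.measurable_average_gradEst.norm.pow_const 2).stronglyMeasurable
      ((S.memLp_average_stochGrad k).integrable_norm_pow two_ne_zero)
    filter_upwards [h] with ω hω
    refine hω.le.trans ?_
    simp only [params]
    have := integral_norm_average_gradEst_sq_le S.hL S.hn S.hm S.hconv S.hsmooth S.hquasi
      S.hp0.le S.hp1.le (S.hξ.map_eval k) (state f C x0 w0 ξ γ k ω)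
    linarith
  sigma1_bound k := by
    have : (P[fun _ : Ω => (0 : ℝ) | history ξ k]) = 0 := condExp_zero
    simp [params, this]
  sigma2_bound k :=
    S.condExp_state_succ_le k (Φ := fun s => sigmaSq f xs s.w)
      (Ψ := fun s => (1 - p) * sigmaSq f xs s.w
        + 2 * (L * p) * (globalObj f s.x - globalObj f xs))
      (measurable_sigmaSq S.hsmooth xs) (S.integrable_sigmaSq (k + 1))
      fun s => integral_sigmaSq_step_le S.hL S.hn S.hm S.hconv S.hsmooth S.hquasi S.hp0.le
        S.hp1.le (S.hξ.map_eval k) C γ s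
  error_bound K := by
    rw [params_eta f xs S.hp1.le]
    refine (S.error_bound hγ hγ' K).trans (le_of_eq ?_)
    simp only [params, state, integral_const, probReal_univ, one_smul]
    ring

/-! ### Convergence -/

/-- The weight (4/p)γ² turns the contraction of σ² into a gain 4γ²σ², which pays for 2γ²σ² from the
second moment and for at most γ²σ² from η. The gap collects 4Lγ² + 8Lγ² = 12Lγ² ≤ γ/2, so γ/2 of it
survives, and the error bound consumes γ/4 of that. -/
lemma weighted_gap_le (S : Setting f L μ δ p xs ν C P ξ) (hγ : 0 < γ)
    (hγ' : γ ≤ maxStep L δ p) (K : ℕ) :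
    ∑ k ∈ Finset.range (K + 1), weight (rate γ μ p) k
        * ∫ ω, (globalObj f (state f C x0 w0 ξ γ k ω).x - globalObj f xs) ∂P
      ≤ 4 * initialGap f xs x0 w0 L μ δ p γ / γ
        + 48 * L * γ ^ 2 / δ ^ 2 * D1 f xs * weightSum (rate γ μ p) K := by
  have hη1 := rate_lt_one (γ := γ) (μ := μ) S.hp1
  have hp0 := S.hp0
  have hL := S.hL
  have h24 := mul_le_of_le_maxStep hL hγ'
  have herr := S.error_bound (x0 := x0) (w0 := w0) hγ hγ' K
  have hμη : rate γ μ p ≤ γ * μ / 2 := min_le_left _ _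
  have hpη : rate γ μ p ≤ p / 4 := min_le_right _ _
  obtain ⟨V, hV⟩ : ∃ V : ℕ → ℝ, V = fun k =>
    ∫ ω, ‖(state f C x0 w0 ξ γ k ω).virtual - xs‖ ^ 2 ∂P := ⟨_, rfl⟩
  obtain ⟨R, hR⟩ : ∃ R : ℕ → ℝ, R = fun k =>
    ∫ ω, (globalObj f (state f C x0 w0 ξ γ k ω).x - globalObj f xs) ∂P := ⟨_, rfl⟩
  obtain ⟨T, hT⟩ : ∃ T : ℕ → ℝ, T = fun k =>
    ∫ ω, sigmaSq f xs (state f C x0 w0 ξ γ k ω).w ∂P := ⟨_, rfl⟩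
  obtain ⟨E, hE⟩ : ∃ E : ℕ → ℝ, E = fun k =>
    ∫ ω, ‖(1 / (n : ℝ)) • ∑ i, (state f C x0 w0 ξ γ k ω).e i‖ ^ 2 ∂P := ⟨_, rfl⟩
  have hV0 : ∀ k, 0 ≤ V k := fun k => by rw [hV]; exact integral_nonneg fun ω => by positivity
  have hR0 : ∀ k, 0 ≤ R k := fun k => by rw [hR]; exact S.integral_gap_nonneg _
  have hT0 : ∀ k, 0 ≤ T k := fun k => by
    rw [hT]; exact integral_nonneg fun ω => sigmaSq_nonneg _ _
  have hV1 : ∀ k, V (k + 1) ≤ (1 - γ * μ / 2) * V k - γ * R k + 3 * L * γ * E k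
      + γ ^ 2 * (4 * L * R k + 2 * T k) := fun k => by
    rw [hV, hR, hE, hT]; exact S.integral_virtual_succ_le hγ.le k
  have hT1 : ∀ k, T (k + 1) ≤ (1 - p) * T k + 2 * (L * p) * R k := fun k => by
    rw [hR, hT]; exact S.integral_sigmaSq_succ_le k
  have eV : V 0 = ‖x0 - xs‖ ^ 2 := by rw [hV]; simp [state, State.virtual]
  have eT : T 0 = sigmaSq f xs w0 := by rw [hT]; simp [state]
  -- The integrals are displayed as functions applied to k, so that they can be folded into `E` and
  -- `R`.
  change 3 * L * ∑ k ∈ Finset.range (K + 1), weight (rate γ μ p) k * (fun k =>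
    ∫ ω, ‖(1 / (n : ℝ)) • ∑ i, (state f C x0 w0 ξ γ k ω).e i‖ ^ 2 ∂P) k
      ≤ 1 / 4 * ∑ k ∈ Finset.range (K + 1), weight (rate γ μ p) k * (fun k =>
          ∫ ω, (globalObj f (state f C x0 w0 ξ γ k ω).x - globalObj f xs) ∂P) k + _ + _ at herr
  change ∑ k ∈ Finset.range (K + 1), weight (rate γ μ p) k * (fun k =>
          ∫ ω, (globalObj f (state f C x0 w0 ξ γ k ω).x - globalObj f xs) ∂P) k ≤ _
  rw [← hE, ← hR] at herr
  rw [← hR]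
  have hrec : ∀ k, V (k + 1) + 4 / p * γ ^ 2 * T (k + 1)
      ≤ (1 - rate γ μ p) * (V k + 4 / p * γ ^ 2 * T k)
        + (3 * L * γ * E k - γ / 2 * R k) := by
    intro k
    have h1 := mul_le_mul_of_nonneg_left (hT1 k) (by positivity : 0 ≤ 4 / p * γ ^ 2)
    have e1 : 4 / p * γ ^ 2 * ((1 - p) * T k + 2 * (L * p) * R k)
        = 4 / p * γ ^ 2 * T k - 4 * γ ^ 2 * T k + 8 * L * γ ^ 2 * R k := by
      field_simp
      ring
    have h2 : rate γ μ p * V k ≤ γ * μ / 2 * V k := mul_le_mul_of_nonneg_right hμη (hV0 k)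
    have h3 : rate γ μ p * (4 / p * γ ^ 2 * T k) ≤ γ ^ 2 * T k := by
      have := mul_le_mul_of_nonneg_right hpη
        (by have := hT0 k; positivity : 0 ≤ 4 / p * γ ^ 2 * T k)
      have e2 : p / 4 * (4 / p * γ ^ 2 * T k) = γ ^ 2 * T k := by field_simp
      linarith
    have h4 : 12 * L * γ ^ 2 * R k ≤ γ / 2 * R k := by
      refine mul_le_mul_of_nonneg_right ?_ (hR0 k)
      nlinarith
    have h5 : 0 ≤ γ ^ 2 * T k := mul_nonneg (sq_nonneg γ) (hT0 k)
    have := hV1 k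
    linarith
  -- The contraction factor is exactly 1 - η, so the weighted sum of the Lyapunov function has
  -- coefficient η - η = 0.
  have key := weighted_sum_le_of_recursion hη1
    (u := fun k => V k + 4 / p * γ ^ 2 * T k) hrec K
  have e3 : ∑ k ∈ Finset.range (K + 1), weight (rate γ μ p) k * (3 * L * γ * E k - γ / 2 * R k)
      = γ * (3 * L * ∑ k ∈ Finset.range (K + 1), weight (rate γ μ p) k * E k)
        - γ / 2 * ∑ k ∈ Finset.range (K + 1), weight (rate γ μ p) k * R k := by
    simp only [Finset.mul_sum, ← Finset.sum_sub_distrib]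
    exact Finset.sum_congr rfl fun k _ => by ring
  rw [sub_self, zero_mul, zero_add, e3] at key
  have hpos : 0 ≤ weight (rate γ μ p) K * (V (K + 1) + 4 / p * γ ^ 2 * T (K + 1)) := by
    have := hV0 (K + 1)
    have := hT0 (K + 1)
    have := (weight_pos hη1 K).le
    positivity
  have h6 := mul_le_mul_of_nonneg_left herr hγ.le
  simp only [eV, eT] at key
  set WR := ∑ k ∈ Finset.range (K + 1), weight (rate γ μ p) k * R k
  set W := weightSum (rate γ μ p) K
  have h7 : γ / 4 * WR ≤ initialGap f xs x0 w0 L μ δ p γ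
      + γ * (12 * L * γ ^ 2 / δ ^ 2 * D1 f xs * W) := by
    rw [initialGap]
    linarith
  have e4 : 4 * initialGap f xs x0 w0 L μ δ p γ / γ + 48 * L * γ ^ 2 / δ ^ 2 * D1 f xs * W
      = (initialGap f xs x0 w0 L μ δ p γ + γ * (12 * L * γ ^ 2 / δ ^ 2 * D1 f xs * W))
        / (γ / 4) := by
    field_simp
    ring
  rw [e4, le_div_iff₀ (by positivity)]
  linarith

lemma memLp_weightedAvg (S : Setting f L μ δ p xs ν C P ξ) (η : ℝ) (K : ℕ) :
    MemLp (fun ω => weightedAvg η (fun k => (state f C x0 w0 ξ γ k ω).x) K) 2 P :=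
  (memLp_finsetSum _ fun k _ => (S.memLp_state k).1.const_smul (weight η k)).const_smul
    (weightSum η K)⁻¹

lemma integrable_gap_weightedAvg (S : Setting f L μ δ p xs ν C P ξ) (η : ℝ) (K : ℕ) :
    Integrable (fun ω => globalObj f (weightedAvg η (fun k => (state f C x0 w0 ξ γ k ω).x) K)
      - globalObj f xs) P :=
  S.integrable_gap_of_memLp (S.memLp_weightedAvg η K)

lemma expectedGap_le_inv_weightSum (S : Setting f L μ δ p xs ν C P ξ) (hγ : 0 < γ)
    (hγ' : γ ≤ maxStep L δ p) (K : ℕ) :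
    expectedGap P f C xs x0 w0 ξ μ p γ K
      ≤ (weightSum (rate γ μ p) K)⁻¹ * (4 * initialGap f xs x0 w0 L μ δ p γ / γ)
        + 48 * L * γ ^ 2 / δ ^ 2 * D1 f xs := by
  have hη1 := rate_lt_one (γ := γ) (μ := μ) S.hp1
  have hW := weightSum_pos hη1 K
  have h1 := S.weighted_gap_le (x0 := x0) (w0 := w0) hγ hγ' K
  set η := rate γ μ p
  have jensen : expectedGap P f C xs x0 w0 ξ μ p γ K ≤ (weightSum η K)⁻¹ *
      ∑ k ∈ Finset.range (K + 1), weight η k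
        * ∫ ω, (globalObj f (state f C x0 w0 ξ γ k ω).x - globalObj f xs) ∂P := by
    have hi : ∀ k, Integrable (fun ω => weight η k *
        (globalObj f (state f C x0 w0 ξ γ k ω).x - globalObj f xs)) P := fun k =>
      (S.integrable_gap k).const_mul _
    have e : (weightSum η K)⁻¹ * ∑ k ∈ Finset.range (K + 1), weight η k
          * ∫ ω, (globalObj f (state f C x0 w0 ξ γ k ω).x - globalObj f xs) ∂P
        = ∫ ω, (weightSum η K)⁻¹ * ∑ k ∈ Finset.range (K + 1), weight η k
          * (globalObj f (state f C x0 w0 ξ γ k ω).x - globalObj f xs) ∂P := by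
      rw [integral_const_mul, integral_finsetSum _ fun k _ => hi k]
      simp only [integral_const_mul]
    rw [e]
    refine integral_mono (S.integrable_gap_weightedAvg _ K)
      ((integrable_finsetSum _ fun k _ => hi k).const_mul _) fun ω => ?_
    have hsum : ∑ k ∈ Finset.range (K + 1), (weightSum η K)⁻¹ * weight η k = 1 := by
      rw [← Finset.mul_sum]
      exact inv_mul_cancel₀ hW.ne'
    have hj := (convexOn_globalObj S.hconv).map_sum_le (t := Finset.range (K + 1))
      (w := fun k => (weightSum η K)⁻¹ * weight η k)
      (p := fun k => (state f C x0 w0 ξ γ k ω).x)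
      (fun k _ => mul_nonneg (inv_nonneg.2 hW.le) (weight_pos hη1 k).le) hsum
      (fun k _ => Set.mem_univ _)
    have ea : weightedAvg η (fun k => (state f C x0 w0 ξ γ k ω).x) K
        = ∑ k ∈ Finset.range (K + 1),
          ((weightSum η K)⁻¹ * weight η k) • (state f C x0 w0 ξ γ k ω).x := by
      rw [weightedAvg, Finset.smul_sum]
      exact Finset.sum_congr rfl fun k _ => by rw [smul_smul]
    have eb : (weightSum η K)⁻¹ * ∑ k ∈ Finset.range (K + 1), weight η k
          * (globalObj f (state f C x0 w0 ξ γ k ω).x - globalObj f xs)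
        = ∑ k ∈ Finset.range (K + 1), ((weightSum η K)⁻¹ * weight η k)
            * globalObj f (state f C x0 w0 ξ γ k ω).x - globalObj f xs := by
      simp only [mul_sub, Finset.sum_sub_distrib, Finset.mul_sum, ← mul_assoc]
      rw [← Finset.sum_mul, hsum, one_mul]
    simp only [smul_eq_mul] at hj
    rw [← ea] at hj
    simp only [eb]
    exact sub_le_sub_right hj _
  refine jensen.trans ?_
  have h2 := mul_le_mul_of_nonneg_left h1 (inv_nonneg.2 hW.le)
  refine h2.trans (le_of_eq ?_)
  rw [mul_add]
  congr 1
  field_simp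

lemma expectedGap_le_pow (S : Setting f L μ δ p xs ν C P ξ) (hγ : 0 < γ)
    (hγ' : γ ≤ maxStep L δ p) (K : ℕ) :
    expectedGap P f C xs x0 w0 ξ μ p γ K
      ≤ (1 - rate γ μ p) ^ K * (4 * initialGap f xs x0 w0 L μ δ p γ / γ)
        + 48 * L * γ ^ 2 / δ ^ 2 * D1 f xs := by
  refine (S.expectedGap_le_inv_weightSum hγ hγ' K).trans ?_
  have h1 := S.initialGap_nonneg x0 w0 hγ.le
  gcongr
  exact inv_weightSum_le (rate_nonneg hγ.le S.hquasi.mu_nonneg S.hp0.le) (rate_lt_one S.hp1) K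

lemma expectedGap_le_inv (S : Setting f L μ δ p xs ν C P ξ) (hγ : 0 < γ)
    (hγ' : γ ≤ maxStep L δ p) (hμ : μ = 0) {K : ℕ} (hK : 1 ≤ K) :
    expectedGap P f C xs x0 w0 ξ μ p γ K
      ≤ 4 * initialGap f xs x0 w0 L μ δ p γ / (γ * K)
        + 48 * L * γ ^ 2 / δ ^ 2 * D1 f xs := by
  refine (S.expectedGap_le_inv_weightSum hγ hγ' K).trans ?_
  have h1 := S.initialGap_nonneg x0 w0 hγ.le
  have hK' : (0 : ℝ) < K := by exact_mod_cast hK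
  have h2 : rate γ μ p = 0 := by
    rw [rate, hμ, mul_zero, zero_div]
    exact min_eq_left (by have := S.hp0; positivity)
  have h3 : (weightSum (rate γ μ p) K)⁻¹ ≤ (K : ℝ)⁻¹ := by
    rw [h2, weightSum_zero]
    exact inv_anti₀ hK' (by linarith)
  have e : 4 * initialGap f xs x0 w0 L μ δ p γ / (γ * K)
      = (K : ℝ)⁻¹ * (4 * initialGap f xs x0 w0 L μ δ p γ / γ) := by field_simp
  rw [e]
  gcongr

end Setting

/-! ### Explicit rates -/

section Rates

variable {L μ δ p γ : ℝ}

/-- Multiplying the expression under the root by 1 - p removes its singularity: the product is at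
most 3(2 + 9δ) ≤ 36, and 8 · 6 = 48. -/
lemma le_maxStep (hL : 0 < L) (hδ : 0 < δ) (hδ1 : δ ≤ 1) (hp0 : 0 < p) (hp : p < 1) :
    δ * √(1 - p) / (48 * L) ≤ maxStep L δ p := by
  have h1 : 0 < 1 - p := sub_pos.2 hp
  have hs : √(1 - p) ≤ 1 := Real.sqrt_le_one.2 (by linarith)
  refine le_min ?_ ?_
  · rw [div_le_div_iff₀ (by positivity) (by positivity)]
    have : δ * √(1 - p) ≤ 1 := mul_le_one₀ hδ1 (Real.sqrt_nonneg _) hs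
    nlinarith
  · set q := 3 * (2 + 3 * δ * (2 + 1 / (1 - p))) with hq
    have hq1 : 0 < q := by positivity
    have h2 : (1 - p) * q ≤ 6 ^ 2 := by
      have e : (1 - p) * q = 3 * ((1 - p) * (2 + 6 * δ) + 3 * δ) := by
        rw [hq]
        field_simp
        ring
      rw [e]
      have : (1 - p) * (2 + 6 * δ) ≤ 1 * (2 + 6 * δ) := by gcongr; linarith
      linarith
    have h3 : √(1 - p) * √q ≤ 6 := by
      rw [← Real.sqrt_mul h1.le]
      exact (Real.sqrt_le_sqrt h2).trans_eq (Real.sqrt_sq (by norm_num))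
    rw [div_le_div_iff₀ (by positivity) (by positivity)]
    calc δ * √(1 - p) * (8 * L * √q) = 8 * (δ * L) * (√(1 - p) * √q) := by ring
      _ ≤ 8 * (δ * L) * 6 := by gcongr
      _ = _ := by ring

lemma le_maxStep_of_le_half (hL : 0 < L) (hδ : 0 < δ) (hδ1 : δ ≤ 1) (hp0 : 0 < p)
    (hp : p ≤ 1 / 2) : δ / (72 * L) ≤ maxStep L δ p := by
  refine le_trans ?_ (le_maxStep hL hδ hδ1 hp0 (by linarith))
  -- As 4/9 ≤ 1/2 ≤ 1 - p; this turns 48 into 72.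
  have : 2 / 3 ≤ √(1 - p) := Real.le_sqrt_of_sq_le (by linarith)
  rw [div_le_div_iff₀ (by positivity) (by positivity)]
  nlinarith [mul_pos hδ hL]

lemma one_sub_rate_pow_le_exp (hp : p < 1) (K : ℕ) :
    (1 - rate γ μ p) ^ K ≤ Real.exp (-(rate γ μ p * K)) := by
  have h1 : 0 ≤ 1 - rate γ μ p := (sub_pos.2 (rate_lt_one hp)).le
  calc _ ≤ (Real.exp (-rate γ μ p)) ^ K := by gcongr; exact Real.one_sub_le_exp_neg _
    _ = _ := by rw [← Real.exp_nat_mul]; ring_nf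

/-- Each branch of the minimum defining the rate is matched by its own summand: `le_maxStep` and the
halving in γμ/2 give 96 = 2 · 48, while p/4 would need only 4. -/
lemma inv_rate_maxStep_le (hL : 0 < L) (hδ : 0 < δ) (hδ1 : δ ≤ 1) (hp0 : 0 < p) (hp : p < 1)
    (hμ : 0 < μ) :
    1 ≤ rate (maxStep L δ p) μ p * (96 * (1 / p + L / μ / (δ * √(1 - p)))) := by
  have h1 : 0 < √(1 - p) := Real.sqrt_pos.2 (sub_pos.2 hp)
  have h2 := le_maxStep hL hδ hδ1 hp0 hp
  have hY : 0 < L / μ / (δ * √(1 - p)) := by positivity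
  rw [rate]
  rcases min_cases (maxStep L δ p * μ / 2) (p / 4) with ⟨h, _⟩ | ⟨h, _⟩ <;> rw [h]
  · calc (1 : ℝ) = δ * √(1 - p) / (48 * L) * μ / 2 * (96 * (0 + L / μ / (δ * √(1 - p)))) := by
          field_simp
          ring
      _ ≤ _ := by
          have : 0 ≤ 1 / p := by positivity
          have := (maxStep_pos hL hδ hp).le
          gcongr
  · calc (1 : ℝ) ≤ p / 4 * (96 * (1 / p + 0)) := by
          have : p / 4 * (96 * (1 / p + 0)) = 24 := by field_simp; ring
          rw [this]; norm_num
      _ ≤ _ := by gcongr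

/-- Allows a(γ) to be replaced by a(γ₀), on which the logarithmic factor of the tuned step is built.
-/
lemma initialGap_mono {d n m : ℕ} {f : Fin n → Fin m → Vec d → ℝ} {xs x0 : Vec d}
    {w0 : Fin n → Vec d} (hL : 0 < L) (hδ : 0 < δ) (hp0 : 0 < p) (hp : p < 1) (hμ : 0 ≤ μ)
    (hγ : 0 < γ) {γ' : ℝ} (h : γ ≤ γ') :
    initialGap f xs x0 w0 L μ δ p γ ≤ initialGap f xs x0 w0 L μ δ p γ' := by
  have h1 := sigmaSq_nonneg (f := f) xs w0
  have h2 : rate γ μ p ≤ rate γ' μ p := min_le_min (by gcongr) le_rfl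
  have h3 : 0 < 1 - rate γ' μ p := sub_pos.2 (rate_lt_one hp)
  have h4 : F2 L μ δ p γ ≤ F2 L μ δ p γ' := by unfold F2; gcongr
  have h5 := F2_nonneg (μ := μ) (γ := γ) hL hδ hp0 hp
  have h6 : 0 ≤ γ' := hγ.le.trans h
  unfold initialGap
  gcongr

end Rates

/-! ### The logarithmic factor of the tuned stepsize. -/

section LogFactor

variable {d n m : ℕ} {f : Fin n → Fin m → Vec d → ℝ} {L μ δ p : ℝ} {xs x0 : Vec d}
  {w0 : Fin n → Vec d}

lemma half_le_logFactor (K : ℕ) : 1 / 2 ≤ logFactor f xs x0 w0 L μ δ p K := by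
  have h1 : Real.log 2 ≤ logFactor f xs x0 w0 L μ δ p K :=
    Real.log_le_log two_pos (le_max_left _ _)
  have := Real.log_two_gt_d9
  linarith

lemma logFactor_le {K : ℕ} {y : ℝ} (hy : 2 ≤ y)
    (h : δ ^ 2 * initialGap f xs x0 w0 L μ δ p (maxStep L δ p) * μ ^ 3 * (K : ℝ) ^ 3
      / (48 * L * D1 f xs) ≤ y) : logFactor f xs x0 w0 L μ δ p K ≤ Real.log y :=
  Real.log_le_log (lt_max_of_lt_left two_pos) (max_le hy h)

/-- The defining property of Λ: exp(-Λ) brings the initial gap down to the noise level. The second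
entry of the maximum is responsible; the entry 2 only keeps Λ away from zero. -/
lemma exp_neg_logFactor_mul_le (hL : 0 < L) (hD : 0 < D1 f xs) (K : ℕ) :
    Real.exp (-logFactor f xs x0 w0 L μ δ p K)
        * (δ ^ 2 * initialGap f xs x0 w0 L μ δ p (maxStep L δ p) * μ ^ 3 * (K : ℝ) ^ 3)
      ≤ 48 * L * D1 f xs := by
  rw [logFactor, Real.exp_neg, Real.exp_log (lt_max_of_lt_left two_pos)]
  set q := δ ^ 2 * initialGap f xs x0 w0 L μ δ p (maxStep L δ p) * μ ^ 3 * (K : ℝ) ^ 3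
  have h0 : 0 < 48 * L * D1 f xs := by positivity
  have h1 : q / (48 * L * D1 f xs) ≤ max 2 (q / (48 * L * D1 f xs)) := le_max_right _ _
  rw [inv_mul_le_iff₀ (lt_max_of_lt_left two_pos)]
  rwa [div_le_iff₀ h0] at h1

end LogFactor

/-! ### Rates for the largest and for the tuned stepsize. -/

namespace Setting

variable {d n m : ℕ} {f : Fin n → Fin m → Vec d → ℝ} {L μ δ p : ℝ} {xs x0 : Vec d}
  {w0 : Fin n → Vec d} {Θ Ω : Type*} [MeasurableSpace Θ] [mΩ : MeasurableSpace Ω] {ν : Measure Θ}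
  {C : Θ → Vec d → Vec d} {P : Measure Ω} {ξ : ℕ → Ω → Fin n → Seed m Θ} {γ : ℝ}

lemma maxStep_pos (S : Setting f L μ δ p xs ν C P ξ) : 0 < maxStep L δ p :=
  ECLSVRG.maxStep_pos S.hL S.hC.delta_pos S.hp1

/-- This is μ ≤ L ≤ L/δ, except for d = 0, where the initial gap itself vanishes. -/
lemma initialGap_mul_le (S : Setting f L μ δ p xs ν C P ξ) (x0 : Vec d) (w0 : Fin n → Vec d) :
    initialGap f xs x0 w0 L μ δ p (maxStep L δ p) * μ
      ≤ L / δ * initialGap f xs x0 w0 L μ δ p (maxStep L δ p) := by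
  by_cases hv : ∃ v : Vec d, v ≠ 0
  · obtain ⟨v, hv⟩ := hv
    have h1 := S.hquasi.mul_norm_sq_le S.smooth_globalObj v
    have hμL : μ ≤ L := le_of_mul_le_mul_right h1 (by positivity)
    have hδ := S.hC.delta_pos
    have h2 : L ≤ L / δ := le_div_self S.hL.le hδ S.hC.delta_le_one
    rw [mul_comm]
    exact mul_le_mul_of_nonneg_right (hμL.trans h2) (S.initialGap_nonneg x0 w0 S.maxStep_pos.le)
  · have hz : ∀ v : Vec d, v = 0 := by simpa using hv
    have e : ∀ v : Vec d, ‖v‖ = 0 := fun v => by rw [hz v, norm_zero]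
    have : initialGap f xs x0 w0 L μ δ p (maxStep L δ p) = 0 := by
      simp [initialGap, sigmaSq, e]
    simp [this]

variable [IsProbabilityMeasure P] [IsProbabilityMeasure ν]

lemma expectedGap_le_exp (S : Setting f L μ δ p xs ν C P ξ) (hγ : 0 < γ)
    (hγ' : γ ≤ maxStep L δ p) (K : ℕ) :
    expectedGap P f C xs x0 w0 ξ μ p γ K
      ≤ Real.exp (-(rate γ μ p * K))
          * (4 * initialGap f xs x0 w0 L μ δ p (maxStep L δ p) / γ)
        + 48 * L * γ ^ 2 / δ ^ 2 * D1 f xs := by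
  refine (S.expectedGap_le_pow hγ hγ' K).trans ?_
  have h0 := S.initialGap_nonneg x0 w0 hγ.le
  have h1 := initialGap_mono (f := f) (xs := xs) (x0 := x0) (w0 := w0) S.hL S.hC.delta_pos S.hp0
    S.hp1 S.hquasi.mu_nonneg hγ hγ'
  have h2 := one_sub_rate_pow_le_exp (γ := γ) (μ := μ) S.hp1 K
  gcongr

/-- Linear convergence to a neighbourhood. -/
lemma expectedGap_maxStep_le_of_log_le (S : Setting f L μ δ p xs ν C P ξ) (hμ : 0 < μ) {ε : ℝ}
    (hε : 0 < ε) {K : ℕ}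
    (hK : 96 * ((1 / p + L / μ / (δ * √(1 - p))) * Real.log (1 / ε)) ≤ K) (hε1 : ε < 1) :
    expectedGap P f C xs x0 w0 ξ μ p (maxStep L δ p) K
      ≤ ε * (4 * initialGap f xs x0 w0 L μ δ p (maxStep L δ p) / maxStep L δ p)
        + 96 * (L * maxStep L δ p ^ 2 * zetaSq f xs / δ ^ 2) := by
  have hγ := S.maxStep_pos
  refine (S.expectedGap_le_exp hγ le_rfl K).trans ?_
  have h0 := S.initialGap_nonneg x0 w0 hγ.le
  have h1 := inv_rate_maxStep_le S.hL S.hC.delta_pos S.hC.delta_le_one S.hp0 S.hp1 hμ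
  have h2 := rate_nonneg hγ.le hμ.le S.hp0.le
  have hlog : 0 < Real.log (1 / ε) := Real.log_pos (one_lt_one_div hε hε1)
  have h3 : Real.log (1 / ε) ≤ rate (maxStep L δ p) μ p * K := by
    calc Real.log (1 / ε) = 1 * Real.log (1 / ε) := (one_mul _).symm
      _ ≤ rate (maxStep L δ p) μ p * (96 * (1 / p + L / μ / (δ * √(1 - p)))) * Real.log (1 / ε) := by
        gcongr
      _ = rate (maxStep L δ p) μ p *
          (96 * ((1 / p + L / μ / (δ * √(1 - p))) * Real.log (1 / ε))) := by ring
      _ ≤ _ := by gcongr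
  have h4 : Real.exp (-(rate (maxStep L δ p) μ p * K)) ≤ ε := by
    calc _ ≤ Real.exp (-Real.log (1 / ε)) := Real.exp_le_exp.2 (by linarith)
      _ = ε := by rw [one_div, Real.log_inv, neg_neg, Real.exp_log hε]
  have e : 48 * L * maxStep L δ p ^ 2 / δ ^ 2 * D1 f xs
      = 96 * (L * maxStep L δ p ^ 2 * zetaSq f xs / δ ^ 2) := by rw [D1]; ring
  rw [e]
  gcongr

lemma expectedGap_maxStep_le (S : Setting f L μ δ p xs ν C P ξ) (hμ : 0 < μ) (hm : 2 ≤ m)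
    (hp : p = 1 / (m : ℝ)) (K : ℕ) :
    expectedGap P f C xs x0 w0 ξ μ p (maxStep L δ p) K
      ≤ 288 * (L / δ * initialGap f xs x0 w0 L μ δ p (maxStep L δ p)
          * Real.exp (-(min (δ * μ / L) (1 / (m : ℝ)) * K / 144)))
        + 48 * L * maxStep L δ p ^ 2 / δ ^ 2 * D1 f xs := by
  have hL := S.hL
  have hδ := S.hC.delta_pos
  have hγ := S.maxStep_pos
  have hm' : (2 : ℝ) ≤ m := by exact_mod_cast hm
  have hp2 : p ≤ 1 / 2 := by rw [hp]; gcongr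
  have hγ0 := le_maxStep_of_le_half hL hδ S.hC.delta_le_one S.hp0 hp2
  refine (S.expectedGap_le_exp hγ le_rfl K).trans ?_
  have h0 := S.initialGap_nonneg x0 w0 hγ.le
  have h1 : min (δ * μ / L) (1 / (m : ℝ)) / 144 ≤ rate (maxStep L δ p) μ p := by
    have hmin : 0 ≤ min (δ * μ / L) (1 / (m : ℝ)) := by positivity
    refine le_min ?_ ?_
    · calc _ ≤ (δ * μ / L) / 144 := by gcongr; exact min_le_left _ _
        _ = δ / (72 * L) * μ / 2 := by field_simp; ring
        _ ≤ _ := by gcongr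
    · have : min (δ * μ / L) (1 / (m : ℝ)) ≤ p := by rw [hp]; exact min_le_right _ _
      linarith [S.hp0]
  have h2 : Real.exp (-(rate (maxStep L δ p) μ p * K))
      ≤ Real.exp (-(min (δ * μ / L) (1 / (m : ℝ)) * K / 144)) := by
    refine Real.exp_le_exp.2 (neg_le_neg ?_)
    calc _ = min (δ * μ / L) (1 / (m : ℝ)) / 144 * K := by ring
      _ ≤ _ := by gcongr
  have h3 : 4 * initialGap f xs x0 w0 L μ δ p (maxStep L δ p) / maxStep L δ p
      ≤ 288 * (L / δ * initialGap f xs x0 w0 L μ δ p (maxStep L δ p)) := by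
    calc _ ≤ 4 * initialGap f xs x0 w0 L μ δ p (maxStep L δ p) / (δ / (72 * L)) := by gcongr
      _ = _ := by field_simp; ring
  have h4 := mul_le_mul h2 h3 (by positivity) (Real.exp_pos _).le
  linarith

/-- The condition 4mΛ ≤ K says that Λ/K ≤ p/4, so the rate is exactly Λ/K and the exponential factor
is exp(-Λ). -/
lemma expectedGap_logStep_le (S : Setting f L μ δ p xs ν C P ξ) (hμ : 0 < μ)
    (hp : p = 1 / (m : ℝ)) (hD : 0 < D1 f xs) {K : ℕ} (hK : 1 ≤ K)
    (hle : 2 * logFactor f xs x0 w0 L μ δ p K / (μ * K) ≤ maxStep L δ p)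
    (hm : 4 * m * logFactor f xs x0 w0 L μ δ p K ≤ K) :
    expectedGap P f C xs x0 w0 ξ μ p (2 * logFactor f xs x0 w0 L μ δ p K / (μ * K)) K
      ≤ 960 * (logFactor f xs x0 w0 L μ δ p K ^ 2 * (L * D1 f xs / (δ ^ 2 * μ ^ 2 * K ^ 2))) := by
  have hL := S.hL
  have hδ := S.hC.delta_pos
  have hK' : (0 : ℝ) < K := by exact_mod_cast hK
  have hm0 : (0 : ℝ) < m := by exact_mod_cast S.hm
  have hΛ := half_le_logFactor (f := f) (xs := xs) (x0 := x0) (w0 := w0) (L := L) (μ := μ)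
    (δ := δ) (p := p) K
  have hexp := exp_neg_logFactor_mul_le (x0 := x0) (w0 := w0) (μ := μ) (δ := δ) (p := p) hL hD K
  have ha := S.initialGap_nonneg x0 w0 S.maxStep_pos.le
  set Λ := logFactor f xs x0 w0 L μ δ p K
  have hγ : 0 < 2 * Λ / (μ * K) := by positivity
  refine (S.expectedGap_le_exp hγ hle K).trans ?_
  set a := initialGap f xs x0 w0 L μ δ p (maxStep L δ p)
  have hrate : rate (2 * Λ / (μ * K)) μ p = Λ / K := by
    have e : 2 * Λ / (μ * K) * μ / 2 = Λ / K := by field_simp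
    rw [rate, e, hp]
    refine min_eq_left ?_
    rw [div_div, div_le_div_iff₀ hK' (by positivity)]
    linarith
  rw [hrate, div_mul_cancel₀ _ hK'.ne']
  set N := L * D1 f xs / (δ ^ 2 * μ ^ 2 * K ^ 2) with hN
  have hN0 : 0 ≤ N := by positivity
  have e1 : 48 * L * (2 * Λ / (μ * K)) ^ 2 / δ ^ 2 * D1 f xs = 192 * (Λ ^ 2 * N) := by
    rw [hN]
    field_simp
    ring
  have e2 : Real.exp (-Λ) * (4 * a / (2 * Λ / (μ * K)))
      = 2 / Λ * (Real.exp (-Λ) * (δ ^ 2 * a * μ ^ 3 * K ^ 3)) / (δ ^ 2 * μ ^ 2 * K ^ 2) := by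
    field_simp
    ring
  have h1 : Real.exp (-Λ) * (4 * a / (2 * Λ / (μ * K))) ≤ 96 / Λ * N := by
    rw [e2]
    calc _ ≤ 2 / Λ * (48 * L * D1 f xs) / (δ ^ 2 * μ ^ 2 * K ^ 2) := by gcongr
      _ = _ := by rw [hN]; field_simp; ring
  -- Since Λ ≥ 1/2, Λ³ ≥ 1/8 and 768/8 = 96. The noise adds 192, so 960 results.
  have h2 : 96 / Λ ≤ 768 * Λ ^ 2 := by
    rw [div_le_iff₀ (by positivity)]
    have : (1 / 2 : ℝ) ^ 3 ≤ Λ ^ 3 := by gcongr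
    nlinarith
  have h3 := mul_le_mul_of_nonneg_right h2 hN0
  rw [e1]
  linarith

/-- The opposite regime: the coin limits the rate to p/4 = 1/(4m), but now K/Λ < 4m bounds the
factor 4a/γ = 2aμK/Λ. -/
lemma expectedGap_logStep_le_of_lt (S : Setting f L μ δ p xs ν C P ξ) (hμ : 0 < μ)
    (hp : p = 1 / (m : ℝ)) {K : ℕ} (hK : 1 ≤ K)
    (hle : 2 * logFactor f xs x0 w0 L μ δ p K / (μ * K) ≤ maxStep L δ p)
    (hm : K < 4 * m * logFactor f xs x0 w0 L μ δ p K) :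
    expectedGap P f C xs x0 w0 ξ μ p (2 * logFactor f xs x0 w0 L μ δ p K / (μ * K)) K
      ≤ Real.exp (-(K / (4 * m)))
          * (8 * m * (L / δ * initialGap f xs x0 w0 L μ δ p (maxStep L δ p)))
        + 192 * (logFactor f xs x0 w0 L μ δ p K ^ 2
          * (L * D1 f xs / (δ ^ 2 * μ ^ 2 * K ^ 2))) := by
  have hL := S.hL
  have hδ := S.hC.delta_pos
  have hK' : (0 : ℝ) < K := by exact_mod_cast hK
  have hm0 : (0 : ℝ) < m := by exact_mod_cast S.hm
  have hΛ := half_le_logFactor (f := f) (xs := xs) (x0 := x0) (w0 := w0) (L := L) (μ := μ)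
    (δ := δ) (p := p) K
  have ha := S.initialGap_nonneg x0 w0 S.maxStep_pos.le
  have haμ := S.initialGap_mul_le x0 w0
  set Λ := logFactor f xs x0 w0 L μ δ p K
  have hγ : 0 < 2 * Λ / (μ * K) := by positivity
  refine (S.expectedGap_le_exp hγ hle K).trans ?_
  set a := initialGap f xs x0 w0 L μ δ p (maxStep L δ p)
  have hrate : rate (2 * Λ / (μ * K)) μ p = 1 / (4 * m) := by
    have e : 2 * Λ / (μ * K) * μ / 2 = Λ / K := by field_simp
    have e' : 1 / (m : ℝ) / 4 = 1 / (4 * m) := by field_simp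
    rw [rate, e, hp, e']
    refine min_eq_right ?_
    rw [div_le_div_iff₀ (by positivity) hK']
    linarith
  have e0 : 1 / (4 * (m : ℝ)) * K = K / (4 * m) := by ring
  rw [hrate, e0]
  have e1 : 48 * L * (2 * Λ / (μ * K)) ^ 2 / δ ^ 2 * D1 f xs
      = 192 * (Λ ^ 2 * (L * D1 f xs / (δ ^ 2 * μ ^ 2 * K ^ 2))) := by
    field_simp
    ring
  rw [e1]
  have h1 : 4 * a / (2 * Λ / (μ * K)) ≤ 8 * m * (L / δ * a) := by
    have e2 : 4 * a / (2 * Λ / (μ * K)) = 2 * (a * μ) * (K / Λ) := by field_simp; ring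
    have h2 : K / Λ ≤ 4 * m := by
      rw [div_le_iff₀ (by positivity)]
      exact hm.le
    rw [e2]
    calc _ ≤ 2 * (a * μ) * (4 * m) := by gcongr
      _ = 8 * m * (a * μ) := by ring
      _ ≤ _ := by gcongr
  gcongr

lemma expectedGap_tunedStep_le (S : Setting f L μ δ p xs ν C P ξ) (hμ : 0 < μ) (hm : 2 ≤ m)
    (hp : p = 1 / (m : ℝ)) {K : ℕ} (hK : 1 ≤ K)
    (hmK : 4 * m * logFactor f xs x0 w0 L μ δ p K ≤ K) {c : ℝ} (hc : 960 ≤ c) :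
    expectedGap P f C xs x0 w0 ξ μ p (tunedStep f xs x0 w0 L μ δ p K) K
      ≤ c * (L / δ * initialGap f xs x0 w0 L μ δ p (maxStep L δ p)
            * Real.exp (-(min (δ * μ / L) (1 / (m : ℝ)) * K / c))
          + logFactor f xs x0 w0 L μ δ p K ^ 2 * (L * D1 f xs / (δ ^ 2 * μ ^ 2 * K ^ 2))) := by
  have hL := S.hL
  have hδ := S.hC.delta_pos
  have hK' : (0 : ℝ) < K := by exact_mod_cast hK
  have ha := S.initialGap_nonneg x0 w0 S.maxStep_pos.le
  have hD := D1_nonneg f xs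
  have hγ := S.maxStep_pos
  have hmin : 0 ≤ min (δ * μ / L) (1 / (m : ℝ)) := by positivity
  have h1 := S.expectedGap_maxStep_le (x0 := x0) (w0 := w0) hμ hm hp K
  have hexp : Real.exp (-(min (δ * μ / L) (1 / (m : ℝ)) * K / 144))
      ≤ Real.exp (-(min (δ * μ / L) (1 / (m : ℝ)) * K / c)) := by
    refine Real.exp_le_exp.2 (neg_le_neg ?_)
    gcongr
    linarith
  have h2 : 288 * (L / δ * initialGap f xs x0 w0 L μ δ p (maxStep L δ p)
          * Real.exp (-(min (δ * μ / L) (1 / (m : ℝ)) * K / 144)))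
      ≤ c * (L / δ * initialGap f xs x0 w0 L μ δ p (maxStep L δ p)
          * Real.exp (-(min (δ * μ / L) (1 / (m : ℝ)) * K / c))) := by
    gcongr
    linarith
  have hN0 : 0 ≤ L * D1 f xs / (δ ^ 2 * μ ^ 2 * K ^ 2) := by positivity
  have hN : 0 ≤ logFactor f xs x0 w0 L μ δ p K ^ 2
    * (L * D1 f xs / (δ ^ 2 * μ ^ 2 * K ^ 2)) := by positivity
  rw [mul_add]
  by_cases hD0 : D1 f xs = 0
  · rw [tunedStep, if_pos hD0]
    rw [hD0, mul_zero, add_zero] at h1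
    exact (h1.trans h2).trans (le_add_of_nonneg_right (mul_nonneg (by linarith) hN))
  · have hD1 : 0 < D1 f xs := lt_of_le_of_ne hD (Ne.symm hD0)
    rw [tunedStep, if_neg hD0]
    -- When γ₀ is the smaller step, its noise is dominated by that of the logarithmic step, because
    -- the noise is increasing in γ.
    rcases le_total (maxStep L δ p) (2 * logFactor f xs x0 w0 L μ δ p K / (μ * K)) with h | h
    · rw [min_eq_left h]
      refine h1.trans (add_le_add h2 ?_)
      calc 48 * L * maxStep L δ p ^ 2 / δ ^ 2 * D1 f xs
          ≤ 48 * L * (2 * logFactor f xs x0 w0 L μ δ p K / (μ * K)) ^ 2 / δ ^ 2 * D1 f xs := by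
            gcongr
        _ = 192 * (logFactor f xs x0 w0 L μ δ p K ^ 2
            * (L * D1 f xs / (δ ^ 2 * μ ^ 2 * K ^ 2))) := by
            field_simp
            ring
        _ ≤ _ := mul_le_mul_of_nonneg_right (by linarith) hN
    · rw [min_eq_right h]
      refine (S.expectedGap_logStep_le hμ hp hD1 hK h hmK).trans ?_
      refine (mul_le_mul_of_nonneg_right hc hN).trans (le_add_of_nonneg_left ?_)
      have : 0 ≤ c := by linarith
      positivity

end Setting

/-! ### Elementary inequalities that resolve the implicit condition on K. -/

section Logarithms

lemma one_le_log {X : ℝ} (hX : 4 ≤ X) : 1 ≤ Real.log X := by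
  rw [Real.le_log_iff_exp_le (by linarith)]
  have := Real.exp_one_lt_d9
  linarith

/-- Of the eight powers of X, six are spent on the constant 4⁶ = 4096. -/
lemma exp_neg_le_of_log_le {X t : ℝ} (hX : 4 ≤ X) (ht : 8 * Real.log X ≤ t) :
    Real.exp (-t) ≤ 1 / (4096 * X ^ 2) := by
  have hX0 : 0 < X := by linarith
  have h1 : Real.exp (8 * Real.log X) = X ^ 8 := by
    rw [← Real.exp_log hX0, Real.log_exp, ← Real.exp_nat_mul]
    norm_num
  rw [Real.exp_neg, ← one_div]
  refine one_div_le_one_div_of_le (by positivity) ?_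
  calc 4096 * X ^ 2 = 4 ^ 6 * X ^ 2 := by norm_num
    _ ≤ X ^ 6 * X ^ 2 := by gcongr
    _ = Real.exp (8 * Real.log X) := by rw [h1]; ring
    _ ≤ Real.exp t := Real.exp_le_exp.2 ht

/-- The step depends on K through Λ, so K must dominate a logarithm of itself. Here log u ≤ 2√u and
√u ≥ 1000 give 480√u ≤ 0.48u, and log X contributes at most 0.00016u. -/
lemma mul_log_sq_mul_cube_le {X u : ℝ} (hX : 4 ≤ X) (hu : 1000000 * Real.log X ≤ u) :
    80 * Real.log (X ^ 2 * u ^ 3) ≤ u := by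
  have h1 := one_le_log hX
  have hu0 : 1000000 ≤ u := by linarith
  have hu1 : 0 < u := by linarith
  have h2 : Real.log (X ^ 2 * u ^ 3) = 2 * Real.log X + 3 * Real.log u := by
    rw [Real.log_mul (by positivity) (by positivity), Real.log_pow, Real.log_pow]
    norm_num
  have h3 : 1000 ≤ √u := Real.le_sqrt_of_sq_le (by linarith)
  have h4 : Real.log u ≤ 2 * √u := by
    have h5 := Real.log_le_sub_one_of_pos (Real.sqrt_pos.2 hu1)
    rw [Real.log_sqrt hu1.le] at h5
    linarith
  have h6 : √u * √u = u := Real.mul_self_sqrt hu1.le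
  have h7 : 1000 * √u ≤ u := by nlinarith
  rw [h2]
  linarith

end Logarithms

/-! ### Iteration complexity of the tuned stepsize. -/

namespace Setting

variable {d n m : ℕ} {f : Fin n → Fin m → Vec d → ℝ} {L μ δ p : ℝ} {xs x0 : Vec d}
  {w0 : Fin n → Vec d} {Θ Ω : Type*} [MeasurableSpace Θ] [mΩ : MeasurableSpace Ω] {ν : Measure Θ}
  {C : Θ → Vec d → Vec d} {P : Measure Ω} {ξ : ℕ → Ω → Fin n → Seed m Θ}

/-- After the stated number of iterations, the logarithmic factor of the tuned step size is small
compared with the number of iterations. -/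
lemma logFactor_noise_le (S : Setting f L μ δ p xs ν C P ξ) (hμ : 0 < μ) (hD : 0 < D1 f xs)
    {ε X : ℝ} (hε : 0 < ε) (hX : 4 ≤ X)
    (hβX : √(L * zetaSq f xs) / (δ * μ * √ε) ≤ X)
    (haX : L / δ * initialGap f xs x0 w0 L μ δ p (maxStep L δ p) ≤ ε * X) {K : ℕ}
    (hK : 1000000 * (√(L * zetaSq f xs) / (δ * μ * √ε) * Real.log X) ≤ K) :
    logFactor f xs x0 w0 L μ δ p K ^ 2 * (L * D1 f xs / (δ ^ 2 * μ ^ 2 * K ^ 2))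
      ≤ ε / 3200 := by
  have hL := S.hL
  have hδ := S.hC.delta_pos
  have hζ : 0 < zetaSq f xs := by
    have : D1 f xs = 2 * zetaSq f xs := rfl
    linarith
  have haμ := S.initialGap_mul_le x0 w0
  have ha := S.initialGap_nonneg x0 w0 S.maxStep_pos.le
  have hΛ0 := half_le_logFactor (f := f) (xs := xs) (x0 := x0) (w0 := w0) (L := L) (μ := μ)
    (δ := δ) (p := p) K
  set β := √(L * zetaSq f xs) / (δ * μ * √ε) with hβ
  have hβ0 : 0 < β := by positivity
  have hβ2 : L * zetaSq f xs = β ^ 2 * ε * (δ ^ 2 * μ ^ 2) := by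
    have h1 : (√(L * zetaSq f xs)) ^ 2 = L * zetaSq f xs := Real.sq_sqrt (by positivity)
    have h2 : (√ε) ^ 2 = ε := Real.sq_sqrt hε.le
    have h3 : √(L * zetaSq f xs) = β * (δ * μ * √ε) := by rw [hβ]; field_simp
    rw [← h1, h3]
    calc _ = β ^ 2 * (√ε) ^ 2 * (δ ^ 2 * μ ^ 2) := by ring
      _ = _ := by rw [h2]
  have hLD : L * D1 f xs = 2 * (β ^ 2 * ε * (δ ^ 2 * μ ^ 2)) := by
    rw [D1, ← hβ2]; ring
  have hu : 1000000 * Real.log X ≤ K / β := by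
    rw [le_div_iff₀ hβ0]
    linarith
  have hlX := one_le_log hX
  have hu0 : 1000000 ≤ (K : ℝ) / β := by linarith
  have hK0 : (0 : ℝ) < K := by
    rw [le_div_iff₀ hβ0] at hu0
    exact lt_of_lt_of_le (by positivity) hu0
  have hΛ : logFactor f xs x0 w0 L μ δ p K ≤ Real.log (X ^ 2 * (K / β) ^ 3) := by
    refine logFactor_le ?_ ?_
    · have h1 : (1 : ℝ) ≤ (K / β) ^ 3 := one_le_pow₀ (by linarith)
      have h2 : (4 : ℝ) ^ 2 ≤ X ^ 2 := by gcongr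
      nlinarith
    · set a := initialGap f xs x0 w0 L μ δ p (maxStep L δ p)
      -- In terms of β and u = K/β the argument of the logarithm is aμβu³/(96ε), and aμ ≤ εX, β ≤ X
      -- bound it by X²u³.
      have e : δ ^ 2 * a * μ ^ 3 * K ^ 3 / (48 * L * D1 f xs)
          = a * μ * β * (K / β) ^ 3 / (96 * ε) := by
        rw [mul_assoc 48, hLD]
        field_simp
        ring
      rw [e, div_le_iff₀ (by positivity)]
      have h1 : a * μ * β ≤ ε * X * X := by
        have := haμ.trans haX
        gcongr
      calc _ ≤ ε * X * X * (K / β) ^ 3 := by gcongr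
        _ = X ^ 2 * (K / β) ^ 3 * ε := by ring
        _ ≤ X ^ 2 * (K / β) ^ 3 * (96 * ε) := by gcongr; linarith
  have h80 := mul_log_sq_mul_cube_le hX hu
  set Λ := logFactor f xs x0 w0 L μ δ p K
  have h1 : 80 * Λ ≤ K / β := by linarith
  rw [le_div_iff₀ hβ0] at h1
  -- The noise equals 2ε(Λβ/K)², and 80² / 2 = 3200.
  have e : Λ ^ 2 * (L * D1 f xs / (δ ^ 2 * μ ^ 2 * K ^ 2)) = (80 * Λ * β) ^ 2 / K ^ 2 * (ε / 3200) := by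
    rw [hLD]
    field_simp
    ring
  rw [e]
  have h2 : (80 * Λ * β) ^ 2 / K ^ 2 ≤ 1 := by
    rw [div_le_one (by positivity)]
    gcongr
  exact mul_le_of_le_one_left (by positivity) h2

variable [IsProbabilityMeasure P] [IsProbabilityMeasure ν]

lemma expectedGap_tunedStep_le_of_complexity_le (S : Setting f L μ δ p xs ν C P ξ) (hμ : 0 < μ)
    (hm : 2 ≤ m) (hp : p = 1 / (m : ℝ)) {ε : ℝ} (hε : 0 < ε) {K : ℕ}
    (hK : 1000000 * (complexity f xs L μ δ ε * Real.log (2 + complexity f xs L μ δ ε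
      + L / δ * initialGap f xs x0 w0 L μ δ p (maxStep L δ p) / ε)) ≤ K) :
    expectedGap P f C xs x0 w0 ξ μ p (tunedStep f xs x0 w0 L μ δ p K) K ≤ ε := by
  have hL := S.hL
  have hδ := S.hC.delta_pos
  have hm' : (2 : ℝ) ≤ m := by exact_mod_cast hm
  have ha := S.initialGap_nonneg x0 w0 S.maxStep_pos.le
  have hβ0 : 0 ≤ √(L * zetaSq f xs) / (δ * μ * √ε) := by positivity
  have hLδ : 0 ≤ L / (δ * μ) := by positivity
  have hcomp : complexity f xs L μ δ ε
    = m + L / (δ * μ) + √(L * zetaSq f xs) / (δ * μ * √ε) := rfl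
  have hgap0 := S.expectedGap_maxStep_le (x0 := x0) (w0 := w0) hμ hm hp K
  have hΛ := half_le_logFactor (f := f) (xs := xs) (x0 := x0) (w0 := w0) (L := L) (μ := μ)
    (δ := δ) (p := p) K
  set B := complexity f xs L μ δ ε
  have hLa0 : 0 ≤ L / δ * initialGap f xs x0 w0 L μ δ p (maxStep L δ p) / ε := by positivity
  set X := 2 + B + L / δ * initialGap f xs x0 w0 L μ δ p (maxStep L δ p) / ε with hX
  have hB2 : 2 ≤ B := by linarith
  have hX4 : 4 ≤ X := by linarith
  have hlX := one_le_log hX4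
  have haX : L / δ * initialGap f xs x0 w0 L μ δ p (maxStep L δ p) ≤ ε * X := by
    have h1 : L / δ * initialGap f xs x0 w0 L μ δ p (maxStep L δ p) / ε ≤ X := by linarith
    rw [div_le_iff₀ hε] at h1
    linarith
  have hK' : (0 : ℝ) < K := lt_of_lt_of_le (by positivity) hK
  have hK1 : 1 ≤ K := by exact_mod_cast hK'
  have hmB : (m : ℝ) ≤ B := by linarith
  have hmX : (m : ℝ) ≤ X := by linarith
  have hBX : B ≤ X := by linarith
  -- the exponential term of the largest step size
  have hfirst : 288 * (L / δ * initialGap f xs x0 w0 L μ δ p (maxStep L δ p)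
      * Real.exp (-(min (δ * μ / L) (1 / (m : ℝ)) * K / 144))) ≤ ε / 2 := by
    have hmin : 1 / B ≤ min (δ * μ / L) (1 / (m : ℝ)) := by
      refine le_min ?_ (by gcongr)
      have : δ * μ / L = 1 / (L / (δ * μ)) := by field_simp
      rw [this]
      exact one_div_le_one_div_of_le (by positivity) (by linarith)
    have h1 : 8 * Real.log X ≤ min (δ * μ / L) (1 / (m : ℝ)) * K / 144 := by
      have h2 : 1 / B * (1000000 * (B * Real.log X)) ≤ min (δ * μ / L) (1 / (m : ℝ)) * K := by
        gcongr
      have e : 1 / B * (1000000 * (B * Real.log X)) = 1000000 * Real.log X := by field_simp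
      linarith
    have h3 := exp_neg_le_of_log_le hX4 h1
    calc _ ≤ 288 * (ε * X * (1 / (4096 * X ^ 2))) := by gcongr
      _ = 288 / 4096 * ε / X := by field_simp
      _ ≤ ε / 2 := by
        rw [div_le_iff₀ (by linarith)]
        nlinarith
  by_cases hD0 : D1 f xs = 0
  · rw [tunedStep, if_pos hD0]
    rw [hD0, mul_zero, add_zero] at hgap0
    linarith
  have hD1 : 0 < D1 f xs := lt_of_le_of_ne (D1_nonneg f xs) (Ne.symm hD0)
  have hsecond := S.logFactor_noise_le hμ hD1 hε hX4 (by linarith) haX (K := K) (by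
    refine le_trans ?_ hK
    gcongr
    linarith)
  rw [tunedStep, if_neg hD0]
  rcases le_total (maxStep L δ p) (2 * logFactor f xs x0 w0 L μ δ p K / (μ * K)) with h | h
  · rw [min_eq_left h]
    have h1 : 48 * L * maxStep L δ p ^ 2 / δ ^ 2 * D1 f xs
        ≤ 192 * (logFactor f xs x0 w0 L μ δ p K ^ 2
            * (L * D1 f xs / (δ ^ 2 * μ ^ 2 * K ^ 2))) := by
      have hγ := S.maxStep_pos
      calc 48 * L * maxStep L δ p ^ 2 / δ ^ 2 * D1 f xs
          ≤ 48 * L * (2 * logFactor f xs x0 w0 L μ δ p K / (μ * K)) ^ 2 / δ ^ 2 * D1 f xs := by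
            gcongr
        _ = _ := by
            field_simp
            ring
    linarith
  · rw [min_eq_right h]
    -- The condition 4mΛ ≤ K is not assumed here. If it fails, the rate is 1/(4m), and K ≥ 10⁶ · m ·
    -- log X still makes the exponential term small.
    rcases le_or_gt (4 * m * logFactor f xs x0 w0 L μ δ p K) K with h1 | h1
    · have := S.expectedGap_logStep_le hμ hp hD1 hK1 h h1
      linarith
    · have h2 := S.expectedGap_logStep_le_of_lt hμ hp hK1 h h1
      have h3 : 8 * Real.log X ≤ K / (4 * m) := by
        rw [le_div_iff₀ (by positivity)]
        have : m * Real.log X ≤ B * Real.log X := by gcongr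
        linarith
      have h4 := exp_neg_le_of_log_le hX4 h3
      have h5 : Real.exp (-(K / (4 * m)))
          * (8 * m * (L / δ * initialGap f xs x0 w0 L μ δ p (maxStep L δ p))) ≤ ε / 2 := by
        have hX0 : 0 < X := by linarith
        calc _ ≤ 1 / (4096 * X ^ 2) * (8 * X * (ε * X)) := by gcongr
          _ = ε / 512 := by field_simp; norm_num
          _ ≤ ε / 2 := by linarith
      linarith

end Setting

end ECLSVRG

open ECLSVRG in
theorem mainTheorem8 :
    ∃ c : ℝ, 1 ≤ c ∧
    ∀ {d n m : ℕ} (_hn : 0 < n) (_hm : 0 < m)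
      (f : Fin n → Fin m → Vec d → ℝ) (L μ δ p : ℝ) (xs x0 : Vec d) (w0 : Fin n → Vec d)
      {Θ : Type*} [MeasurableSpace Θ] (ν : Measure Θ) [IsProbabilityMeasure ν]
      (C : Θ → Vec d → Vec d)
      {Ω : Type*} [MeasurableSpace Ω] (P : Measure Ω) [IsProbabilityMeasure P]
      (ξ : ℕ → Ω → Fin n → Seed m Θ)
      (_hL : 0 < L) (_hp0 : 0 < p) (_hp1 : p < 1)
      (_hconv : ∀ i j, ConvexOn ℝ Set.univ (f i j))
      (_hsmooth : ∀ i j, IsLSmooth L (f i j))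
      (_hquasi : IsQuasiStronglyConvex μ (globalObj f) xs)
      (_hC : IsCompressor ν C δ)
      (_hξ : IsSampling P p ν ξ),
      -- the parametric assumption and the convergence bounds, for every admissible stepsize
      (∀ γ : ℝ, 0 < γ → γ ≤ maxStep L δ p →
        ParametricAssumption P (history ξ) (globalObj f) xs L μ γ
          (fun k ω => (state f C x0 w0 ξ γ k ω).x)
          (stochGrad f C x0 w0 ξ γ)
          (fun i k ω => (state f C x0 w0 ξ γ k ω).e i)
          (fun _ _ => 0)
          (fun k ω => sigmaSq f xs (state f C x0 w0 ξ γ k ω).w)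
          (params f xs L μ δ p γ) ∧
        (∀ K : ℕ, Integrable (fun ω =>
          globalObj f (weightedAvg (rate γ μ p) (fun k => (state f C x0 w0 ξ γ k ω).x) K)
            - globalObj f xs) P) ∧
        (0 < μ → ∀ K : ℕ,
          expectedGap P f C xs x0 w0 ξ μ p γ K
            ≤ (1 - rate γ μ p) ^ K * (4 * initialGap f xs x0 w0 L μ δ p γ / γ)
              + 48 * L * γ ^ 2 / δ ^ 2 * D1 f xs) ∧
        (μ = 0 → ∀ K : ℕ, 1 ≤ K →
          expectedGap P f C xs x0 w0 ξ μ p γ K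
            ≤ 4 * initialGap f xs x0 w0 L μ δ p γ / (γ * K)
              + 48 * L * γ ^ 2 / δ ^ 2 * D1 f xs)) ∧
      -- linear rate to a neighbourhood, for the largest stepsize
      (0 < μ → ∀ ε : ℝ, 0 < ε → ε < 1 → ∀ K : ℕ,
        c * ((1 / p + L / μ / (δ * √(1 - p))) * Real.log (1 / ε)) ≤ K →
        expectedGap P f C xs x0 w0 ξ μ p (maxStep L δ p) K
          ≤ ε * (4 * initialGap f xs x0 w0 L μ δ p (maxStep L δ p) / maxStep L δ p)
            + 96 * (L * maxStep L δ p ^ 2 * zetaSq f xs / δ ^ 2)) ∧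
      -- the tuned stepsize, with `p = 1/m`
      (0 < μ → 2 ≤ m → p = 1 / (m : ℝ) →
        (∀ K : ℕ, 1 ≤ K → 4 * m * logFactor f xs x0 w0 L μ δ p K ≤ K →
          expectedGap P f C xs x0 w0 ξ μ p (tunedStep f xs x0 w0 L μ δ p K) K
            ≤ c * (L / δ * initialGap f xs x0 w0 L μ δ p (maxStep L δ p)
                  * Real.exp (-(min (δ * μ / L) (1 / (m : ℝ)) * K / c))
                + logFactor f xs x0 w0 L μ δ p K ^ 2 * (L * D1 f xs / (δ ^ 2 * μ ^ 2 * K ^ 2)))) ∧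
        (∀ ε : ℝ, 0 < ε → ∀ K : ℕ,
          c * (complexity f xs L μ δ ε * Real.log (2 + complexity f xs L μ δ ε
            + L / δ * initialGap f xs x0 w0 L μ δ p (maxStep L δ p) / ε)) ≤ K →
          expectedGap P f C xs x0 w0 ξ μ p (tunedStep f xs x0 w0 L μ δ p K) K ≤ ε)) := by
  -- The size comes from the complexity bound, where `mul_log_sq_mul_cube_le` asks for 10⁶; the
  -- linear rate needs only 96 and the tuned-step bound 960.
  refine ⟨1000000, by norm_num, ?_⟩
  intro d n m hn hm f L μ δ p xs x0 w0 Θ _ ν _ C Ω _ P _ ξ hL hp0 hp1 hconv hsmooth hquasi hC hξ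
  have S : Setting f L μ δ p xs ν C P ξ :=
    ⟨hn, hm, hL, hp0, hp1, hconv, hsmooth, hquasi, hC, hξ⟩
  refine ⟨fun γ hγ hγ' => ⟨S.parametricAssumption hγ hγ',
    fun K => S.integrable_gap_weightedAvg _ K, fun _ K => S.expectedGap_le_pow hγ hγ' K,
    fun hμ K hK => S.expectedGap_le_inv hγ hγ' hμ hK⟩, fun hμ ε hε hε1 K hK => ?_,
    fun hμ hm2 hpm => ⟨fun K hK hmK =>
      S.expectedGap_tunedStep_le hμ hm2 hpm hK hmK (by norm_num),
      fun ε hε K hK => S.expectedGap_tunedStep_le_of_complexity_le hμ hm2 hpm hε hK⟩⟩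
  refine S.expectedGap_maxStep_le_of_log_le hμ hε (le_trans ?_ hK) hε1
  have hlog : 0 < Real.log (1 / ε) := Real.log_pos (one_lt_one_div hε hε1)
  have hδ := hC.delta_pos
  gcongr
  norm_num
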